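/- **Groups.** A *Freed–Moore group* is a second countable Hausdorff topological group $G^\tau$ with continuous homomorphisms $\theta,\phi\colon G^\tau\to\mathbb Z_2$ and a continuous embedding of $U(1)$ as a subgroup such that $zg=g\,z^{(-1)^{\phi(g)}}$ for $z\in U(1)$, $g\in G^\tau$. Put $c=\theta+\phi$. Assume that $G^\tau$ is locally compact. Then $U(1)$ is normal, $H:=G^\tau/U(1)$ is a second countable locally compact group, and $\theta,\phi,c$ factor through $H$. For a Borel section $s\colon H\to G^\tau$ with $s(1)=1$ let $\tau\colon H\times H\to U(1)$ be the cocycle $s(g)s(h)=\tau(g,h)s(gh)$, and let $\alpha_h$ be complex conjugation on $\mathbb C$ if $\phi(h)$ is nontrivial and the identity otherwise. The *unit charge twisted group algebra* $A=C^*_{uc}(G^\tau):=\mathbb C\rtimes_{\alpha,\tau}H$ is the real $C^*$-algebra obtained by completing $L^1(H,\mathbb C)$ in the norm $\sup_{(\pi,v)}\|\int_H\pi(f(h))v_h\,dh\|$, where $(\pi,v)$ runs over the covariant representations on separable real Hilbert spaces: $\pi$ is a unital real $*$-representation of $\mathbb C$, $v$ is a Borel map to the unitary group, $v_gv_h=\pi(\tau(g,h))v_{gh}$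 and $v_h\pi(z)=\pi(\alpha_h(z))v_h$. A homomorphism $\chi\colon G^\tau\to\mathbb Z_2$ defines a grading of $A$ with grading automorphism $f\mapsto(-1)^{\chi}f$ on $L^1(H,\mathbb C)$. We write $(A,\theta)$ and $(A,c)$ for the two resulting graded algebras. **$K$-theory.** Let $B$ be a unital $\mathbb Z_2$-graded real topological algebra such as the unitization of a graded $C^*$-algebra, or its graded tensor product with a Clifford algebra. Let $\sigma=\pm1$. Consider triples $(M,J_1,J_2)$ with $M$ a finitely generated projective left $B$-module (without grading) and $J_1,J_2$ additive operators on $M$ with $J_i(bm)=(-1)^{|b|}bJ_i(m)$ and $J_i^2=\sigma$. A triple is elementary if $J_1,J_2$ are connected by a norm-continuous path of such operators. Identify $T\sim T'$ if $T\oplus E\cong T'\oplus E'$ with $E,E'$ elementary. The resulting abelian group (under $\oplus$) is the Karoubi group $K_0(B)$ if $\sigma=1$ and the group $\operatorname{SPT}^B$ of (differences of polarizations, i.e.) SPT phases protected by $B$ if $\sigma=-1$. Put $K_n(B)=K_0(Cl_{+n}\otimes B)$, where $Cl_{+n}$ is the graded real Clifford algebra on $n$ odd generators of square $+1$ and $\otimes$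 is the graded tensor product. For a not necessarily unital graded real $C^*$-algebra, $K_n$ and $\operatorname{SPT}$ denote the kernels of the maps from the groups of $A_+=\mathbb R\oplus A$ to those of $\mathbb R$. A superscript $\theta$ or $c$ names the grading used. **Opposites.** $A^{\circ}$ denotes the opposite algebra with $a^\circ b^\circ=(ba)^\circ$ (so left $A^\circ$-modules are right $A$-modules), with unchanged gradings. For a grading $\chi$, $A^{op_\chi}$ denotes the graded opposite with $a^{op}b^{op}=(-1)^{\chi(a)\chi(b)}(ba)^{op}$; gradings commuting with $\chi$ are gradings of it. **Theorem.** Let $G^\tau$ be a locally compact Freed–Moore group and $A=C^*_{uc}(G^\tau)$ (for any Borel section). The Freed–Moore $K$-theory of $G^\tau$ is isomorphic to the group of unit charge SPT phases protected by $G^\tau$, that is, $$K_0^{c}(A^{\circ})\;\cong\;\operatorname{SPT}^{A,\theta}\;\cong\;K_2^{\theta}(A^{op_\theta}).$$ The same comparison holds for the algebra $B:=A^{op_c}$, the graded opposite of $A$ with respect to $c$, with its gradings $c$ and $\theta$: $$K_0^{c}(B)\;\cong\;\operatorname{SPT}^{B,\theta}\;\cong\;K_2^{\theta}(B^{op_\theta}).$$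 All isomorphisms are isomorphisms of abelian groups. -/

import Mathlib

open scoped TensorProduct ENNReal

universe u v w

set_option linter.unusedSectionVars false

noncomputable section

namespace GradedK

/-- A `ℤ/2`-grading on a unital real topological algebra, encoded by its grading automorphism
(the involution which is `1` on the even part and `-1` on the odd part). -/
structure Grading (R : Type u) [Ring R] [Algebra ℝ R] [TopologicalSpace R] where
  hom : R →ₐ[ℝ] R
  invol : ∀ a, hom (hom a) = a
  cont : Continuous hom

namespace Grading

variable {R : Type u} [Ring R] [Algebra ℝ R] [TopologicalSpace R]

/-- The grading automorphism as a ring homomorphism. A map `T : M →ₛₗ[γ.ring] M` is a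
skew-linear operator: `T (a • m) = (-1)^|a| • a • T m` for homogeneous `a`. -/
def ring (γ : Grading R) : R →+* R := γ.hom.toRingHom

@[simp] theorem ring_apply (γ : Grading R) (a : R) : γ.ring a = γ.hom a := rfl

theorem ring_algebraMap (γ : Grading R) (r : ℝ) : γ.ring (algebraMap ℝ R r) = algebraMap ℝ R r := by
  simp

end Grading

theorem exists_retract (R : Type u) [Ring R] (M : Type v) [AddCommGroup M] [Module R M]
    [Module.Finite R M] [Module.Projective R M] :
    ∃ (n : ℕ) (i : M →ₗ[R] (Fin n → R)) (r : (Fin n → R) →ₗ[R] M), ∀ m, r (i m) = m := by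
  obtain ⟨n, r, hr⟩ := Module.Finite.exists_fin' R M
  obtain ⟨i, hi⟩ := Module.projective_lifting_property r LinearMap.id hr
  exact ⟨n, i, r, fun m => LinearMap.congr_fun hi m⟩

section Karoubi

variable {R : Type u} [Ring R] [Algebra ℝ R] [TopologicalSpace R]

/-- `SkewSq γ σ M`: skew-linear operators `J` on `M` with `J² = σ`. For `σ = 1` these are the
`ℤ/2`-gradings of the ungraded module `M`, for `σ = -1` the symmetric polarizations. -/
structure SkewSq (γ : Grading R) (σ : ℤˣ) (M : Type v) [AddCommGroup M] [Module R M] where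
  op : M →ₛₗ[γ.ring] M
  sq : ∀ m, op (op m) = (σ : ℤ) • m

/-- Continuity of a path of skew-linear operators on a finitely generated projective module `M`,
realised as a direct summand of `R ^ n`. As `M` is finitely generated over `R` and skew-linear
operators are determined by their values on generators, continuity in the operator norm is the same
as continuity of `t ↦ J t m` for every `m`, and it does not depend on the realisation. -/
def PathContinuous {γ : Grading R} {σ : ℤˣ} {M : Type v} [AddCommGroup M] [Module R M]
    (J : unitInterval → SkewSq γ σ M) : Prop :=
  ∃ (n : ℕ) (i : M →ₗ[R] (Fin n → R)) (r : (Fin n → R) →ₗ[R] M),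
    (∀ m, r (i m) = m) ∧ ∀ m, Continuous fun t => i ((J t).op m)

/-- Homotopy inside the space of skew-linear operators with square `σ`. -/
def SkewHomotopic {γ : Grading R} {σ : ℤˣ} {M : Type v} [AddCommGroup M] [Module R M]
    (J₀ J₁ : SkewSq γ σ M) : Prop :=
  ∃ J : unitInterval → SkewSq γ σ M, PathContinuous J ∧ J 0 = J₀ ∧ J 1 = J₁

/-- Triples `(M, J₁, J₂)` of a finitely generated projective module (without a grading) and
two skew-linear operators with square `σ`: Karoubi triples for `σ = 1` and formal differences of
symmetric polarizations for `σ = -1`. -/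
structure KTriple (γ : Grading R) (σ : ℤˣ) where
  M : Type v
  [grp : AddCommGroup M]
  [mod : Module R M]
  [fin : Module.Finite R M]
  [proj : Module.Projective R M]
  J₁ : SkewSq γ σ M
  J₂ : SkewSq γ σ M

attribute [instance] KTriple.grp KTriple.mod KTriple.fin KTriple.proj

namespace SkewSq

variable {γ : Grading R} {σ : ℤˣ} {M : Type v} [AddCommGroup M] [Module R M]
  {N : Type w} [AddCommGroup N] [Module R N]

@[ext] theorem ext {J J' : SkewSq γ σ M} (h : ∀ m, J.op m = J'.op m) : J = J' := by
  cases J; cases J'; congr; exact LinearMap.ext h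

/-- The direct sum of two operators. -/
def prod (J : SkewSq γ σ M) (J' : SkewSq γ σ N) : SkewSq γ σ (M × N) where
  op := { toFun := fun x => (J.op x.1, J'.op x.2)
          map_add' := fun x y => by simp
          map_smul' := fun a x => by simp }
  sq x := Prod.ext (J.sq x.1) (J'.sq x.2)

@[simp] theorem prod_apply (J : SkewSq γ σ M) (J' : SkewSq γ σ N) (x : M × N) :
    (J.prod J').op x = (J.op x.1, J'.op x.2) := rfl

end SkewSq

variable {γ : Grading R} {σ : ℤˣ} {M : Type v} [AddCommGroup M] [Module R M]
  {N : Type w} [AddCommGroup N] [Module R N]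

theorem PathContinuous.of_fintype {κ : Type*} [Fintype κ] {J : unitInterval → SkewSq γ σ M}
    (i : M →ₗ[R] (κ → R)) (r : (κ → R) →ₗ[R] M) (hr : ∀ m, r (i m) = m)
    (h : ∀ m k, Continuous fun t => i ((J t).op m) k) : PathContinuous J := by
  let e : (κ → R) ≃ₗ[R] (Fin (Fintype.card κ) → R) :=
    LinearEquiv.funCongrLeft R R (Fintype.equivFin κ).symm
  refine ⟨Fintype.card κ, e.toLinearMap ∘ₗ i, r ∘ₗ e.symm.toLinearMap, fun m => ?_, fun m => ?_⟩
  · simp [hr]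
  · exact continuous_pi fun k => h m _

theorem SkewHomotopic.refl [Module.Finite R M] [Module.Projective R M] (J : SkewSq γ σ M) :
    SkewHomotopic J J := by
  obtain ⟨n, i, r, hr⟩ := exists_retract R M
  exact ⟨fun _ => J, ⟨n, i, r, hr, fun _ => continuous_const⟩, rfl, rfl⟩

theorem SkewHomotopic.symm {J J' : SkewSq γ σ M} (h : SkewHomotopic J J') :
    SkewHomotopic J' J := by
  obtain ⟨F, ⟨n, i, r, hr, hF⟩, h0, h1⟩ := h
  exact ⟨fun t => F (unitInterval.symm t),
    ⟨n, i, r, hr, fun m => (hF m).comp unitInterval.continuous_symm⟩,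
    by simpa using h1, by simpa using h0⟩

theorem SkewHomotopic.prod {J₀ J₁ : SkewSq γ σ M} {K₀ K₁ : SkewSq γ σ N}
    (h : SkewHomotopic J₀ J₁) (h' : SkewHomotopic K₀ K₁) :
    SkewHomotopic (J₀.prod K₀) (J₁.prod K₁) := by
  obtain ⟨J, ⟨n, i, r, hr, hJ⟩, rfl, rfl⟩ := h
  obtain ⟨K, ⟨n', i', r', hr', hK⟩, rfl, rfl⟩ := h'
  let f := LinearEquiv.sumArrowLequivProdArrow (Fin n) (Fin n') R R
  refine ⟨fun t => (J t).prod (K t), PathContinuous.of_fintype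
    (f.symm.toLinearMap ∘ₗ i.prodMap i') (r.prodMap r' ∘ₗ f.toLinearMap) (fun m => ?_)
    (fun m k => ?_), rfl, rfl⟩
  · simp [hr, hr']
  · rcases k with k | k
    · exact (continuous_apply k).comp (hJ m.1)
    · exact (continuous_apply k).comp (hK m.2)

/-- The underlying real vector space of a module over a real algebra. -/
abbrev realModule (R : Type u) [Ring R] [Algebra ℝ R] (M : Type v) [AddCommGroup M] [Module R M] :
    Module ℝ M := Module.compHom M (algebraMap ℝ R)

theorem map_real_smul {S : Type*} [Ring S] [Algebra ℝ S] (f : R →+* S)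
    (hf : ∀ c, f (algebraMap ℝ R c) = algebraMap ℝ S c) {P : Type*} [AddCommGroup P] [Module S P] (T : M →ₛₗ[f] P)
    (c : ℝ) (m : M) :
    letI := realModule R M
    letI := realModule S P
    T (c • m) = c • T m := by
  change T (algebraMap ℝ R c • m) = algebraMap ℝ S c • T m
  rw [LinearMap.map_smulₛₗ, hf]

/-- The rotation of `M ⊕ M` with cosine `c` and sine `s`. -/
def rotation (R : Type u) [Ring R] [Algebra ℝ R] (M : Type v) [AddCommGroup M] [Module R M]
    (c s : ℝ) (h : c * c + s * s = 1) : (M × M) ≃ₗ[R] (M × M) :=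
  letI := realModule R M
  haveI : SMulCommClass R ℝ M := ⟨fun a c m => by
    change a • algebraMap ℝ R c • m = algebraMap ℝ R c • a • m
    simp only [smul_smul, Algebra.commutes]⟩
  { toFun := fun x => (c • x.1 + s • x.2, c • x.2 - s • x.1)
    invFun := fun x => (c • x.1 - s • x.2, c • x.2 + s • x.1)
    map_add' := fun x y => by
      ext
      · simp only [Prod.fst_add, Prod.snd_add]; module
      · simp only [Prod.fst_add, Prod.snd_add]; module
    map_smul' := fun a x => by
      ext <;> simp only [Prod.smul_fst, Prod.smul_snd, smul_add, smul_sub, RingHom.id_apply,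
        smul_comm a]
    left_inv := fun x => by
      ext
      · change c • (c • x.1 + s • x.2) - s • (c • x.2 - s • x.1) = x.1
        match_scalars <;> linarith
      · change c • (c • x.2 - s • x.1) + s • (c • x.1 + s • x.2) = x.2
        match_scalars <;> linarith
    right_inv := fun x => by
      ext
      · change c • (c • x.1 - s • x.2) + s • (c • x.2 + s • x.1) = x.1
        match_scalars <;> linarith
      · change c • (c • x.2 + s • x.1) - s • (c • x.1 - s • x.2) = x.2
        match_scalars <;> linarith }

/-- Transport of a skew-linear operator along a module isomorphism. -/
def SkewSq.conj (J : SkewSq γ σ N) (e : M ≃ₗ[R] N) : SkewSq γ σ M where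
  op := { toFun := fun m => e.symm (J.op (e m))
          map_add' := fun x y => by simp
          map_smul' := fun a x => by simp }
  sq m := by
    change e.symm (J.op (e (e.symm (J.op (e m))))) = _
    simp [J.sq]

theorem SkewHomotopic.prod_swap [IsTopologicalRing R] [ContinuousSMul ℝ R] [Module.Finite R M]
    [Module.Projective R M] (J K : SkewSq γ σ M) : SkewHomotopic (J.prod K) (K.prod J) := by
  obtain ⟨n, i, r, hr⟩ := exists_retract R M
  let f := LinearEquiv.sumArrowLequivProdArrow (Fin n) (Fin n) R R
  let c : unitInterval → ℝ := fun t => Real.cos (t * (Real.pi / 2))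
  let s : unitInterval → ℝ := fun t => Real.sin (t * (Real.pi / 2))
  have hc : Continuous c := by fun_prop
  have hs : Continuous s := by fun_prop
  have hcs : ∀ t, c t * c t + s t * s t = 1 := fun t => by
    have := Real.cos_sq_add_sin_sq (t * (Real.pi / 2)); simp only [c, s]; nlinarith
  let _ := realModule R M
  have hJ : ∀ (a : ℝ) m, J.op (a • m) = a • J.op m :=
    map_real_smul (M := M) (P := M) γ.ring γ.ring_algebraMap J.op
  have hK : ∀ (a : ℝ) m, K.op (a • m) = a • K.op m :=
    map_real_smul (M := M) (P := M) γ.ring γ.ring_algebraMap K.op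
  have hi : ∀ (a : ℝ) m, i (a • m) = a • i m := fun a m => by
    change i (algebraMap ℝ R a • m) = _
    rw [map_smul]; ext k; simp [Algebra.smul_def]
  refine ⟨fun t => (J.prod K).conj (rotation R M (c t) (s t) (hcs t)),
    PathContinuous.of_fintype (f.symm.toLinearMap ∘ₗ i.prodMap i) (r.prodMap r ∘ₗ f.toLinearMap)
    (fun m => by simp [hr]) (fun m k => ?_), ?_, ?_⟩
  · rcases k with k | k
    · change Continuous fun t =>
        i (c t • J.op (c t • m.1 + s t • m.2) - s t • K.op (c t • m.2 - s t • m.1)) k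
      simp only [map_add, map_sub, hJ, hK, hi, Pi.add_apply, Pi.sub_apply, Pi.smul_apply]
      fun_prop
    · change Continuous fun t =>
        i (c t • K.op (c t • m.2 - s t • m.1) + s t • J.op (c t • m.1 + s t • m.2)) k
      simp only [map_add, map_sub, hJ, hK, hi, Pi.add_apply, Pi.sub_apply, Pi.smul_apply]
      fun_prop
  · ext m
    · change c 0 • J.op (c 0 • m.1 + s 0 • m.2) - s 0 • K.op (c 0 • m.2 - s 0 • m.1) = J.op m.1
      simp [c, s]
    · change c 0 • K.op (c 0 • m.2 - s 0 • m.1) + s 0 • J.op (c 0 • m.1 + s 0 • m.2) = K.op m.2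
      simp [c, s]
  · ext m
    · change c 1 • J.op (c 1 • m.1 + s 1 • m.2) - s 1 • K.op (c 1 • m.2 - s 1 • m.1) = K.op m.1
      simp [c, s]
    · change c 1 • K.op (c 1 • m.2 - s 1 • m.1) + s 1 • J.op (c 1 • m.1 + s 1 • m.2) = J.op m.2
      simp [c, s]

namespace KTriple

variable {γ : Grading R} {σ : ℤˣ}

/-- A triple is elementary if its two operators are homotopic. -/
def Elementary (T : KTriple.{u, v} γ σ) : Prop := SkewHomotopic T.J₁ T.J₂

/-- Isomorphism of triples: a module isomorphism intertwining both operators. -/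
def Iso (T T' : KTriple.{u, v} γ σ) : Prop :=
  ∃ e : T.M ≃ₗ[R] T'.M,
    (∀ m, e (T.J₁.op m) = T'.J₁.op (e m)) ∧ ∀ m, e (T.J₂.op m) = T'.J₂.op (e m)

/-- Direct sum of triples. -/
def sum (T T' : KTriple.{u, v} γ σ) : KTriple.{u, v} γ σ where
  M := T.M × T'.M
  J₁ := T.J₁.prod T'.J₁
  J₂ := T.J₂.prod T'.J₂

/-- The zero triple. -/
def zero : KTriple.{u, v} γ σ where
  M := PUnit
  J₁ := ⟨0, fun _ => rfl⟩
  J₂ := ⟨0, fun _ => rfl⟩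

/-- The triple with the two operators exchanged. -/
def swap (T : KTriple.{u, v} γ σ) : KTriple.{u, v} γ σ where
  M := T.M
  J₁ := T.J₂
  J₂ := T.J₁

/-- The stable equivalence defining the group:
`T ~ T'` iff `T ⊕ E ≅ T' ⊕ E'` for some elementary `E`, `E'`. -/
def Equiv (T T' : KTriple.{u, v} γ σ) : Prop :=
  ∃ E E' : KTriple.{u, v} γ σ, E.Elementary ∧ E'.Elementary ∧ (T.sum E).Iso (T'.sum E')

theorem Iso.refl (T : KTriple.{u, v} γ σ) : T.Iso T :=
  ⟨LinearEquiv.refl R _, fun _ => rfl, fun _ => rfl⟩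

theorem Iso.symm {T T' : KTriple.{u, v} γ σ} (h : T.Iso T') : T'.Iso T := by
  obtain ⟨e, h₁, h₂⟩ := h
  refine ⟨e.symm, fun m => ?_, fun m => ?_⟩
  · apply e.injective; simp [h₁]
  · apply e.injective; simp [h₂]

theorem Iso.trans {T T' T'' : KTriple.{u, v} γ σ} (h : T.Iso T') (h' : T'.Iso T'') :
    T.Iso T'' := by
  obtain ⟨e, h₁, h₂⟩ := h
  obtain ⟨f, g₁, g₂⟩ := h'
  exact ⟨e.trans f, fun m => by simp [h₁, g₁], fun m => by simp [h₂, g₂]⟩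

theorem Iso.sum {S S' T T' : KTriple.{u, v} γ σ} (h : S.Iso S') (h' : T.Iso T') :
    (S.sum T).Iso (S'.sum T') := by
  obtain ⟨e, h₁, h₂⟩ := h
  obtain ⟨f, g₁, g₂⟩ := h'
  exact ⟨e.prodCongr f, fun m => Prod.ext (h₁ _) (g₁ _), fun m => Prod.ext (h₂ _) (g₂ _)⟩

theorem sum_comm (S T : KTriple.{u, v} γ σ) : (S.sum T).Iso (T.sum S) :=
  ⟨LinearEquiv.prodComm R _ _, fun _ => rfl, fun _ => rfl⟩

theorem sum_assoc (S T U : KTriple.{u, v} γ σ) : ((S.sum T).sum U).Iso (S.sum (T.sum U)) :=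
  ⟨LinearEquiv.prodAssoc R _ _ _, fun _ => rfl, fun _ => rfl⟩

theorem sum_zero (S : KTriple.{u, v} γ σ) : (S.sum zero).Iso S :=
  ⟨(LinearEquiv.prodUnique : (S.M × PUnit.{v+1}) ≃ₗ[R] S.M), fun _ => rfl, fun _ => rfl⟩

theorem sum_sum_comm (S T U V : KTriple.{u, v} γ σ) :
    ((S.sum T).sum (U.sum V)).Iso ((S.sum U).sum (T.sum V)) :=
  ⟨LinearEquiv.prodProdProdComm R _ _ _ _, fun _ => rfl, fun _ => rfl⟩

theorem zero_elementary : (zero : KTriple.{u, v} γ σ).Elementary :=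
  SkewHomotopic.refl (R := R) _

theorem Elementary.sum {S T : KTriple.{u, v} γ σ} (hS : S.Elementary) (hT : T.Elementary) :
    (S.sum T).Elementary :=
  SkewHomotopic.prod hS hT

theorem Elementary.swap {S : KTriple.{u, v} γ σ} (hS : S.Elementary) : S.swap.Elementary :=
  SkewHomotopic.symm hS

theorem Equiv.refl (T : KTriple.{u, v} γ σ) : T.Equiv T :=
  ⟨zero, zero, zero_elementary, zero_elementary, Iso.refl _⟩

theorem Equiv.symm {T T' : KTriple.{u, v} γ σ} (h : T.Equiv T') : T'.Equiv T := by
  obtain ⟨E, E', hE, hE', h⟩ := h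
  exact ⟨E', E, hE', hE, h.symm⟩

theorem Equiv.trans {T T' T'' : KTriple.{u, v} γ σ} (h : T.Equiv T') (h' : T'.Equiv T'') :
    T.Equiv T'' := by
  obtain ⟨E, E', hE, hE', h⟩ := h
  obtain ⟨F, F', hF, hF', h'⟩ := h'
  refine ⟨E.sum F, F'.sum E', hE.sum hF, hF'.sum hE', ?_⟩
  refine (sum_assoc _ _ _).symm.trans ((h.sum (Iso.refl F)).trans ?_)
  refine (sum_assoc _ _ _).trans (((Iso.refl T').sum (sum_comm E' F)).trans ?_)
  refine (sum_assoc _ _ _).symm.trans ((h'.sum (Iso.refl E')).trans (sum_assoc _ _ _))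

theorem Iso.equiv {T T' : KTriple.{u, v} γ σ} (h : T.Iso T') : T.Equiv T' :=
  ⟨zero, zero, zero_elementary, zero_elementary, h.sum (Iso.refl _)⟩

theorem Equiv.sum {S S' T T' : KTriple.{u, v} γ σ} (h : S.Equiv S') (h' : T.Equiv T') :
    (S.sum T).Equiv (S'.sum T') := by
  obtain ⟨E, E', hE, hE', h⟩ := h
  obtain ⟨F, F', hF, hF', h'⟩ := h'
  exact ⟨E.sum F, E'.sum F', hE.sum hF, hE'.sum hF',
    (sum_sum_comm _ _ _ _).trans ((h.sum h').trans (sum_sum_comm _ _ _ _))⟩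

theorem Elementary.equiv_zero {E : KTriple.{u, v} γ σ} (h : E.Elementary) : E.Equiv zero :=
  ⟨zero, E, zero_elementary, h, sum_comm _ _⟩

theorem Equiv.swap {S S' : KTriple.{u, v} γ σ} (h : S.Equiv S') : S.swap.Equiv S'.swap := by
  obtain ⟨E, E', hE, hE', e, h, h'⟩ := h
  exact ⟨E.swap, E'.swap, hE.swap, hE'.swap, e, h', h⟩

theorem sum_swap_equiv_zero [IsTopologicalRing R] [ContinuousSMul ℝ R] (T : KTriple.{u, v} γ σ) :
    (T.swap.sum T).Equiv zero :=
  Elementary.equiv_zero (SkewHomotopic.prod_swap T.J₂ T.J₁)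

/-- Stable equivalence of triples. -/
instance setoid (γ : Grading R) (σ : ℤˣ) : Setoid (KTriple.{u, v} γ σ) where
  r := Equiv
  iseqv := ⟨Equiv.refl, Equiv.symm, Equiv.trans⟩

end KTriple

/-- The group of stable equivalence classes of triples under direct sum: for `σ = 1` the Karoubi
`K`-theory group, for `σ = -1` the group of SPT phases, of a unital graded algebra. -/
def KUnital (γ : Grading R) (σ : ℤˣ) : Type (max u (v + 1)) :=
  Quotient (KTriple.setoid.{u, v} γ σ)

instance (γ : Grading R) (σ : ℤˣ) : Zero (KUnital.{u, v} γ σ) :=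
  ⟨Quotient.mk _ KTriple.zero⟩

instance (γ : Grading R) (σ : ℤˣ) : Add (KUnital.{u, v} γ σ) :=
  ⟨Quotient.map₂ KTriple.sum fun _ _ h _ _ h' => KTriple.Equiv.sum h h'⟩

instance (γ : Grading R) (σ : ℤˣ) : Neg (KUnital.{u, v} γ σ) :=
  ⟨Quotient.map KTriple.swap fun _ _ h => KTriple.Equiv.swap h⟩

instance (γ : Grading R) (σ : ℤˣ) [IsTopologicalRing R] [ContinuousSMul ℝ R] :
    AddCommGroup (KUnital.{u, v} γ σ) where
  add_assoc := by
    rintro ⟨a⟩ ⟨b⟩ ⟨c⟩; exact Quotient.sound (KTriple.sum_assoc a b c).equiv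
  zero_add := by
    rintro ⟨a⟩
    exact Quotient.sound ((KTriple.sum_comm _ _).trans (KTriple.sum_zero a)).equiv
  add_zero := by rintro ⟨a⟩; exact Quotient.sound (KTriple.sum_zero a).equiv
  add_comm := by rintro ⟨a⟩ ⟨b⟩; exact Quotient.sound (KTriple.sum_comm a b).equiv
  neg_add_cancel := by rintro ⟨a⟩; exact Quotient.sound (KTriple.sum_swap_equiv_zero a)
  nsmul := nsmulRec
  zsmul := zsmulRec

end Karoubi


section BaseChange

variable {R : Type u} [Ring R] {S : Type w} [Ring S] (f : R →+* S)
  (M : Type v) [AddCommGroup M] [Module R M]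

/-- The relations `s f(r) ⊗ m = s ⊗ r m`. -/
def BaseChange.relations : Submodule S (S ⊗[ℤ] M) :=
  Submodule.span S {x | ∃ (s : S) (r : R) (m : M), x = (s * f r) ⊗ₜ[ℤ] m - s ⊗ₜ[ℤ] (r • m)}

/-- The base change `S ⊗_R M` of a left module along a ring homomorphism `f : R → S` of not
necessarily commutative rings. -/
def BaseChange : Type (max v w) := (S ⊗[ℤ] M) ⧸ BaseChange.relations f M

namespace BaseChange

instance : AddCommGroup (BaseChange f M) :=
  inferInstanceAs (AddCommGroup ((S ⊗[ℤ] M) ⧸ BaseChange.relations f M))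

instance : Module S (BaseChange f M) :=
  inferInstanceAs (Module S ((S ⊗[ℤ] M) ⧸ BaseChange.relations f M))

variable {M}

/-- The class of `s ⊗ m`. -/
def tmul (s : S) (m : M) : BaseChange f M := Submodule.Quotient.mk (s ⊗ₜ[ℤ] m)

theorem smul_tmul (s s' : S) (m : M) : s • tmul f s' m = tmul f (s * s') m := rfl

theorem tmul_add (s : S) (m m' : M) : tmul f s (m + m') = tmul f s m + tmul f s m' := by
  simp only [tmul, TensorProduct.tmul_add]; rfl

theorem tmul_smul (s : S) (r : R) (m : M) : tmul f s (r • m) = tmul f (s * f r) m := by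
  refine ((Submodule.Quotient.eq (BaseChange.relations f M)).2 ?_).symm
  exact Submodule.subset_span ⟨s, r, m, rfl⟩

/-- The canonical map `m ↦ 1 ⊗ m`. -/
def ι : M →ₛₗ[f] BaseChange f M where
  toFun := tmul f 1
  map_add' := tmul_add f 1
  map_smul' r m := by rw [tmul_smul, smul_tmul, one_mul, mul_one]

theorem tmul_eq (s : S) (m : M) : tmul f s m = s • ι f m := by
  change _ = s • tmul f 1 m
  rw [smul_tmul, mul_one]

variable {f}

theorem induction {P : BaseChange f M → Prop} (x : BaseChange f M) (h0 : P 0)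
    (ht : ∀ (s : S) (m : M), P (s • ι f m)) (ha : ∀ x y, P x → P y → P (x + y)) : P x := by
  obtain ⟨x, rfl⟩ := Submodule.Quotient.mk_surjective _ x
  induction x with
  | zero => exact h0
  | tmul s m => have := ht s m; rw [← tmul_eq] at this; exact this
  | add x y hx hy => exact ha _ _ hx hy

variable {S' : Type*} [Ring S'] {N : Type*} [AddCommGroup N] [Module S' N]

theorem hom_ext {ψ : S →+* S'} {g h : BaseChange f M →ₛₗ[ψ] N}
    (H : ∀ m, g (ι f m) = h (ι f m)) : g = h := by
  ext x
  induction x using induction with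
  | h0 => simp
  | ht s m => simp [H]
  | ha x y hx hy => simp [hx, hy]

/-- The universal property of base change. -/
def lift (ψ : S →+* S') (g : M →+ N) (hg : ∀ (r : R) m, g (r • m) = ψ (f r) • g m) :
    BaseChange f M →ₛₗ[ψ] N :=
  let b : S →+ M →+ N := AddMonoidHom.mk' (fun s => (DistribSMul.toAddMonoidHom N (ψ s)).comp g)
    fun s s' => by ext m; simp [add_smul]
  let t : (S ⊗[ℤ] M) →ₛₗ[ψ] N :=
    { toFun := TensorProduct.liftAddHom b fun c s m => by
        change ψ (c • s) • g m = ψ s • g (c • m)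
        rw [map_zsmul, map_zsmul, smul_assoc, smul_comm]
      map_add' := map_add _
      map_smul' := fun s x => by
        induction x with
        | zero => simp
        | tmul s' m => simp [b, TensorProduct.smul_tmul', mul_smul]
        | add x y hx hy => simp only [smul_add, map_add, hx, hy] }
  (BaseChange.relations f M).liftQ t <| by
    refine Submodule.span_le.2 ?_
    rintro _ ⟨s, r, m, rfl⟩
    simp [t, b, hg, mul_smul]

@[simp] theorem lift_ι (ψ : S →+* S') (g : M →+ N) (hg : ∀ (r : R) m, g (r • m) = ψ (f r) • g m)
    (m : M) : lift ψ g hg (ι f m) = g m := by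
  change ψ 1 • g m = g m
  simp

variable (f) in
theorem exists_retract_of {n : ℕ} (i : M →ₗ[R] (Fin n → R)) (r : (Fin n → R) →ₗ[R] M)
    (h : ∀ m, r (i m) = m) :
    ∃ (i' : BaseChange f M →ₗ[S] (Fin n → S)) (r' : (Fin n → S) →ₗ[S] BaseChange f M),
      (∀ x, r' (i' x) = x) ∧ ∀ m, i' (ι f m) = fun k => f (i m k) := by
  let i' : BaseChange f M →ₗ[S] (Fin n → S) :=
    lift (RingHom.id S) (AddMonoidHom.mk' (fun m k => f (i m k)) fun x y => by ext; simp)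
      fun a m => by ext; simp
  let r' : (Fin n → S) →ₗ[S] BaseChange f M :=
    Fintype.linearCombination S fun k => ι f (r (Pi.single k 1))
  refine ⟨i', r', fun x => ?_, fun m => lift_ι _ _ _ m⟩
  have : r' ∘ₗ i' = LinearMap.id := by
    refine hom_ext fun m => ?_
    have h1 : i' (ι f m) = fun k => f (i m k) := lift_ι _ _ _ m
    rw [LinearMap.comp_apply, h1]
    conv_rhs => rw [LinearMap.id_apply, ← h m, ← Finset.univ_sum_single (i m), map_sum, map_sum]
    simp only [r', Fintype.linearCombination_apply]
    refine Finset.sum_congr rfl fun k _ => ?_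
    rw [← LinearMap.map_smulₛₗ, ← map_smul]
    congr 2
    ext l; by_cases hl : l = k
    · subst hl; simp
    · simp [hl]
  exact LinearMap.congr_fun this x

instance [Module.Finite R M] [Module.Projective R M] : Module.Finite S (BaseChange f M) := by
  obtain ⟨n, i, r, h⟩ := exists_retract R M
  obtain ⟨i', r', h', -⟩ := exists_retract_of f i r h
  exact Module.Finite.of_surjective r' fun x => ⟨i' x, h' x⟩

instance [Module.Finite R M] [Module.Projective R M] : Module.Projective S (BaseChange f M) := by
  obtain ⟨n, i, r, h⟩ := exists_retract R M
  obtain ⟨i', r', h', -⟩ := exists_retract_of f i r h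
  exact Module.Projective.of_split i' r' (LinearMap.ext h')

variable {M' : Type v} [AddCommGroup M'] [Module R M']

/-- Functoriality of base change. -/
def map (e : M →ₗ[R] M') : BaseChange f M →ₗ[S] BaseChange f M' :=
  lift (RingHom.id S) ((ι f).toAddMonoidHom.comp e.toAddMonoidHom) fun a m => by simp

@[simp] theorem map_ι (e : M →ₗ[R] M') (m : M) : map e (ι f m) = ι f (e m) := lift_ι _ _ _ m

/-- Base change preserves isomorphisms. -/
def congr (e : M ≃ₗ[R] M') : BaseChange f M ≃ₗ[S] BaseChange f M' :=
  LinearEquiv.ofLinearMap (map e.toLinearMap) (map e.symm.toLinearMap)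
    (hom_ext fun m => by simp) (hom_ext fun m => by simp)

@[simp] theorem congr_ι (e : M ≃ₗ[R] M') (m : M) : congr e (ι f m) = ι f (e m) := map_ι _ m

variable (f M M') in
/-- Base change preserves direct sums. -/
def prodEquiv : BaseChange f (M × M') ≃ₗ[S] BaseChange f M × BaseChange f M' :=
  LinearEquiv.ofLinearMap
    ((map (LinearMap.fst R M M')).prod (map (LinearMap.snd R M M')))
    ((map (LinearMap.inl R M M')).coprod (map (LinearMap.inr R M M')))
    (by
      apply LinearMap.prod_ext <;> refine hom_ext fun m => ?_ <;> simp)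
    (hom_ext fun m => by simp [← map_add])

theorem prodEquiv_ι (m : M × M') : prodEquiv f M M' (ι f m) = (ι f m.1, ι f m.2) := by
  simp [prodEquiv]

end BaseChange

end BaseChange

/-- Continuous homomorphisms of graded algebras. -/
structure GradedHom {R : Type u} [Ring R] [Algebra ℝ R] [TopologicalSpace R] (γ : Grading R)
    {S : Type w} [Ring S] [Algebra ℝ S] [TopologicalSpace S] (δ : Grading S) where
  hom : R →ₐ[ℝ] S
  cont : Continuous hom
  comm : ∀ a, hom (γ.hom a) = δ.hom (hom a)

/-- The underlying ring homomorphism. -/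
def GradedHom.ring {R : Type u} [Ring R] [Algebra ℝ R] [TopologicalSpace R] {γ : Grading R}
    {S : Type w} [Ring S] [Algebra ℝ S] [TopologicalSpace S] {δ : Grading S}
    (f : GradedHom γ δ) : R →+* S := f.hom.toRingHom

section Functoriality

variable {R : Type u} [Ring R] [Algebra ℝ R] [TopologicalSpace R] {γ : Grading R}
  {S : Type w} [Ring S] [Algebra ℝ S] [TopologicalSpace S] {δ : Grading S}
  (f : GradedHom γ δ) {σ : ℤˣ}

/-- The base change of a skew-linear operator `T`, given by `s ⊗ m ↦ δ(s) ⊗ T m`. -/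
def SkewSq.baseChangeOp {M : Type v} [AddCommGroup M] [Module R M] (J : SkewSq γ σ M) :
    BaseChange f.ring M →ₛₗ[δ.ring] BaseChange f.ring M :=
  BaseChange.lift δ.ring ((BaseChange.ι f.ring).toAddMonoidHom.comp J.op.toAddMonoidHom)
    fun r m => by
      change BaseChange.ι f.ring (J.op (r • m)) = δ.ring (f.ring r) • BaseChange.ι f.ring (J.op m)
      rw [LinearMap.map_smulₛₗ, LinearMap.map_smulₛₗ]
      congr 1
      exact f.comm r

theorem SkewSq.baseChangeOp_ι {M : Type v} [AddCommGroup M] [Module R M] (J : SkewSq γ σ M)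
    (m : M) : J.baseChangeOp f (BaseChange.ι f.ring m) = BaseChange.ι f.ring (J.op m) :=
  BaseChange.lift_ι _ _ _ m

/-- The base change of a skew-linear operator with square `σ`. -/
def SkewSq.baseChange {M : Type v} [AddCommGroup M] [Module R M] (J : SkewSq γ σ M) :
    SkewSq δ σ (BaseChange f.ring M) where
  op := J.baseChangeOp f
  sq x := by
    induction x using BaseChange.induction with
    | h0 => simp only [map_zero, smul_zero]
    | ht s m =>
      rw [LinearMap.map_smulₛₗ, LinearMap.map_smulₛₗ, baseChangeOp_ι, baseChangeOp_ι, J.sq,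
        map_zsmul, smul_comm]
      congr 2
      exact δ.invol s
    | ha x y hx hy => simp only [map_add, hx, hy, smul_add]

theorem SkewSq.baseChange_smul_ι {M : Type v} [AddCommGroup M] [Module R M] (J : SkewSq γ σ M)
    (s : S) (m : M) : (J.baseChange f).op (s • BaseChange.ι f.ring m) =
      δ.ring s • BaseChange.ι f.ring (J.op m) := by
  rw [LinearMap.map_smulₛₗ]
  exact congrArg _ (J.baseChangeOp_ι f m)

theorem SkewSq.baseChange_prod {M N : Type v} [AddCommGroup M] [Module R M] [AddCommGroup N]
    [Module R N] (J : SkewSq γ σ M) (K : SkewSq γ σ N) (x : BaseChange f.ring (M × N)) :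
    BaseChange.prodEquiv f.ring M N (((J.prod K).baseChange f).op x) =
      ((J.baseChange f).prod (K.baseChange f)).op (BaseChange.prodEquiv f.ring M N x) := by
  induction x using BaseChange.induction with
  | h0 => simp only [map_zero]
  | ht s m =>
    rw [baseChange_smul_ι, map_smul, map_smul, BaseChange.prodEquiv_ι, BaseChange.prodEquiv_ι]
    ext
    · exact (baseChange_smul_ι f J s m.1).symm
    · exact (baseChange_smul_ι f K s m.2).symm
  | ha x y hx hy => simp only [map_add, hx, hy]

theorem SkewSq.baseChange_congr {M N : Type v} [AddCommGroup M] [Module R M] [AddCommGroup N]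
    [Module R N] (J : SkewSq γ σ M) (K : SkewSq γ σ N) (e : M ≃ₗ[R] N)
    (h : ∀ m, e (J.op m) = K.op (e m)) (x : BaseChange f.ring M) :
    BaseChange.congr e ((J.baseChange f).op x) = (K.baseChange f).op (BaseChange.congr e x) := by
  induction x using BaseChange.induction with
  | h0 => simp only [map_zero]
  | ht s m =>
    rw [baseChange_smul_ι, map_smul, map_smul, BaseChange.congr_ι, BaseChange.congr_ι,
      baseChange_smul_ι, h]
  | ha x y hx hy => simp only [map_add, hx, hy]

theorem SkewHomotopic.baseChange [IsTopologicalRing S] {M : Type v} [AddCommGroup M] [Module R M]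
    {J K : SkewSq γ σ M} (h : SkewHomotopic J K) :
    SkewHomotopic (J.baseChange f) (K.baseChange f) := by
  obtain ⟨F, ⟨n, i, r, hr, hF⟩, rfl, rfl⟩ := h
  obtain ⟨i', r', h', hi'⟩ := BaseChange.exists_retract_of f.ring i r hr
  refine ⟨fun t => (F t).baseChange f, ⟨n, i', r', h', fun x => ?_⟩, rfl, rfl⟩
  induction x using BaseChange.induction with
  | h0 => simpa only [map_zero] using continuous_const
  | ht s m =>
    simp only [SkewSq.baseChange_smul_ι, map_smul, hi']
    refine continuous_pi fun k => continuous_const.mul ?_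
    exact f.cont.comp ((continuous_apply k).comp (hF m))
  | ha x y hx hy =>
    simp only [map_add]
    exact hx.add hy

/-- The base change of a triple. -/
def KTriple.baseChange (T : KTriple.{u, v} γ σ) : KTriple.{w, max v w} δ σ where
  M := BaseChange f.ring T.M
  J₁ := T.J₁.baseChange f
  J₂ := T.J₂.baseChange f

theorem KTriple.baseChange_sum (T T' : KTriple.{u, v} γ σ) :
    ((T.sum T').baseChange f).Iso ((T.baseChange f).sum (T'.baseChange f)) :=
  ⟨BaseChange.prodEquiv f.ring T.M T'.M, SkewSq.baseChange_prod f T.J₁ T'.J₁,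
    SkewSq.baseChange_prod f T.J₂ T'.J₂⟩

theorem KTriple.Iso.baseChange {T T' : KTriple.{u, v} γ σ} (h : T.Iso T') :
    (T.baseChange f).Iso (T'.baseChange f) := by
  obtain ⟨e, h₁, h₂⟩ := h
  exact ⟨BaseChange.congr e, SkewSq.baseChange_congr f T.J₁ T'.J₁ e h₁,
    SkewSq.baseChange_congr f T.J₂ T'.J₂ e h₂⟩

theorem KTriple.Equiv.baseChange [IsTopologicalRing S] {T T' : KTriple.{u, v} γ σ}
    (h : T.Equiv T') : (T.baseChange f).Equiv (T'.baseChange f) := by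
  obtain ⟨E, E', hE, hE', h⟩ := h
  exact ⟨E.baseChange f, E'.baseChange f, SkewHomotopic.baseChange f hE,
    SkewHomotopic.baseChange f hE',
    (baseChange_sum f _ _).symm.trans ((h.baseChange f).trans (baseChange_sum f _ _))⟩

/-- The homomorphism of `K`-groups induced by a graded homomorphism. -/
def KUnital.map (σ : ℤˣ) [IsTopologicalRing R] [ContinuousSMul ℝ R] [IsTopologicalRing S]
    [ContinuousSMul ℝ S] : KUnital.{u, v} γ σ →+ KUnital.{w, max v w} δ σ :=
  AddMonoidHom.mk'
    (Quotient.map (KTriple.baseChange f) fun _ _ h => KTriple.Equiv.baseChange f h)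
    (by
      rintro ⟨a⟩ ⟨b⟩
      exact Quotient.sound (KTriple.baseChange_sum f a b).equiv)

end Functoriality


/-- The real numbers, purely even. -/
def Grading.real : Grading ℝ where
  hom := AlgHom.id ℝ ℝ
  invol _ := rfl
  cont := continuous_id

section Clifford

variable {R : Type u} [Ring R] [Algebra ℝ R] [TopologicalSpace R]

/-- The graded tensor product `Cl₊₁ ⊗ R` with the real Clifford algebra on one odd generator `e`
with `e² = 1`. The pair `(a, b)` is the element `a + b e`, and `e a = γ(a) e`,
that is, `e a = (-1)^|a| a e` for homogeneous `a`. -/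
@[ext] structure Cl (γ : Grading R) where
  fst : R
  snd : R

namespace Cl

variable {γ : Grading R}

/-- The underlying pair. -/
def equiv (γ : Grading R) : Cl γ ≃ R × R where
  toFun x := (x.fst, x.snd)
  invFun x := ⟨x.1, x.2⟩

instance instAddCommGroup : AddCommGroup (Cl γ) := (equiv γ).addCommGroup

instance : Module ℝ (Cl γ) := (equiv γ).module ℝ

instance : TopologicalSpace (Cl γ) := .induced (equiv γ) inferInstance

instance : Mul (Cl γ) :=
  ⟨fun x y => ⟨x.fst * y.fst + x.snd * γ.hom y.snd, x.fst * y.snd + x.snd * γ.hom y.fst⟩⟩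

instance : One (Cl γ) := ⟨⟨1, 0⟩⟩

@[simp] theorem fst_add (x y : Cl γ) : (x + y).fst = x.fst + y.fst := rfl
@[simp] theorem snd_add (x y : Cl γ) : (x + y).snd = x.snd + y.snd := rfl
@[simp] theorem fst_zero : (0 : Cl γ).fst = 0 := rfl
@[simp] theorem snd_zero : (0 : Cl γ).snd = 0 := rfl
@[simp] theorem fst_one : (1 : Cl γ).fst = 1 := rfl
@[simp] theorem snd_one : (1 : Cl γ).snd = 0 := rfl
@[simp] theorem fst_smul (c : ℝ) (x : Cl γ) : (c • x).fst = c • x.fst := rfl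
@[simp] theorem snd_smul (c : ℝ) (x : Cl γ) : (c • x).snd = c • x.snd := rfl
@[simp] theorem fst_mul (x y : Cl γ) :
    (x * y).fst = x.fst * y.fst + x.snd * γ.hom y.snd := rfl
@[simp] theorem snd_mul (x y : Cl γ) :
    (x * y).snd = x.fst * y.snd + x.snd * γ.hom y.fst := rfl

instance : Ring (Cl γ) where
  __ := instAddCommGroup
  left_distrib x y z := by ext <;> simp [mul_add] <;> abel
  right_distrib x y z := by ext <;> simp [add_mul] <;> abel
  zero_mul x := by ext <;> simp
  mul_zero x := by ext <;> simp
  mul_assoc x y z := by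
    ext <;> simp [mul_add, add_mul, mul_assoc, γ.invol] <;> abel
  one_mul x := by ext <;> simp
  mul_one x := by ext <;> simp

instance : Algebra ℝ (Cl γ) :=
  Algebra.ofModule (fun c x y => by ext <;> simp) (fun c x y => by ext <;> simp)

theorem continuous_fst : Continuous fun x : Cl γ => x.fst :=
  _root_.continuous_fst.comp (continuous_induced_dom (f := equiv γ))

theorem continuous_snd : Continuous fun x : Cl γ => x.snd :=
  _root_.continuous_snd.comp (continuous_induced_dom (f := equiv γ))

theorem continuous_mk {X : Type*} [TopologicalSpace X] {f g : X → R} (hf : Continuous f)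
    (hg : Continuous g) : Continuous fun x => (⟨f x, g x⟩ : Cl γ) :=
  continuous_induced_rng.2 (hf.prodMk hg)

instance [IsTopologicalRing R] : IsTopologicalRing (Cl γ) where
  continuous_add := by
    have h₁ := continuous_fst (γ := γ)
    have h₂ := continuous_snd (γ := γ)
    exact continuous_mk (by fun_prop) (by fun_prop)
  continuous_mul := by
    have h₁ := continuous_fst (γ := γ)
    have h₂ := continuous_snd (γ := γ)
    have h₃ := γ.cont
    exact continuous_mk (by fun_prop) (by fun_prop)
  continuous_neg := by
    have h₁ := continuous_fst (γ := γ)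
    have h₂ := continuous_snd (γ := γ)
    exact continuous_mk (f := fun x : Cl γ => -x.fst) (g := fun x : Cl γ => -x.snd)
      (by fun_prop) (by fun_prop)

instance [ContinuousSMul ℝ R] : ContinuousSMul ℝ (Cl γ) where
  continuous_smul := by
    have h₁ := continuous_fst (γ := γ)
    have h₂ := continuous_snd (γ := γ)
    exact continuous_mk (f := fun x : ℝ × Cl γ => x.1 • x.2.fst)
      (g := fun x : ℝ × Cl γ => x.1 • x.2.snd) (by fun_prop) (by fun_prop)

end Cl

/-- The grading of `Cl₊₁ ⊗ R`: the generator `e` is odd. -/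
def Grading.cl [IsTopologicalRing R] (γ : Grading R) : Grading (Cl γ) where
  hom :=
    { toFun := fun x => ⟨γ.hom x.fst, -γ.hom x.snd⟩
      map_one' := by ext <;> simp
      map_mul' := fun x y => by ext <;> simp; abel
      map_zero' := by ext <;> simp
      map_add' := fun x y => by ext <;> simp; abel
      commutes' := fun c => by
        simp only [Algebra.algebraMap_eq_smul_one]
        ext <;> simp }
  invol x := by
    change (⟨γ.hom (γ.hom x.fst), -γ.hom (-γ.hom x.snd)⟩ : Cl γ) = x
    ext <;> simp [γ.invol]
  cont := Cl.continuous_mk (γ.cont.comp Cl.continuous_fst) (γ.cont.comp Cl.continuous_snd).neg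

/-- The homomorphism `Cl₊₁ ⊗ R → Cl₊₁ ⊗ S` induced by a graded homomorphism `R → S`. -/
def GradedHom.cl [IsTopologicalRing R] {γ : Grading R} {S : Type w} [Ring S] [Algebra ℝ S]
    [TopologicalSpace S] [IsTopologicalRing S] {δ : Grading S} (f : GradedHom γ δ) :
    GradedHom γ.cl δ.cl where
  hom :=
    { toFun := fun x => ⟨f.hom x.fst, f.hom x.snd⟩
      map_one' := by ext <;> simp
      map_mul' := fun x y => by ext <;> simp [f.comm]
      map_zero' := by ext <;> simp
      map_add' := fun x y => by ext <;> simp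
      commutes' := fun c => by
        simp only [Algebra.algebraMap_eq_smul_one]
        ext <;> simp }
  cont := Cl.continuous_mk (f.cont.comp Cl.continuous_fst) (f.cont.comp Cl.continuous_snd)
  comm x := by
    change (⟨f.hom (γ.hom x.fst), f.hom (-γ.hom x.snd)⟩ : Cl δ) =
      ⟨δ.hom (f.hom x.fst), -δ.hom (f.hom x.snd)⟩
    simp [f.comm]

end Clifford

section NonUnital

/-- A `ℤ/2`-grading on a not necessarily unital real topological algebra, encoded by its grading
automorphism. -/
structure NGrading (A : Type u) [NonUnitalRing A] [Module ℝ A] [TopologicalSpace A] where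
  hom : A →ₙₐ[ℝ] A
  invol : ∀ a, hom (hom a) = a
  cont : Continuous hom

/-- The unitization `A₊ = ℝ ⊕ A`, with the product topology. -/
def Plus (A : Type u) : Type u := Unitization ℝ A

variable {A : Type u} [NonUnitalRing A] [Module ℝ A] [IsScalarTower ℝ A A] [SMulCommClass ℝ A A]
  [TopologicalSpace A] [IsTopologicalRing A] [ContinuousSMul ℝ A]

namespace Plus

instance : Ring (Plus A) := inferInstanceAs (Ring (Unitization ℝ A))

instance : Algebra ℝ (Plus A) := inferInstanceAs (Algebra ℝ (Unitization ℝ A))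

/-- The scalar part. -/
def fst (x : Plus A) : ℝ := Unitization.toProd x |>.1

/-- The part in `A`. -/
def snd (x : Plus A) : A := Unitization.toProd x |>.2

/-- The element `r + a`. -/
def mk (r : ℝ) (a : A) : Plus A := Unitization.mk (r, a)

@[ext] theorem ext {x y : Plus A} (h : x.fst = y.fst) (h' : x.snd = y.snd) : x = y :=
  Unitization.ext h h'

instance : TopologicalSpace (Plus A) :=
  .induced (fun x => (x.fst, x.snd)) inferInstance

theorem continuous_fst : Continuous fun x : Plus A => x.fst :=
  _root_.continuous_fst.comp (continuous_induced_dom (f := fun x : Plus A => (x.fst, x.snd)))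

theorem continuous_snd : Continuous fun x : Plus A => x.snd :=
  _root_.continuous_snd.comp (continuous_induced_dom (f := fun x : Plus A => (x.fst, x.snd)))

theorem continuous_rng {X : Type*} [TopologicalSpace X] {f : X → Plus A}
    (h : Continuous fun x => (f x).fst) (h' : Continuous fun x => (f x).snd) : Continuous f :=
  continuous_induced_rng.2 (h.prodMk h')

instance : IsTopologicalRing (Plus A) where
  continuous_add := by
    have h₁ := continuous_fst (A := A)
    have h₂ := continuous_snd (A := A)
    exact continuous_rng ((h₁.comp _root_.continuous_fst).add (h₁.comp _root_.continuous_snd))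
      ((h₂.comp _root_.continuous_fst).add (h₂.comp _root_.continuous_snd))
  continuous_mul := by
    have h₁ := continuous_fst (A := A)
    have h₂ := continuous_snd (A := A)
    have a₁ := h₁.comp (_root_.continuous_fst (X := Plus A) (Y := Plus A))
    have a₂ := h₂.comp (_root_.continuous_fst (X := Plus A) (Y := Plus A))
    have b₁ := h₁.comp (_root_.continuous_snd (X := Plus A) (Y := Plus A))
    have b₂ := h₂.comp (_root_.continuous_snd (X := Plus A) (Y := Plus A))
    exact continuous_rng (a₁.mul b₁) (((a₁.smul b₂).add (b₁.smul a₂)).add (a₂.mul b₂))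
  continuous_neg := continuous_rng (continuous_fst (A := A)).neg (continuous_snd (A := A)).neg

instance : ContinuousSMul ℝ (Plus A) where
  continuous_smul := by
    have h₁ := (continuous_fst (A := A)).comp (_root_.continuous_snd (X := ℝ) (Y := Plus A))
    have h₂ := (continuous_snd (A := A)).comp (_root_.continuous_snd (X := ℝ) (Y := Plus A))
    exact continuous_rng (_root_.continuous_fst.mul h₁) (_root_.continuous_fst.smul h₂)

end Plus

namespace NGrading

/-- The grading of the unitization, in which the unit is even. -/
def plus (γ : NGrading A) : Grading (Plus A) where
  hom :=
    { toFun := fun x => Plus.mk x.fst (γ.hom x.snd)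
      map_one' := Plus.ext rfl (map_zero γ.hom)
      map_mul' := fun x y => Plus.ext rfl <| by
        change γ.hom (x.fst • y.snd + y.fst • x.snd + x.snd * y.snd) =
          x.fst • γ.hom y.snd + y.fst • γ.hom x.snd + γ.hom x.snd * γ.hom y.snd
        simp only [map_add, map_smul, map_mul]
      map_zero' := Plus.ext rfl (map_zero γ.hom)
      map_add' := fun x y => Plus.ext rfl (map_add γ.hom x.snd y.snd)
      commutes' := fun r => Plus.ext rfl (map_zero γ.hom) }
  invol x := Plus.ext rfl (γ.invol x.snd)
  cont := Plus.continuous_rng Plus.continuous_fst (γ.cont.comp Plus.continuous_snd)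

/-- The augmentation `A₊ → ℝ`. -/
def augmentation (γ : NGrading A) : GradedHom γ.plus Grading.real where
  hom := Unitization.fstHom ℝ A
  cont := Plus.continuous_fst
  comm _ := rfl

/-- The group of a not necessarily unital graded algebra: the kernel of the map from the group of
`A₊` to the group of `ℝ`. -/
def KGroup (γ : NGrading A) (σ : ℤˣ) : AddSubgroup (KUnital.{u, u} γ.plus σ) :=
  (KUnital.map.{u, u, 0} γ.augmentation σ).ker

/-- Karoubi `K`-theory `K₀(A)`: classes of triples of gradings. -/
abbrev K₀ (γ : NGrading A) := γ.KGroup 1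

/-- The group of SPT phases protected by `A`: classes of differences of polarizations. -/
abbrev SPT (γ : NGrading A) := γ.KGroup (-1)

/-- Karoubi `K`-theory `K₂(A)`: the kernel of `K₀(Cl₊₂ ⊗ A₊) → K₀(Cl₊₂)`, where
`Cl₊₂ ⊗ - = Cl₊₁ ⊗ (Cl₊₁ ⊗ -)`. -/
def K₂ (γ : NGrading A) : AddSubgroup (KUnital.{u, u} γ.plus.cl.cl 1) :=
  (KUnital.map.{u, u, 0} γ.augmentation.cl.cl 1).ker

/-- The same grading on the opposite algebra `Aᵐᵒᵖ` (reversed multiplication, no sign). -/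
def mop (γ : NGrading A) : NGrading Aᵐᵒᵖ where
  hom := 
    { toFun := fun a => .op (γ.hom a.unop)
      map_smul' := fun c a => by simp
      map_zero' := by simp
      map_add' := fun a b => by simp
      map_mul' := fun a b => by simp }
  invol a := by simp [γ.invol]
  cont := MulOpposite.continuous_op.comp (γ.cont.comp MulOpposite.continuous_unop)

end NGrading

/-- The graded opposite of `A` with respect to the grading `γ`: the same vector space, with
`aᵒᵖ bᵒᵖ = (-1)^(|a| |b|) (b a)ᵒᵖ` for homogeneous `a`, `b`. -/
@[ext] structure GrOp (γ : NGrading A) where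
  /-- the element `aᵒᵖ` -/
  op ::
  unop : A

namespace GrOp

variable {γ : NGrading A}

/-- The underlying element. -/
def equiv (γ : NGrading A) : GrOp γ ≃ A where
  toFun x := x.unop
  invFun a := ⟨a⟩

instance instAddCommGroup : AddCommGroup (GrOp γ) := (equiv γ).addCommGroup

instance : Module ℝ (GrOp γ) := (equiv γ).module ℝ

instance : TopologicalSpace (GrOp γ) := .induced (equiv γ) inferInstance

/-- The even part of an element. -/
def even (γ : NGrading A) (a : A) : A := (2⁻¹ : ℝ) • (a + γ.hom a)

/-- The odd part of an element. -/
def odd (γ : NGrading A) (a : A) : A := (2⁻¹ : ℝ) • (a - γ.hom a)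

/-- With `b = b₀ + b₁` the decomposition into even and odd parts,
`aᵒᵖ bᵒᵖ = (b₀ a + b₁ γ(a))ᵒᵖ`. -/
instance : Mul (GrOp γ) :=
  ⟨fun x y => ⟨even γ y.unop * x.unop + odd γ y.unop * γ.hom x.unop⟩⟩

@[simp] theorem unop_add (x y : GrOp γ) : (x + y).unop = x.unop + y.unop := rfl
@[simp] theorem unop_zero : (0 : GrOp γ).unop = 0 := rfl
@[simp] theorem unop_smul (c : ℝ) (x : GrOp γ) : (c • x).unop = c • x.unop := rfl
theorem unop_mul (x y : GrOp γ) :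
    (x * y).unop = even γ y.unop * x.unop + odd γ y.unop * γ.hom x.unop := rfl

/-- The multiplication on homogeneous elements, with `ε, δ = ±1` the signs of `γ` on `x`, `y`:
the sign is `-1` exactly if both elements are odd. -/
theorem unop_mul_of_homogeneous (x y : GrOp γ) (ε δ : ℤˣ)
    (hx : γ.hom x.unop = (ε : ℤ) • x.unop) (hy : γ.hom y.unop = (δ : ℤ) • y.unop) :
    (x * y).unop = (if ε = -1 ∧ δ = -1 then (-1 : ℤ) else 1) • (y.unop * x.unop) := by
  rw [unop_mul, even, odd, hx, hy]
  rcases Int.units_eq_one_or ε with rfl | rfl <;> rcases Int.units_eq_one_or δ with rfl | rfl <;>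
    simp [← two_smul ℝ y.unop, smul_smul]

instance : NonUnitalRing (GrOp γ) where
  __ := instAddCommGroup
  left_distrib x y z := by
    ext; simp only [unop_mul, unop_add, even, odd, map_add, smul_add, smul_sub, add_mul,
      sub_mul]; abel
  right_distrib x y z := by
    ext; simp only [unop_mul, unop_add, map_add, mul_add]; abel
  zero_mul x := by ext; simp [unop_mul]
  mul_zero x := by ext; simp [unop_mul, even, odd]
  mul_assoc x y z := by
    ext
    simp only [unop_mul, even, odd, map_add, map_smul, map_sub, map_mul, γ.invol, mul_add, add_mul,
      mul_sub, sub_mul, smul_mul_assoc, mul_smul_comm, mul_assoc]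
    module

instance : IsScalarTower ℝ (GrOp γ) (GrOp γ) where
  smul_assoc c x y := by
    ext; simp [unop_mul, mul_smul_comm, smul_add]

instance : SMulCommClass ℝ (GrOp γ) (GrOp γ) where
  smul_comm c x y := by
    ext; simp only [smul_eq_mul, unop_mul, unop_smul, even, odd, map_smul, ← smul_add, ← smul_sub, smul_comm _ c, smul_mul_assoc]

theorem continuous_unop : Continuous (GrOp.unop : GrOp γ → A) := continuous_induced_dom

instance : IsTopologicalRing (GrOp γ) where
  continuous_add := continuous_induced_rng.2 (by
    have h := continuous_unop (γ := γ)
    exact (h.comp continuous_fst).add (h.comp continuous_snd))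
  continuous_mul := continuous_induced_rng.2 (by
    have h := continuous_unop (γ := γ)
    have h' := γ.cont
    have : Continuous fun x : GrOp γ × GrOp γ =>
      even γ x.2.unop * x.1.unop + odd γ x.2.unop * γ.hom x.1.unop := by
      unfold even odd; fun_prop
    exact this)
  continuous_neg := continuous_induced_rng.2 (continuous_unop (γ := γ)).neg

instance : ContinuousSMul ℝ (GrOp γ) where
  continuous_smul := continuous_induced_rng.2 (by
    have h := continuous_unop (γ := γ)
    exact (continuous_fst (X := ℝ) (Y := GrOp γ)).smul (h.comp continuous_snd))

end GrOp

/-- A grading `δ` commuting with `γ` is a grading of the graded opposite with respect to `γ`. -/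
def NGrading.grOp (γ δ : NGrading A) (h : ∀ a, γ.hom (δ.hom a) = δ.hom (γ.hom a)) :
    NGrading (GrOp γ) where
  hom := 
    { toFun := fun a => ⟨δ.hom a.unop⟩
      map_smul' := fun c a => by ext; simp
      map_zero' := by ext; simp
      map_add' := fun a b => by ext; simp
      map_mul' := fun a b => by ext; simp [GrOp.unop_mul, GrOp.even, GrOp.odd, h] }
  invol a := by 
    change (⟨δ.hom (δ.hom a.unop)⟩ : GrOp γ) = a
    rw [δ.invol]
  cont := continuous_induced_rng.2 (δ.cont.comp GrOp.continuous_unop)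

/-- The grading `γ` on the graded opposite with respect to `γ`. -/
def NGrading.selfOp (γ : NGrading A) : NGrading (GrOp γ) := γ.grOp γ fun _ => rfl

end NonUnital


open MeasureTheory

/-- A Freed–Moore structure on a topological group `G` (assumed second countable, Hausdorff and
locally compact in the theorem): continuous homomorphisms `θ`, `φ` to `ℤ/2`, written
multiplicatively as signs `±1`, and a `U(1)`-subgroup with `z g = g z^φ(g)`. -/
structure FreedMooreGroup (G : Type u) [Group G] [TopologicalSpace G] where
  θ : G →* ℤˣ
  φ : G →* ℤˣ
  Q : Circle →* G
  continuous_θ : Continuous θ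
  continuous_φ : Continuous φ
  continuous_Q : Continuous Q
  injective_Q : Function.Injective Q
  Q_mul : ∀ (z : Circle) (g : G), Q z * g = g * Q (z ^ (φ g : ℤ))

namespace FreedMooreGroup

variable {G : Type u} [Group G] [TopologicalSpace G] (X : FreedMooreGroup G)

instance normal_range : X.Q.range.Normal where
  conj_mem := by
    rintro _ ⟨z, rfl⟩ g
    refine ⟨z ^ (X.φ g⁻¹ : ℤ), ?_⟩
    have := X.Q_mul z g⁻¹
    rw [mul_assoc, this, mul_inv_cancel_left]

/-- Homomorphisms to `ℤ/2` are trivial on `U(1)`, since every element of `U(1)` is a square. -/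
theorem map_Q (χ : G →* ℤˣ) (z : Circle) : χ (X.Q z) = 1 := by
  have h : Circle.exp (z : ℂ).arg = z := Circle.exp_arg z
  rw [← add_halves (z : ℂ).arg, Circle.exp_add] at h
  rw [← h, map_mul, map_mul, Int.units_mul_self]

/-- The quotient group `H = G / U(1)`. -/
def H : Type u := G ⧸ X.Q.range

instance : Group X.H := inferInstanceAs (Group (G ⧸ X.Q.range))

instance : TopologicalSpace X.H := inferInstanceAs (TopologicalSpace (G ⧸ X.Q.range))

instance [IsTopologicalGroup G] : IsTopologicalGroup X.H :=
  inferInstanceAs (IsTopologicalGroup (G ⧸ X.Q.range))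

instance [IsTopologicalGroup G] [LocallyCompactSpace G] : LocallyCompactSpace X.H :=
  inferInstanceAs (LocallyCompactSpace (G ⧸ X.Q.range))

instance : MeasurableSpace X.H := borel X.H

instance : BorelSpace X.H := ⟨rfl⟩

/-- The quotient homomorphism. -/
def proj : G →* X.H := QuotientGroup.mk' X.Q.range

/-- The homomorphism `H → ℤ/2` induced by a homomorphism `G → ℤ/2`. -/
def descend (χ : G →* ℤˣ) : X.H →* ℤˣ :=
  QuotientGroup.lift X.Q.range χ (by rintro _ ⟨z, rfl⟩; exact X.map_Q χ z)

theorem continuous_descend {χ : G →* ℤˣ} (h : Continuous χ) : Continuous (X.descend χ) :=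
  continuous_quot_lift _ h

/-- The homomorphism `c = θ + φ`. -/
def c : G →* ℤˣ := X.θ * X.φ

theorem continuous_c : Continuous X.c := X.continuous_θ.mul X.continuous_φ

/-- A Borel section `s : H → G` with `s(1) = 1`. -/
structure Section where
  toFun : X.H → G
  measurable : @Measurable _ _ (borel X.H) (borel G) toFun
  proj_toFun : ∀ h, X.proj (toFun h) = h
  map_one : toFun 1 = 1

variable {X}

theorem Section.exists_cocycle (s : X.Section) (g h : X.H) :
    ∃ z : Circle, X.Q z = s.toFun g * s.toFun h * (s.toFun (g * h))⁻¹ := by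
  have : X.proj (s.toFun g * s.toFun h * (s.toFun (g * h))⁻¹) = 1 := by
    rw [map_mul, map_mul, map_inv, s.proj_toFun, s.proj_toFun, s.proj_toFun, mul_inv_cancel]
  exact (QuotientGroup.eq_one_iff (N := X.Q.range) _).1 this

/-- The `U(1)`-valued `2`-cocycle of a section: `s(g) s(h) = τ(g, h) s(gh)`. -/
def Section.τ (s : X.Section) (g h : X.H) : Circle := (s.exists_cocycle g h).choose

theorem Section.Q_τ (s : X.Section) (g h : X.H) :
    X.Q (s.τ g h) * s.toFun (g * h) = s.toFun g * s.toFun h := by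
  rw [Section.τ, (s.exists_cocycle g h).choose_spec, inv_mul_cancel_right]

/-- The real Hilbert space `ℓ²(ℕ)`. -/
abbrev E : Type := lp (fun _ : ℕ => ℝ) 2

/-- Covariant representations `(π, v)` of the twisted dynamical system `(ℂ, H, α, τ)` on the
separable real Hilbert space `E`, where `α_h` is complex conjugation if `φ(h) = -1` and the identity
otherwise: a unital real `*`-homomorphism `π : ℂ → B(E)`, given by the operator `I = π(i)`, and a
Borel map `v` from `H` to the unitary group of `E` with
`v_g v_h = π(τ(g, h)) v_{gh}` and `v_h π(z) = π(α_h(z)) v_h`. -/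
@[ext] structure CovRep (s : X.Section) where
  I : E →L[ℝ] E
  I_mul_I : I * I = -1
  star_I : star I = -I
  v : X.H → E →L[ℝ] E
  mem_unitary : ∀ h, v h ∈ unitary (E →L[ℝ] E)
  measurable : ∀ x y : E, Measurable fun h => inner ℝ x (v h y)
  v_mul_v : ∀ g h, v g * v h = ((s.τ g h : ℂ).re • 1 + (s.τ g h : ℂ).im • I) * v (g * h)
  v_mul_I : ∀ h, v h * I = (X.descend X.φ h : ℤ) • (I * v h)

variable {s : X.Section}

/-- The homomorphism `π : ℂ → B(E)`. -/
def CovRep.π (ρ : CovRep s) (z : ℂ) : E →L[ℝ] E := z.re • 1 + z.im • ρ.I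

/-- The twist of a covariant representation by a sign character: `(π, v) ↦ (π, χ v)`. -/
def CovRep.twist (χ : G →* ℤˣ) (hχ : Continuous χ) (ρ : CovRep s) : CovRep s where
  I := ρ.I
  I_mul_I := ρ.I_mul_I
  star_I := ρ.star_I
  v h := (X.descend χ h : ℤ) • ρ.v h
  mem_unitary h := by
    rcases Int.units_eq_one_or (X.descend χ h) with e | e
    · simpa [e] using ρ.mem_unitary h
    · have := ρ.mem_unitary h
      rw [Unitary.mem_iff] at this ⊢
      simpa [e] using this
  measurable x y := by
    have h₁ : Measurable fun h : X.H => ((X.descend χ h : ℤ) : ℝ) :=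
      ((continuous_of_discreteTopology (f := fun n : ℤ => (n : ℝ))).comp
        (Units.continuous_val.comp (X.continuous_descend hχ))).measurable
    convert h₁.mul (ρ.measurable x y) using 2 with h
    simp [← Int.cast_smul_eq_zsmul ℝ, inner_smul_right]
  v_mul_v g h := by
    rw [map_mul, Units.val_mul, smul_mul_smul_comm, ρ.v_mul_v, mul_smul_comm]
  v_mul_I h := by
    rw [smul_mul_assoc, ρ.v_mul_I, mul_smul_comm, smul_comm]

theorem CovRep.twist_twist (χ : G →* ℤˣ) (hχ : Continuous χ) (ρ : CovRep s) :
    (ρ.twist χ hχ).twist χ hχ = ρ := by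
  refine CovRep.ext rfl (funext fun h => ?_)
  change (X.descend χ h : ℤ) • (X.descend χ h : ℤ) • ρ.v h = ρ.v h
  rw [smul_smul, ← Units.val_mul, Int.units_mul_self, Units.val_one, one_smul]

theorem CovRep.twist_comm (ρ : CovRep s) (χ ψ : G →* ℤˣ) (hχ : Continuous χ)
    (hψ : Continuous ψ) :
    (ρ.twist χ hχ).twist ψ hψ = (ρ.twist ψ hψ).twist χ hχ := by
  refine CovRep.ext rfl (funext fun h => ?_)
  exact smul_comm (X.descend ψ h : ℤ) (X.descend χ h : ℤ) (ρ.v h)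

/-- Bounded families of operators, indexed by the covariant representations, with the supremum
norm. -/
def Families (s : X.Section) : Type u := lp (fun _ : CovRep s => E →L[ℝ] E) ∞

namespace Families

/-- The operator at `ρ`. -/
def apply (a : Families s) (ρ : CovRep s) : E →L[ℝ] E :=
  (show lp (fun _ : CovRep s => E →L[ℝ] E) ∞ from a) ρ

instance : NonUnitalNormedRing (Families s) := lp.nonUnitalNormedRing

instance : NormedSpace ℝ (Families s) := lp.instNormedSpace

instance : IsScalarTower ℝ (Families s) (Families s) := lp.infty_isScalarTower

instance : SMulCommClass ℝ (Families s) (Families s) := lp.infty_smulCommClass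

instance : StarRing (Families s) := lp.inftyStarRing

instance : CStarRing (Families s) := lp.inftyCStarRing

instance : StarModule ℝ (Families s) :=
  inferInstanceAs (StarModule ℝ (lp (fun _ : CovRep s => E →L[ℝ] E) ∞))

/-- The action of a sign character on families of operators. -/
def twist (χ : G →* ℤˣ) (hχ : Continuous χ) : Families s →⋆ₙₐ[ℝ] Families s where
  toFun a := ⟨fun ρ => a.apply (ρ.twist χ hχ), memℓp_infty <| by
    obtain ⟨C, hC⟩ := memℓp_infty_iff.1 (lp.memℓp a)
    exact ⟨C, by rintro _ ⟨ρ, rfl⟩; exact hC ⟨_, rfl⟩⟩⟩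
  map_smul' _ _ := rfl
  map_zero' := rfl
  map_add' _ _ := rfl
  map_mul' _ _ := rfl
  map_star' _ := rfl

@[ext] theorem ext {a b : Families s} (h : ∀ ρ, a.apply ρ = b.apply ρ) : a = b :=
  lp.ext (funext h)

@[simp] theorem twist_apply (χ : G →* ℤˣ) (hχ : Continuous χ) (a : Families s) (ρ : CovRep s) :
    (twist χ hχ a).apply ρ = a.apply (ρ.twist χ hχ) := rfl

theorem norm_twist_le (χ : G →* ℤˣ) (hχ : Continuous χ) (a : Families s) :
    ‖twist χ hχ a‖ ≤ ‖a‖ :=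
  lp.norm_le_of_forall_le (norm_nonneg a) fun ρ =>
    lp.norm_apply_le_norm ENNReal.top_ne_zero
      (show lp (fun _ : CovRep s => E →L[ℝ] E) ∞ from a) (ρ.twist χ hχ)

theorem continuous_twist (χ : G →* ℤˣ) (hχ : Continuous χ) :
    Continuous (twist (s := s) χ hχ) :=
  AddMonoidHomClass.continuous_of_bound (twist (s := s) χ hχ) 1 fun a => by
    simpa using norm_twist_le χ hχ a

theorem twist_twist (χ : G →* ℤˣ) (hχ : Continuous χ) (a : Families s) :
    twist χ hχ (twist χ hχ a) = a := by
  ext1 ρ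
  rw [twist_apply, twist_apply, CovRep.twist_twist]

theorem twist_comm (χ ψ : G →* ℤˣ) (hχ : Continuous χ) (hψ : Continuous ψ) (a : Families s) :
    twist χ hχ (twist ψ hψ a) = twist ψ hψ (twist χ hχ a) := by
  ext1 ρ
  simp only [twist_apply, CovRep.twist_comm ρ χ ψ hχ hψ]

end Families

variable [IsTopologicalGroup G] [LocallyCompactSpace G]

/-- The family of integrated forms `∫ π(f(h)) v_h dh` of a function `f ∈ L¹(H, ℂ)`, where `dh` is
the left Haar measure and the integral is in the weak sense. -/
def IsIntegratedForm (f : X.H → ℂ) (a : Families s) : Prop :=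
  ∀ (ρ : CovRep s) (x y : E),
    inner ℝ x (a.apply ρ y) = ∫ h, inner ℝ x (ρ.π (f h) (ρ.v h y)) ∂Measure.haar

/-- The integrated forms of integrable functions. -/
def integratedForms (s : X.Section) : Set (Families s) :=
  {a | ∃ f : X.H → ℂ, Integrable f Measure.haar ∧ IsIntegratedForm f a}

/-- The unit charge twisted group algebra `ℂ ⋊ H` as a real `C*`-algebra: the completion of
`L¹(H, ℂ)` in the norm `sup ‖∫ π(f(h)) v_h dh‖` over all covariant representations `(π, v)`. As `H`
is second countable, representations on `E = ℓ²(ℕ)` suffice. -/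
def twistedGroupAlgebra (s : X.Section) : NonUnitalStarSubalgebra ℝ (Families s) :=
  (NonUnitalStarAlgebra.adjoin ℝ (integratedForms s)).topologicalClosure

/-- The unit charge twisted group algebra as a type. -/
abbrev Cuc (s : X.Section) : Type u := twistedGroupAlgebra s

theorem twist_mem_integratedForms (χ : G →* ℤˣ) (hχ : Continuous χ) {a : Families s}
    (ha : a ∈ integratedForms s) : Families.twist χ hχ a ∈ integratedForms s := by
  obtain ⟨f, hf, ha⟩ := ha
  have h₁ : Measurable fun h : X.H => ((X.descend χ h : ℤ) : ℂ) :=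
    ((continuous_of_discreteTopology (f := fun n : ℤ => (n : ℂ))).comp
      (Units.continuous_val.comp (X.continuous_descend hχ))).measurable
  refine ⟨fun h => ((X.descend χ h : ℤ) : ℂ) * f h,
    hf.bdd_mul (c := 1) h₁.aestronglyMeasurable (.of_forall fun h => ?_), fun ρ x y => ?_⟩
  · rcases Int.units_eq_one_or (X.descend χ h) with e | e <;> simp [e]
  · rw [Families.twist_apply, ha]
    congr 1
    ext h
    rcases Int.units_eq_one_or (X.descend χ h) with e | e <;>
      simp [e, CovRep.π, CovRep.twist]

theorem twist_mem (χ : G →* ℤˣ) (hχ : Continuous χ) {a : Families s}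
    (ha : a ∈ twistedGroupAlgebra s) : Families.twist χ hχ a ∈ twistedGroupAlgebra s := by
  have h : twistedGroupAlgebra s ≤ (twistedGroupAlgebra s).comap (Families.twist χ hχ) := by
    refine NonUnitalStarSubalgebra.topologicalClosure_minimal _
      (NonUnitalStarAlgebra.adjoin_le fun b hb => ?_)
      ((NonUnitalStarSubalgebra.isClosed_topologicalClosure _).preimage
        (Families.continuous_twist χ hχ))
    exact NonUnitalStarSubalgebra.le_topologicalClosure _
      (NonUnitalStarAlgebra.subset_adjoin ℝ _ (twist_mem_integratedForms χ hχ hb))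
  exact h ha

/-- The grading of the twisted group algebra induced by a homomorphism `χ : G → ℤ/2`: it fixes the
coefficients `ℂ` and multiplies the group element `h` by `χ(h)`, that is `f ↦ χ f` on
`L¹(H, ℂ)`. -/
def Section.grading (s : X.Section) (χ : G →* ℤˣ) (hχ : Continuous χ) : NGrading (Cuc s) where
  hom :=
    { toFun := fun a => ⟨Families.twist χ hχ a, twist_mem χ hχ a.2⟩
      map_smul' := fun _ _ => rfl
      map_zero' := rfl
      map_add' := fun _ _ => rfl
      map_mul' := fun _ _ => rfl }
  invol a := Subtype.ext (Families.twist_twist χ hχ a.1)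
  cont := ((Families.continuous_twist χ hχ).comp continuous_subtype_val).subtype_mk _

/-- The grading by `θ`. -/
def Section.gradingθ (s : X.Section) : NGrading (Cuc s) := s.grading X.θ X.continuous_θ

/-- The grading by `c = θ + φ`. -/
def Section.gradingC (s : X.Section) : NGrading (Cuc s) := s.grading X.c X.continuous_c

theorem Section.gradingC_gradingθ (s : X.Section) (a : Cuc s) :
    s.gradingC.hom (s.gradingθ.hom a) = s.gradingθ.hom (s.gradingC.hom a) :=
  Subtype.ext (Families.twist_comm X.c X.θ X.continuous_c X.continuous_θ a.1)

/-- The grading by `θ` on the graded opposite with respect to the grading by `c`. -/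
def Section.gradingOpθ (s : X.Section) : NGrading (GrOp s.gradingC) :=
  s.gradingC.grOp s.gradingθ s.gradingC_gradingθ

/-- The grading by `c` on the graded opposite with respect to the grading by `c`. -/
def Section.gradingOpC (s : X.Section) : NGrading (GrOp s.gradingC) :=
  s.gradingC.selfOp

end FreedMooreGroup

end GradedK

end

/-! All groups in the theorem have the same shape: stable homotopy classes of matrices `a` over a
non-unital ring `𝒜` with an involutive automorphism `α`, subject to (1 + a) α(1 + a) = 1. This is
recorded by `Presentation`. Two groups presented by the same pair (𝒜, α) are isomorphic
(`Presentation.nonempty_addEquiv`), and anti-isomorphisms of pairs carry presentations along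
(`Presentation.ofAntiEquiv`). So the theorem reduces to comparing a few pairs.

To obtain a presentation, note that an operator on a free module is x ↦ γ(x)P with γ(P)P = σ. Fix a
P₀ such that every operator is a direct summand of a multiple of P₀ (`Cofinal`). Every class is then
that of some P against a multiple of P₀, and writing P = (1 + a)P₀ yields the equation above with
α(x) = γ(P₀⁻¹ x P₀). The groups are kernels of a split map from `R` to a finite-dimensional algebra
`F` (here ℝ or Cl₊₂), so `a` and all homotopies should have entries in the kernel of `R → F`. Over
`F`, nearby operators are conjugate by an explicit intertwiner, hence paths of operators lift to
paths of invertible matrices (`exists_path_lift`). Pushed to `R` by the splitting, these correct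
representatives (`exists_matCls_eq_of_mem_ker`) and homotopies
(`exists_joinedIn_of_matCls_eq_zero`). The outcome is `Chart.presentation`.

For K₀ (σ = 1) and SPT (σ = -1) the pair is M₂(A) with P₀ the matrix with rows (0, 1) and (σ, 0).
For K₂ of the graded opposite, let e, f be the Clifford generators and ω = ef. Multiplying odd
elements by ω makes them commute with e and f and removes the sign of the graded opposite, so Cl₊₂ ⊗
A^op becomes M₂(A°). Conjugation by ω is the grading of Cl₊₂, and ω is the P₀ for σ = -1. Hence this
is the pair of SPT up to a transposition.

The comparison of K₀ for `c` with SPT for `θ` uses unit charge. The imaginary unit i is a multiplier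
of A with i a = φ(a) i and φ = cθ. Conjugation by diag(1, i) changes the P₀ for σ = -1 into -i times
the P₀ for σ = 1; the factor i contributes φ and turns θ into c. The graded opposite with respect to
`c` still has such a multiplier, which gives the second half. -/

noncomputable section

namespace GradedK

/-! ### Homotopies of operators and relations between triples. -/

section Homotopy

variable {R : Type u} [Ring R] [Algebra ℝ R] [TopologicalSpace R] [IsTopologicalRing R]
  {γ : Grading R} {σ : ℤˣ} {M : Type v} [AddCommGroup M] [Module R M]
  {N : Type w} [AddCommGroup N] [Module R N]

/-- Continuity of a path of operators can be tested on any linear map to a free module. -/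
theorem PathContinuous.continuous_map {J : unitInterval → SkewSq γ σ M} (h : PathContinuous J)
    {κ : Type*} [Finite κ] (g : M →ₗ[R] (κ → R)) (m : M) :
    Continuous fun t => g ((J t).op m) := by
  obtain ⟨n, i, r, hr, hJ⟩ := h
  -- `g` factors through the coordinates `i`, by a linear map of free modules, which is continuous.
  have hc : Continuous (g ∘ₗ r) := LinearMap.continuous_on_pi _
  have : (fun t => g ((J t).op m)) = fun t => (g ∘ₗ r) (i ((J t).op m)) := by
    ext t; simp [hr]
  rw [this]
  exact hc.comp (hJ m)

theorem SkewSq.eq_conj {J : SkewSq γ σ N} {J' : SkewSq γ σ M} (e : M ≃ₗ[R] N)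
    (h : ∀ m, e (J'.op m) = J.op (e m)) : J' = J.conj e := by
  ext m
  apply e.injective
  rw [h]
  exact (e.apply_symm_apply _).symm

/-- Homotopies are transported along module isomorphisms. -/
theorem SkewHomotopic.of_equiv {J K : SkewSq γ σ N} {J' K' : SkewSq γ σ M}
    (h : SkewHomotopic J K) (e : M ≃ₗ[R] N) (hJ : ∀ m, e (J'.op m) = J.op (e m))
    (hK : ∀ m, e (K'.op m) = K.op (e m)) : SkewHomotopic J' K' := by
  rw [SkewSq.eq_conj e hJ, SkewSq.eq_conj e hK]
  obtain ⟨F, ⟨n, i, r, hr, hF⟩, rfl, rfl⟩ := h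
  refine ⟨fun t => (F t).conj e, ⟨n, i ∘ₗ e.toLinearMap, e.symm.toLinearMap ∘ₗ r,
    fun m => by simp [hr], fun m => ?_⟩, rfl, rfl⟩
  have : (fun t => (i ∘ₗ e.toLinearMap) (((F t).conj e).op m)) = fun t => i ((F t).op (e m)) := by
    ext1 t
    exact congrArg i (e.apply_symm_apply _)
  rw [this]
  exact hF _

/-- Concatenation of paths. The space of operators gets the topology of pointwise convergence in the
coordinates of the first path; `PathContinuous.continuous_map` allows the second path, which comes
with its own coordinates, to be read in those of the first. -/
theorem SkewHomotopic.trans {J K L : SkewSq γ σ M} (h : SkewHomotopic J K)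
    (h' : SkewHomotopic K L) : SkewHomotopic J L := by
  obtain ⟨F, hF, rfl, rfl⟩ := h
  obtain ⟨G, hG, h0, rfl⟩ := h'
  have ⟨n, i, r, hr, hF'⟩ := hF
  let _ : TopologicalSpace (SkewSq γ σ M) := .induced (fun J m => i (J.op m)) inferInstance
  have key : ∀ H : unitInterval → SkewSq γ σ M, (∀ m, Continuous fun t => i ((H t).op m)) ↔
      Continuous H := fun H => by
    rw [continuous_induced_rng, continuous_pi_iff]; rfl
  have p : Joined (F 0) (F 1) := ⟨⟨⟨F, (key F).1 hF'⟩, rfl, rfl⟩⟩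
  have q : Joined (F 1) (G 1) := ⟨⟨⟨G, (key G).1 fun m => hG.continuous_map i m⟩, h0, rfl⟩⟩
  obtain ⟨s⟩ := p.trans q
  exact ⟨s, ⟨n, i, r, hr, (key s).2 s.continuous⟩, s.source, s.target⟩

namespace KTriple

theorem Elementary.of_iso {S T : KTriple.{u, v} γ σ} (hT : T.Elementary) (h : S.Iso T) :
    S.Elementary := by
  obtain ⟨e, h₁, h₂⟩ := h
  exact SkewHomotopic.of_equiv hT e h₁ h₂

/-- A triple whose class vanishes becomes elementary after adding a triple `(N, K, K)`. -/
theorem exists_homotopic_of_equiv_zero {T : KTriple.{u, v} γ σ} (h : T.Equiv zero) :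
    ∃ E : KTriple.{u, v} γ σ, SkewHomotopic (T.J₁.prod E.J₁) (T.J₂.prod E.J₁) := by
  obtain ⟨E, E', hE, hE', h⟩ := h
  have h1 : (T.sum E).Elementary := (zero_elementary.sum hE').of_iso h
  -- The second operator of `E` is moved back to the first along the reversed homotopy.
  exact ⟨E, h1.trans (SkewHomotopic.prod (SkewHomotopic.refl _) hE.symm)⟩

variable [ContinuousSMul ℝ R]

/-- `T.swap` represents the negative of `T`, so adding `T` on both sides cancels it. -/
theorem equiv_of_sum_swap {S T : KTriple.{u, v} γ σ} (h : (S.sum T.swap).Equiv zero) :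
    S.Equiv T := by
  have h1 : ((S.sum T.swap).sum T).Equiv (zero.sum T) := h.sum (Equiv.refl T)
  have h2 : (S.sum (T.swap.sum T)).Equiv (S.sum zero) :=
    (Equiv.refl S).sum (sum_swap_equiv_zero T)
  refine ((sum_zero S).equiv.symm.trans h2.symm).trans ?_
  refine ((sum_assoc S T.swap T).symm.equiv.trans h1).trans ?_
  exact ((sum_comm zero T).trans (sum_zero T)).equiv

variable (M) [Module.Finite R M] [Module.Projective R M] in
/-- The triple `(M, J, K)`. -/
abbrev of (J K : SkewSq γ σ M) : KTriple.{u, v} γ σ where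
  M := M
  J₁ := J
  J₂ := K

variable [Module.Finite R M] [Module.Projective R M]

/-- `[M, J, K] + [M, K, L] = [M, J, L]`. -/
theorem of_sum_of_equiv (J K L : SkewSq γ σ M) :
    ((of M J K).sum (of M K L)).Equiv (of M J L) := by
  -- The difference of the two sides compares J ⊕ K ⊕ L with its cyclic permutation K ⊕ L ⊕ J, which
  -- two rotations achieve.
  refine equiv_of_sum_swap (Elementary.equiv_zero ?_)
  change SkewHomotopic ((J.prod K).prod L) ((K.prod L).prod J)
  have h1 : SkewHomotopic ((J.prod K).prod L) ((K.prod J).prod L) :=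
    (SkewHomotopic.prod_swap J K).prod (SkewHomotopic.refl L)
  refine h1.trans ?_
  have h2 : SkewHomotopic (K.prod (J.prod L)) (K.prod (L.prod J)) :=
    (SkewHomotopic.refl K).prod (SkewHomotopic.prod_swap J L)
  exact h2.of_equiv (LinearEquiv.prodAssoc R _ _ _) (fun _ => rfl) fun _ => rfl

end KTriple

end Homotopy

/-! ### Direct summands and hyperbolic operators. -/

section Retract

variable {R : Type u} [Ring R] [Algebra ℝ R] [TopologicalSpace R]
  {γ : Grading R} {σ : ℤˣ} {M : Type v} [AddCommGroup M] [Module R M]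
  {N : Type w} [AddCommGroup N] [Module R N]

/-- `(M, J)` is a direct summand of `(N, K)`. -/
def SkewSq.IsRetract (J : SkewSq γ σ M) (K : SkewSq γ σ N) : Prop :=
  ∃ (i : M →ₗ[R] N) (r : N →ₗ[R] M), (∀ m, r (i m) = m) ∧
    (∀ m, i (J.op m) = K.op (i m)) ∧ ∀ x, r (K.op x) = J.op (r x)

theorem SkewSq.IsRetract.trans {P : Type*} [AddCommGroup P] [Module R P] {J : SkewSq γ σ M}
    {K : SkewSq γ σ N} {L : SkewSq γ σ P} (h : J.IsRetract K) (h' : K.IsRetract L) :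
    J.IsRetract L := by
  obtain ⟨i, r, h₁, h₂, h₃⟩ := h
  obtain ⟨i', r', h₁', h₂', h₃'⟩ := h'
  exact ⟨i' ∘ₗ i, r ∘ₗ r', fun m => by simp [h₁, h₁'], fun m => by simp [h₂, h₂'],
    fun x => by simp [h₃, h₃']⟩

theorem SkewSq.IsRetract.of_equiv {J : SkewSq γ σ M} {K : SkewSq γ σ N} (e : M ≃ₗ[R] N)
    (h : ∀ m, e (J.op m) = K.op (e m)) : J.IsRetract K :=
  ⟨e.toLinearMap, e.symm.toLinearMap, fun m => by simp, h, fun x => by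
    apply e.injective
    simp [h]⟩

/-- A direct summand has a complement. -/
theorem SkewSq.IsRetract.exists_complement [Module.Finite R N] [Module.Projective R N]
    {J : SkewSq γ σ M} {K : SkewSq γ σ N} (h : J.IsRetract K) :
    ∃ (P : Submodule R N) (_ : Module.Finite R P) (_ : Module.Projective R P)
      (L : SkewSq γ σ P) (e : (M × P) ≃ₗ[R] N), ∀ x, e ((J.prod L).op x) = K.op (e x) := by
  obtain ⟨i, r, hr, hi, hK⟩ := h
  let P := LinearMap.ker r
  have hP : ∀ x : P, r x = 0 := fun x => x.2
  -- The complement is the kernel of `r`, with projection 1 - ir. It is stable under `K` because `r`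
  -- intertwines `K` and `J`.
  let q : N →ₗ[R] P := (LinearMap.id - i ∘ₗ r).codRestrict P fun x => by simp [P, hr]
  have hq : ∀ x : P, q x = x := fun x => Subtype.ext (by simp [q, hP])
  let L : SkewSq γ σ P :=
    { op := (K.op.comp P.subtype).codRestrict P fun x => by
        change r (K.op x) = 0
        rw [hK, hP, map_zero]
      sq := fun x => Subtype.ext (K.sq x) }
  let e : (M × P) ≃ₗ[R] N := LinearEquiv.ofLinearMap (i.coprod P.subtype) (r.prod q)
    (by ext x; simp [q]) (by
      have hqi : ∀ m, q (i m) = 0 := fun m => Subtype.ext (by simp [q, hr])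
      ext x <;> simp [hr, hP, hq, hqi])
  refine ⟨P, Module.Finite.of_surjective q fun x => ⟨x, hq x⟩,
    Module.Projective.of_split P.subtype q (LinearMap.ext hq), L, e, fun x => ?_⟩
  change i (J.op x.1) + K.op x.2 = K.op (i x.1 + x.2)
  rw [map_add, hi]

/-- The operator `H(x, y) = (σ γ(y), γ(x))` on `Rⁿ ⊕ Rⁿ`. -/
def hyperbolic (γ : Grading R) (σ : ℤˣ) (n : ℕ) : SkewSq γ σ ((Fin n → R) × (Fin n → R)) where
  op :=
    { toFun := fun x => (fun k => (σ : ℤ) • γ.hom (x.2 k), fun k => γ.hom (x.1 k))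
      map_add' := fun x y => by ext <;> simp
      map_smul' := fun a x => by ext <;> simp [-zsmul_eq_mul] }
  sq x := by
    ext k
    · simp [γ.invol]
    · simp [γ.invol]

/-- Every `(M, J)` is a direct summand of some hyperbolic operator. -/
theorem SkewSq.isRetract_hyperbolic [Module.Finite R M] [Module.Projective R M]
    (J : SkewSq γ σ M) : ∃ n, J.IsRetract (hyperbolic γ σ n) := by
  obtain ⟨n, i, r, hr⟩ := exists_retract R M
  let tw : (Fin n → R) →ₛₗ[γ.ring] (Fin n → R) :=
    { toFun := fun x k => γ.hom (x k)
      map_add' := fun x y => by ext; simp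
      map_smul' := fun a x => by ext; simp }
  have htw : ∀ x, tw (tw x) = x := fun x => by ext k; exact γ.invol _
  have hσ : ∀ m : M, (σ : ℤ) • (σ : ℤ) • m = m := fun m => by
    rw [smul_smul, ← Units.val_mul, Int.units_mul_self, Units.val_one, one_smul]
  -- The embedding is m ↦ (i m, σ γ(i(J m))), where applying γ after J makes the second coordinate
  -- linear. The retraction is the mean of r(x₁) and J(r(γ x₂)), each of which recovers m alone.
  let y : M →ₗ[R] (Fin n → R) :=
    { toFun := fun m => (σ : ℤ) • tw (i (J.op m))
      map_add' := fun x y => by simp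
      map_smul' := fun a x => by
        simp only [LinearMap.map_smulₛₗ, smul_comm (σ : ℤ), RingHom.id_apply, Grading.ring_apply,
          γ.invol] }
  let z : (Fin n → R) →ₗ[R] M :=
    { toFun := fun x => J.op (r (tw x))
      map_add' := fun x y => by simp
      map_smul' := fun a x => by
        simp only [LinearMap.map_smulₛₗ, RingHom.id_apply, Grading.ring_apply, γ.invol] }
  let half : R := algebraMap ℝ R 2⁻¹
  have hhalf : ∀ m : M, half • (m + m) = m := fun m => by
    rw [← two_smul R m, smul_smul]
    have : half * 2 = 1 := by
      rw [← map_ofNat (algebraMap ℝ R) 2, ← map_mul]; norm_num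
    rw [this, one_smul]
  have hzz : ∀ x, J.op (z x) = (σ : ℤ) • r (tw x) := fun x => J.sq _
  have hH : ∀ x, (hyperbolic γ σ n).op x = ((σ : ℤ) • tw x.2, tw x.1) := fun _ => rfl
  have hz : ∀ x, z (tw x) = J.op (r x) := fun x => by
    change J.op (r (tw (tw x))) = _
    rw [htw]
  let s : (Fin n → R) × (Fin n → R) →ₗ[R] M :=
    { toFun := fun x => half • (r x.1 + z x.2)
      map_add' := fun x y => by simp only [Prod.fst_add, Prod.snd_add, map_add, ← smul_add]; abel_nf
      map_smul' := fun a x => by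
        simp only [Prod.smul_fst, Prod.smul_snd, map_smul, ← smul_add, RingHom.id_apply, smul_smul]
        rw [Algebra.commutes] }
  have hγ : γ.ring half = half := γ.ring_algebraMap _
  refine ⟨n, i.prod y, s, fun m => ?_, fun m => ?_, fun x => ?_⟩
  · change half • (r (i m) + J.op (r (tw ((σ : ℤ) • tw (i (J.op m)))))) = m
    rw [map_zsmul, map_zsmul, map_zsmul, htw, hr, hr, J.sq, hσ, hhalf]
  · rw [hH]
    change (i (J.op m), (σ : ℤ) • tw (i (J.op (J.op m)))) =
      ((σ : ℤ) • tw ((σ : ℤ) • tw (i (J.op m))), tw (i m))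
    rw [map_zsmul, htw, J.sq, map_zsmul, map_zsmul]
    congr 1
    · rw [smul_smul, ← Units.val_mul, Int.units_mul_self, Units.val_one, one_smul]
    · rw [smul_smul, ← Units.val_mul, Int.units_mul_self, Units.val_one, one_smul]
  · rw [hH]
    change half • (r ((σ : ℤ) • tw x.2) + z (tw x.1)) = J.op (half • (r x.1 + z x.2))
    rw [LinearMap.map_smulₛₗ, hγ, map_add, hzz, hz, map_zsmul, add_comm]

end Retract

end GradedK

end

noncomputable section

namespace GradedK

/-! ### Operators on free modules as matrices. -/

section MatrixOperators

variable {R : Type u} [Ring R] [Algebra ℝ R] [TopologicalSpace R]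
  {γ : Grading R} {σ : ℤˣ} {ι κ : Type} [Fintype ι] [DecidableEq ι] [Fintype κ] [DecidableEq κ]

/-- The matrices `P` for which `x ↦ γ(x) P` is a skew-linear operator with square `σ`. -/
def skewMat (γ : Grading R) (σ : ℤˣ) (ι : Type) [Fintype ι] [DecidableEq ι] :
    Set (Matrix ι ι R) :=
  {P | P.map γ.ring * P = (σ : ℤ) • (1 : Matrix ι ι R)}

theorem map_map_grading (P : Matrix ι κ R) : (P.map γ.ring).map γ.ring = P := by
  ext; exact γ.invol _

theorem map_zsmul_one {S : Type*} [Ring S] (f : R →+* S) (n : ℤ) :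
    (n • (1 : Matrix ι ι R)).map f = n • (1 : Matrix ι ι S) := by
  ext i j
  by_cases h : i = j <;> simp [-zsmul_eq_mul, -zsmul_one, h]

/-- Applying γ to the defining equation exchanges the two factors. Hence σγ(P) is a two-sided
inverse of P. -/
theorem mul_map_of_mem_skewMat {P : Matrix ι ι R} (hP : P ∈ skewMat γ σ ι) :
    P * P.map γ.ring = (σ : ℤ) • (1 : Matrix ι ι R) := by
  have h : (P.map γ.ring * P).map γ.ring = _ := congrArg (fun Q : Matrix ι ι R => Q.map γ.ring) hP
  rw [Matrix.map_mul, map_map_grading] at h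
  rw [h, map_zsmul_one]

/-- The operator `x ↦ γ(x) P` on row vectors. -/
def matSq (P : Matrix ι ι R) (hP : P ∈ skewMat γ σ ι) : SkewSq γ σ (ι → R) where
  op :=
    { toFun := fun x => Matrix.vecMul (γ.ring ∘ x) P
      map_add' := fun x y => by
        rw [← Matrix.add_vecMul]; congr 1; ext; simp
      map_smul' := fun a x => by
        rw [← Matrix.smul_vecMul]; congr 1; ext; simp }
  sq x := by
    change Matrix.vecMul (γ.ring ∘ Matrix.vecMul (γ.ring ∘ x) P) P = _
    have h : γ.ring ∘ Matrix.vecMul (γ.ring ∘ x) P = Matrix.vecMul x (P.map γ.ring) := by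
      ext i
      rw [Function.comp_apply, RingHom.map_vecMul]
      congr 1
      ext; exact γ.invol _
    rw [h, Matrix.vecMul_vecMul, show P.map γ.ring * P = _ from hP, Matrix.vecMul_smul,
      Matrix.vecMul_one]

theorem matSq_apply (P : Matrix ι ι R) (hP : P ∈ skewMat γ σ ι) (x : ι → R) :
    (matSq P hP).op x = Matrix.vecMul (γ.ring ∘ x) P := rfl

theorem eq_sum_smul_single (x : ι → R) : x = ∑ k, x k • (Pi.single k 1 : ι → R) := by
  ext l
  simp [Finset.sum_apply, Pi.single_apply]

theorem op_eq_vecMul (J : (ι → R) →ₛₗ[γ.ring] (ι → R)) (x : ι → R) :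
    J x = Matrix.vecMul (γ.ring ∘ x) (Matrix.of fun k => J (Pi.single k 1)) := by
  conv_lhs => rw [eq_sum_smul_single x]
  rw [map_sum, Matrix.vecMul_eq_sum]
  exact Finset.sum_congr rfl fun k _ => LinearMap.map_smulₛₗ J _ _

/-- The matrix of an operator on a free module. -/
def SkewSq.toMat (J : SkewSq γ σ (ι → R)) : Matrix ι ι R :=
  Matrix.of fun k => J.op (Pi.single k 1)

theorem toMat_matSq (P : Matrix ι ι R) (hP : P ∈ skewMat γ σ ι) : (matSq P hP).toMat = P := by
  ext k l
  change Matrix.vecMul (γ.ring ∘ Pi.single k 1) P l = P k l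
  have : γ.ring ∘ (Pi.single k 1 : ι → R) = Pi.single k 1 := by
    ext j
    by_cases h : j = k
    · subst h; simp
    · simp [h]
  rw [this]
  simp

theorem SkewSq.toMat_mem (J : SkewSq γ σ (ι → R)) : J.toMat ∈ skewMat γ σ ι := by
  change J.toMat.map γ.ring * J.toMat = _
  ext k l
  have h1 : J.op (J.op (Pi.single k 1)) = (σ : ℤ) • Pi.single k 1 := J.sq _
  rw [op_eq_vecMul J.op (J.op (Pi.single k 1))] at h1
  rw [Matrix.mul_apply_eq_vecMul]
  refine (congrFun h1 l).trans ?_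
  simp [Matrix.one_apply, Pi.single_apply, eq_comm]

theorem SkewSq.eq_matSq (J : SkewSq γ σ (ι → R)) : J = matSq J.toMat J.toMat_mem := by
  ext1 x
  exact op_eq_vecMul J.op x

/-- A homotopy of operators on a free module is a path of matrices. -/
theorem skewHomotopic_matSq_iff [IsTopologicalRing R] {P Q : Matrix ι ι R}
    (hP : P ∈ skewMat γ σ ι) (hQ : Q ∈ skewMat γ σ ι) :
    SkewHomotopic (matSq P hP) (matSq Q hQ) ↔ JoinedIn (skewMat γ σ ι) P Q := by
  constructor
  · rintro ⟨F, hF, h0, h1⟩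
    refine ⟨⟨⟨fun t => (F t).toMat, ?_⟩, ?_, ?_⟩, fun t => (F t).toMat_mem⟩
    · refine continuous_matrix fun k l => ?_
      exact (continuous_apply l).comp (hF.continuous_map LinearMap.id (Pi.single k 1))
    · change (F 0).toMat = P
      rw [h0, toMat_matSq]
    · change (F 1).toMat = Q
      rw [h1, toMat_matSq]
  · rintro ⟨p, hp⟩
    refine ⟨fun t => matSq (p t) (hp t), ?_, ?_, ?_⟩
    · refine PathContinuous.of_fintype LinearMap.id LinearMap.id (fun _ => rfl) fun m k => ?_
      change Continuous fun t => Matrix.vecMul (γ.ring ∘ m) (p t) k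
      have : Continuous fun t => p t := p.continuous
      exact (continuous_apply k).comp (continuous_const.matrix_vecMul this)
    · ext1 x; simp only [matSq_apply, p.source]
    · ext1 x; simp only [matSq_apply, p.target]

theorem fromBlocks_mem_skewMat {P : Matrix ι ι R} {Q : Matrix κ κ R} (hP : P ∈ skewMat γ σ ι)
    (hQ : Q ∈ skewMat γ σ κ) : Matrix.fromBlocks P 0 0 Q ∈ skewMat γ σ (ι ⊕ κ) := by
  change (Matrix.fromBlocks P 0 0 Q).map γ.ring * _ = _
  rw [Matrix.fromBlocks_map, Matrix.fromBlocks_multiply, show P.map γ.ring * P = _ from hP,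
    show Q.map γ.ring * Q = _ from hQ, ← Matrix.fromBlocks_one, Matrix.fromBlocks_smul]
  simp

theorem sumArrow_matSq {P : Matrix ι ι R} {Q : Matrix κ κ R} (hP : P ∈ skewMat γ σ ι)
    (hQ : Q ∈ skewMat γ σ κ) (x : ι ⊕ κ → R) :
    LinearEquiv.sumArrowLequivProdArrow ι κ R R
        ((matSq _ (fromBlocks_mem_skewMat hP hQ)).op x) =
      ((matSq P hP).prod (matSq Q hQ)).op (LinearEquiv.sumArrowLequivProdArrow ι κ R R x) := by
  rw [matSq_apply, Matrix.vecMul_fromBlocks]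
  simp only [Matrix.vecMul_zero, add_zero, zero_add]
  rfl

theorem submatrix_mem_skewMat {P : Matrix ι ι R} (hP : P ∈ skewMat γ σ ι) (f : κ ≃ ι) :
    P.submatrix f f ∈ skewMat γ σ κ := by
  change (P.submatrix f f).map γ.ring * _ = _
  rw [← Matrix.submatrix_map, Matrix.submatrix_mul_equiv, show P.map γ.ring * P = _ from hP,
    Matrix.submatrix_smul, Pi.smul_apply, Pi.smul_apply, Matrix.submatrix_one_equiv]

theorem funCongrLeft_matSq {P : Matrix ι ι R} (hP : P ∈ skewMat γ σ ι) (f : κ ≃ ι) (x : ι → R) :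
    LinearEquiv.funCongrLeft R R f ((matSq P hP).op x) =
      (matSq _ (submatrix_mem_skewMat hP f)).op (LinearEquiv.funCongrLeft R R f x) := by
  rw [matSq_apply, matSq_apply, Matrix.submatrix_vecMul_equiv]
  ext k
  change Matrix.vecMul (γ.ring ∘ x) P (f k) =
    Matrix.vecMul ((γ.ring ∘ (x ∘ f)) ∘ f.symm) P (f k)
  congr 2
  ext; simp

/-- Right multiplication by an invertible matrix. -/
def vecMulEquiv (g h : Matrix ι ι R) (hgh : g * h = 1) (hhg : h * g = 1) : (ι → R) ≃ₗ[R] (ι → R) :=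
  LinearEquiv.ofLinearMap (Matrix.vecMulLinear g) (Matrix.vecMulLinear h)
    (by refine LinearMap.ext fun x => ?_; simp [Matrix.vecMul_vecMul, hhg]) (by refine LinearMap.ext fun x => ?_; simp [Matrix.vecMul_vecMul, hgh])

theorem vecMulEquiv_matSq {P Q g h : Matrix ι ι R} (hgh : g * h = 1) (hhg : h * g = 1)
    (hP : P ∈ skewMat γ σ ι) (hQ : Q ∈ skewMat γ σ ι) (hg : P * g = g.map γ.ring * Q)
    (x : ι → R) :
    vecMulEquiv g h hgh hhg ((matSq P hP).op x) =
      (matSq Q hQ).op (vecMulEquiv g h hgh hhg x) := by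
  change Matrix.vecMul (Matrix.vecMul (γ.ring ∘ x) P) g =
    Matrix.vecMul (γ.ring ∘ Matrix.vecMul x g) Q
  have : γ.ring ∘ Matrix.vecMul x g = Matrix.vecMul (γ.ring ∘ x) (g.map γ.ring) := by
    ext; exact RingHom.map_vecMul _ _ _ _
  rw [this, Matrix.vecMul_vecMul, Matrix.vecMul_vecMul, hg]

/-- Here Q = γ(h) P g, the change of basis appropriate to skew-linear operators. Then γ(Q) Q = h
γ(P) γ(g) Q = h γ(P) P g = σ. -/
theorem mem_skewMat_of_conj {P Q g h : Matrix ι ι R} (hhg : h * g = 1)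
    (hP : P ∈ skewMat γ σ ι) (hg : P * g = g.map γ.ring * Q) : Q ∈ skewMat γ σ ι := by
  have h1 : h.map γ.ring * g.map γ.ring = 1 := by
    rw [← Matrix.map_mul, hhg, Matrix.map_one _ (map_zero _) (map_one _)]
  have hQ : Q = h.map γ.ring * (P * g) := by rw [hg, ← mul_assoc, h1, one_mul]
  have hP' : P.map γ.ring * P = (σ : ℤ) • (1 : Matrix ι ι R) := hP
  change Q.map γ.ring * Q = _
  have h2 : Q.map γ.ring = h * (P.map γ.ring * g.map γ.ring) := by
    rw [hQ, Matrix.map_mul, map_map_grading, Matrix.map_mul]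
  rw [h2, mul_assoc, mul_assoc, ← hg, ← mul_assoc (P.map _), hP', smul_mul_assoc, one_mul,
    mul_smul_comm, hhg]

/-- The class of the triple `(R^ι, P, Q)`. -/
def matCls {P Q : Matrix ι ι R} (hP : P ∈ skewMat γ σ ι) (hQ : Q ∈ skewMat γ σ ι) :
    KUnital.{u, u} γ σ :=
  Quotient.mk _ (KTriple.of (ι → R) (matSq P hP) (matSq Q hQ))

theorem matCls_congr {P Q P' Q' : Matrix ι ι R} (hP : P ∈ skewMat γ σ ι)
    (hP' : P' ∈ skewMat γ σ ι) (hQ : Q ∈ skewMat γ σ ι) (hQ' : Q' ∈ skewMat γ σ ι) (h : P = P')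
    (h' : Q = Q') : matCls hP hQ = matCls hP' hQ' := by
  subst h h'; rfl

variable [IsTopologicalRing R] [ContinuousSMul ℝ R]

theorem matCls_eq_zero {P Q : Matrix ι ι R} {hP : P ∈ skewMat γ σ ι} {hQ : Q ∈ skewMat γ σ ι}
    (h : JoinedIn (skewMat γ σ ι) P Q) : matCls hP hQ = 0 :=
  Quotient.sound (KTriple.Elementary.equiv_zero ((skewHomotopic_matSq_iff hP hQ).2 h))

theorem matCls_add_matCls {P Q S : Matrix ι ι R} (hP : P ∈ skewMat γ σ ι)
    (hQ : Q ∈ skewMat γ σ ι) (hS : S ∈ skewMat γ σ ι) :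
    matCls hP hQ + matCls hQ hS = matCls hP hS :=
  Quotient.sound (KTriple.of_sum_of_equiv _ _ _)

theorem matCls_fromBlocks {P Q : Matrix ι ι R} {P' Q' : Matrix κ κ R} (hP : P ∈ skewMat γ σ ι)
    (hQ : Q ∈ skewMat γ σ ι) (hP' : P' ∈ skewMat γ σ κ) (hQ' : Q' ∈ skewMat γ σ κ) :
    matCls (fromBlocks_mem_skewMat hP hP') (fromBlocks_mem_skewMat hQ hQ') =
      matCls hP hQ + matCls hP' hQ' :=
  Quotient.sound (KTriple.Iso.equiv ⟨LinearEquiv.sumArrowLequivProdArrow ι κ R R,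
    sumArrow_matSq hP hP', sumArrow_matSq hQ hQ'⟩)

theorem matCls_submatrix {P Q : Matrix ι ι R} (hP : P ∈ skewMat γ σ ι)
    (hQ : Q ∈ skewMat γ σ ι) (f : κ ≃ ι) :
    matCls (submatrix_mem_skewMat hP f) (submatrix_mem_skewMat hQ f) = matCls hP hQ :=
  (Quotient.sound (KTriple.Iso.equiv ⟨LinearEquiv.funCongrLeft R R f,
    funCongrLeft_matSq hP f, funCongrLeft_matSq hQ f⟩)).symm

theorem matCls_conj {P Q P' Q' g h : Matrix ι ι R} (hgh : g * h = 1) (hhg : h * g = 1)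
    (hP : P ∈ skewMat γ σ ι) (hQ : Q ∈ skewMat γ σ ι) (hP' : P' ∈ skewMat γ σ ι)
    (hQ' : Q' ∈ skewMat γ σ ι) (hg : P * g = g.map γ.ring * P')
    (hg' : Q * g = g.map γ.ring * Q') : matCls hP hQ = matCls hP' hQ' :=
  Quotient.sound (KTriple.Iso.equiv ⟨vecMulEquiv g h hgh hhg,
    vecMulEquiv_matSq hgh hhg hP hP' hg, vecMulEquiv_matSq hgh hhg hQ hQ' hg'⟩)

end MatrixOperators

/-! ### Cofinal operators and representatives of classes. -/

section Cofinal

variable {R : Type u} [Ring R] [Algebra ℝ R] [TopologicalSpace R]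
  {γ : Grading R} {σ : ℤˣ} {p : Type} [Fintype p] [DecidableEq p]

/-- The block diagonal matrix with blocks `P₀`. -/
def blockMat (κ : Type) [DecidableEq κ] (P₀ : Matrix p p R) : Matrix (κ × p) (κ × p) R :=
  Matrix.comp κ κ p p R (Matrix.diagonal fun _ => P₀)

theorem blockMat_map {S : Type*} [Ring S] (f : R →+* S) (κ : Type) [DecidableEq κ]
    (P₀ : Matrix p p R) : (blockMat κ P₀).map f = blockMat κ (P₀.map f) := by
  ext ⟨k, i⟩ ⟨l, j⟩
  by_cases h : k = l
  · subst h; simp [blockMat]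
  · simp [blockMat, h]

theorem blockMat_mul (κ : Type) [Fintype κ] [DecidableEq κ] (P Q : Matrix p p R) :
    blockMat κ P * blockMat κ Q = blockMat κ (P * Q) := by
  have := (map_mul (Matrix.compRingEquiv κ p R) (Matrix.diagonal fun _ => P)
    (Matrix.diagonal fun _ => Q)).symm
  rw [Matrix.diagonal_mul_diagonal] at this
  exact this

theorem blockMat_zsmul_one (κ : Type) [DecidableEq κ] (n : ℤ) :
    blockMat κ (n • (1 : Matrix p p R)) = n • 1 := by
  ext ⟨k, i⟩ ⟨l, j⟩
  by_cases h : k = l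
  · subst h; by_cases h' : i = j <;> simp [-zsmul_eq_mul, -zsmul_one, blockMat, h']
  · simp [-zsmul_eq_mul, -zsmul_one, blockMat, h]

theorem blockMat_mem_skewMat (κ : Type) [Fintype κ] [DecidableEq κ] {P₀ : Matrix p p R}
    (h : P₀ ∈ skewMat γ σ p) : blockMat κ P₀ ∈ skewMat γ σ (κ × p) := by
  change (blockMat κ P₀).map γ.ring * _ = _
  rw [blockMat_map, blockMat_mul, show P₀.map γ.ring * P₀ = _ from h, blockMat_zsmul_one]

/-- Adding further copies of P₀ is again a multiple of P₀, once (κ ⊕ l) × p is reindexed as κ × p ⊕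
l × p. -/
theorem fromBlocks_blockMat (κ l : Type) [DecidableEq κ] [DecidableEq l] (P₀ : Matrix p p R) :
    blockMat (κ ⊕ l) P₀ = (Matrix.fromBlocks (blockMat κ P₀) 0 0 (blockMat l P₀)).submatrix
      (Equiv.sumProdDistrib κ l p) (Equiv.sumProdDistrib κ l p) := by
  ext ⟨k | k, i⟩ ⟨k' | k', j⟩ <;> simp [blockMat, Matrix.diagonal_apply]

/-- The operator `P₀` is cofinal if every `(M, J)` is a direct summand of a multiple of it. -/
def Cofinal (γ : Grading R) (σ : ℤˣ) {P₀ : Matrix p p R} (h₀ : P₀ ∈ skewMat γ σ p) : Prop :=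
  ∀ (M : Type v) [AddCommGroup M] [Module R M] [Module.Finite R M] [Module.Projective R M]
    (J : SkewSq γ σ M), ∃ n : ℕ, J.IsRetract (matSq _ (blockMat_mem_skewMat (Fin n) h₀))

variable [IsTopologicalRing R] [ContinuousSMul ℝ R] {P₀ : Matrix p p R} {h₀ : P₀ ∈ skewMat γ σ p}
  {ι : Type} [Fintype ι] [DecidableEq ι]

/-- If the class of `(R^ι, P, Q)` vanishes, then `P` and `Q` are stably homotopic. -/
theorem exists_joinedIn_of_equiv_zero (hc : Cofinal.{u, v} γ σ h₀) {T : KTriple.{u, v} γ σ}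
    (hT : T.Equiv KTriple.zero) (e : T.M ≃ₗ[R] (ι → R)) {P Q : Matrix ι ι R}
    (hP : P ∈ skewMat γ σ ι) (hQ : Q ∈ skewMat γ σ ι)
    (hP' : ∀ x, e (T.J₁.op x) = (matSq P hP).op (e x))
    (hQ' : ∀ x, e (T.J₂.op x) = (matSq Q hQ).op (e x)) :
    ∃ n : ℕ, JoinedIn (skewMat γ σ (ι ⊕ Fin n × p)) (Matrix.fromBlocks P 0 0 (blockMat (Fin n) P₀))
      (Matrix.fromBlocks Q 0 0 (blockMat (Fin n) P₀)) := by
  obtain ⟨E, hE⟩ := KTriple.exists_homotopic_of_equiv_zero hT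
  obtain ⟨n, hn⟩ := hc E.M E.J₁
  obtain ⟨N, _, _, K, f, hf⟩ := hn.exists_complement
  refine ⟨n, ?_⟩
  have hb := blockMat_mem_skewMat (Fin n) h₀
  rw [← skewHomotopic_matSq_iff (fromBlocks_mem_skewMat hP hb) (fromBlocks_mem_skewMat hQ hb)]
  -- `K` completes the stabilising operator `E.J₁` to a multiple of P₀, and it is kept constant
  -- along the homotopy.
  have h2 := hE.prod (SkewHomotopic.refl K)
  let a := ((LinearEquiv.prodAssoc R T.M E.M N).trans (e.prodCongr f)).trans
    (LinearEquiv.sumArrowLequivProdArrow ι (Fin n × p) R R).symm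
  have ha : ∀ (L : SkewSq γ σ T.M) (S : Matrix ι ι R) (hS : S ∈ skewMat γ σ ι),
      (∀ x, e (L.op x) = (matSq S hS).op (e x)) → ∀ x,
      a.symm ((matSq _ (fromBlocks_mem_skewMat hS hb)).op x) =
        ((L.prod E.J₁).prod K).op (a.symm x) := by
    intro L S hS hL x
    obtain ⟨y, rfl⟩ := a.surjective x
    rw [LinearEquiv.symm_apply_eq, LinearEquiv.symm_apply_apply]
    apply (LinearEquiv.sumArrowLequivProdArrow ι (Fin n × p) R R).injective
    rw [sumArrow_matSq hS hb]
    simp only [a, LinearEquiv.trans_apply, LinearEquiv.apply_symm_apply]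
    exact Prod.ext (hL _).symm (hf (y.1.2, y.2)).symm
  exact h2.of_equiv a.symm (ha T.J₁ P hP hP') (ha T.J₂ Q hQ hQ')

/-- Every class is the class of some `(R^(n × p), P, P₀)`. -/
theorem exists_matCls_eq (hc : Cofinal.{u, u} γ σ h₀) (x : KUnital.{u, u} γ σ) :
    ∃ (n : ℕ) (P : Matrix (Fin n × p) (Fin n × p) R) (hP : P ∈ skewMat γ σ (Fin n × p)),
      matCls hP (blockMat_mem_skewMat (Fin n) h₀) = x := by
  obtain ⟨T, rfl⟩ := Quotient.exists_rep x
  obtain ⟨n, hn⟩ := hc T.M T.J₂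
  obtain ⟨N, _, _, K, f, hf⟩ := hn.exists_complement
  let J := (T.J₁.prod K).conj f.symm
  refine ⟨n, J.toMat, J.toMat_mem, ?_⟩
  -- Adding (N, K, K) leaves the class unchanged, while `f` identifies the second operator with a
  -- multiple of P₀.
  have h1 : (T.sum (KTriple.of N K K)).Equiv T :=
    ((KTriple.Equiv.refl T).sum (KTriple.Elementary.equiv_zero
      (E := KTriple.of N K K) (SkewHomotopic.refl K))).trans
      (KTriple.sum_zero T).equiv
  refine (Quotient.sound ((KTriple.Iso.equiv ⟨f, fun m => ?_, hf⟩).symm.trans h1))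
  change f ((T.J₁.prod K).op m) = (matSq J.toMat J.toMat_mem).op (f m)
  rw [← SkewSq.eq_matSq J]
  exact congrArg (fun y => f ((T.J₁.prod K).op y)) (f.symm_apply_apply m).symm

end Cofinal

end GradedK

end

noncomputable section

namespace GradedK

/-! ### Lifting paths of operators over a finite-dimensional algebra. -/

section PathLifting

/-- In a finite-dimensional algebra, inverses depend continuously on the element. -/
theorem exists_continuous_inverse {D : Type*} [Ring D] [Algebra ℝ D] [TopologicalSpace D]
    [IsTopologicalRing D] [ContinuousSMul ℝ D] [T2Space D] [FiniteDimensional ℝ D] {X : Type*}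
    [TopologicalSpace X] {x : X → D} (hx : Continuous x)
    (hdet : ∀ t, (Algebra.leftMulMatrix (Module.finBasis ℝ D) (x t)).det ≠ 0) :
    ∃ y : X → D, Continuous y ∧ (∀ t, x t * y t = 1) ∧ ∀ t, y t * x t = 1 := by
  let b := Module.finBasis ℝ D
  let L := Algebra.leftMulMatrix b
  have hL : Continuous L := L.toLinearMap.continuous_of_finiteDimensional
  have hLx : Continuous fun t => L (x t) := hL.comp hx
  have hb : Continuous b.equivFun.symm :=
    b.equivFun.symm.toLinearMap.continuous_of_finiteDimensional
  have hinv : Continuous fun t => (L (x t))⁻¹ := by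
    simp only [Matrix.inv_def, Ring.inverse_eq_inv']
    exact (hLx.matrix_det.inv₀ hdet).smul hLx.matrix_adjugate
  -- The inverse solves the linear system x y = 1; the inverse of the matrix of left multiplication
  -- is continuous by the adjugate formula.
  have h1 : ∀ t, x t * b.equivFun.symm ((L (x t))⁻¹.mulVec (b.equivFun 1)) = 1 := fun t => by
    apply b.equivFun.injective
    have h2 := Algebra.leftMulMatrix_mulVec_repr b (x t)
      (b.equivFun.symm ((L (x t))⁻¹.mulVec (b.equivFun 1)))
    change (L (x t)).mulVec (b.equivFun (b.equivFun.symm _)) = b.equivFun _ at h2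
    rw [← h2, LinearEquiv.apply_symm_apply, Matrix.mulVec_mulVec,
      Matrix.mul_nonsing_inv _ (isUnit_iff_ne_zero.2 (hdet t)), Matrix.one_mulVec]
  refine ⟨fun t => b.equivFun.symm ((L (x t))⁻¹.mulVec (b.equivFun 1)),
    hb.comp (hinv.matrix_mulVec continuous_const), h1, fun t => ?_⟩
  -- The right inverse is also a left inverse because this holds for square real matrices.
  apply Algebra.leftMulMatrix_injective b
  have h2 := congrArg L (h1 t)
  rw [map_mul, map_one L] at h2
  exact (map_mul L _ _).trans ((mul_eq_one_comm.1 h2).trans (map_one L).symm)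

variable {F : Type w} [Ring F] [Algebra ℝ F] [TopologicalSpace F] [IsTopologicalRing F]
  [ContinuousSMul ℝ F] [T2Space F] [FiniteDimensional ℝ F] {δ : Grading F} {σ : ℤˣ}
  {ι : Type} [Fintype ι] [DecidableEq ι]

theorem map_real_smul_matrix (c : ℝ) (P : Matrix ι ι F) :
    (c • P).map δ.ring = c • P.map δ.ring := by
  ext i j
  exact map_smul δ.hom c (P i j)

/-- The matrix intertwining two nearby operators. -/
def intertwiner (δ : Grading F) (σ : ℤˣ) (P Q : Matrix ι ι F) : Matrix ι ι F :=
  (2⁻¹ : ℝ) • (1 + (σ : ℤ) • (P.map δ.ring * Q))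

/-- This normalisation is what makes the intertwiner of two nearby operators invertible. -/
theorem intertwiner_self {P : Matrix ι ι F} (hP : P ∈ skewMat δ σ ι) :
    intertwiner δ σ P P = 1 := by
  rw [intertwiner, show P.map δ.ring * P = _ from hP, smul_smul, ← Units.val_mul,
    Int.units_mul_self, Units.val_one, one_smul, ← two_smul ℝ, smul_smul]
  norm_num

/-- Both sides equal ½(P + Q), as σδ(P) is inverse to P and σδ(Q) to Q. -/
theorem mul_intertwiner {P Q : Matrix ι ι F} (hP : P ∈ skewMat δ σ ι) (hQ : Q ∈ skewMat δ σ ι) :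
    P * intertwiner δ σ P Q = (intertwiner δ σ P Q).map δ.ring * Q := by
  have hσ : ∀ T : Matrix ι ι F, (σ : ℤ) • (σ : ℤ) • T = T := fun T => by
    rw [smul_smul, ← Units.val_mul, Int.units_mul_self, Units.val_one, one_smul]
  have h1 : (intertwiner δ σ P Q).map δ.ring =
      (2⁻¹ : ℝ) • (1 + (σ : ℤ) • (P * Q.map δ.ring)) := by
    rw [intertwiner, map_real_smul_matrix]
    have := Matrix.map_add δ.ring (map_add _) (1 : Matrix ι ι F) ((σ : ℤ) • (P.map δ.ring * Q))
    rw [this, Matrix.map_one _ (map_zero _) (map_one _)]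
    have h2 : ((σ : ℤ) • (P.map δ.ring * Q)).map δ.ring =
        (σ : ℤ) • (P.map δ.ring * Q).map δ.ring := by
      ext i j; exact map_zsmul δ.ring _ _
    rw [h2, Matrix.map_mul, map_map_grading]
  rw [h1, intertwiner, mul_smul_comm, smul_mul_assoc, mul_add, add_mul, mul_one, one_mul,
    mul_smul_comm, smul_mul_assoc, ← mul_assoc, mul_map_of_mem_skewMat hP, mul_assoc P,
    show Q.map δ.ring * Q = _ from hQ, smul_mul_assoc, one_mul, mul_smul_comm, mul_one, hσ, hσ,
    add_comm]

theorem continuous_matrix_map_grading : Continuous fun P : Matrix ι ι F => P.map δ.ring :=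
  continuous_id.matrix_map δ.cont

/-- Paths of operators over a finite-dimensional algebra lift to paths of invertible matrices. -/
theorem exists_path_lift {Q : unitInterval → Matrix ι ι F} (hQ : Continuous Q)
    (hs : ∀ t, Q t ∈ skewMat δ σ ι) :
    ∃ g h : unitInterval → Matrix ι ι F, Continuous g ∧ Continuous h ∧ (∀ t, g t * h t = 1) ∧
      (∀ t, h t * g t = 1) ∧ g 0 = 1 ∧ ∀ t, Q 0 * g t = (g t).map δ.ring * Q t := by
  let G : unitInterval × unitInterval → Matrix ι ι F :=
    fun x => intertwiner δ σ (Q x.1) (Q x.2)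
  have hG : Continuous G := by
    have h1 : Continuous fun x : unitInterval × unitInterval => (Q x.1).map δ.ring :=
      continuous_matrix_map_grading.comp (hQ.comp continuous_fst)
    have h2 : Continuous fun x : unitInterval × unitInterval => Q x.2 := hQ.comp continuous_snd
    exact (continuous_const.add ((h1.mul h2).const_smul (σ : ℤ))).const_smul (2⁻¹ : ℝ)
  let L := Algebra.leftMulMatrix (Module.finBasis ℝ (Matrix ι ι F))
  have hL : Continuous L := L.toLinearMap.continuous_of_finiteDimensional
  let d : unitInterval × unitInterval → ℝ := fun x => (L (G x)).det
  have hd : Continuous d := (hL.comp hG).matrix_det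
  have hd1 : ∀ t, d (t, t) = 1 := fun t => by
    simp only [d, G, intertwiner_self (hs t), map_one, Matrix.det_one]
  -- The determinant `d` is 1 on the diagonal of a compact square, so it stays non-zero on a band of
  -- uniform width ε around the diagonal.
  obtain ⟨ε, hε, hdε⟩ := Metric.uniformContinuous_iff.1
    (CompactSpace.uniformContinuous_of_continuous hd) 1 one_pos
  have hne : ∀ s t, dist s t < ε → d (s, t) ≠ 0 := fun s t hst h0 => by
    have := hdε (a := (s, t)) (b := (s, s)) (by simpa [Prod.dist_eq, dist_comm] using hst)
    rw [hd1, h0] at this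
    simp at this
  obtain ⟨N, hN⟩ := exists_nat_one_div_lt hε
  let c : ℕ → unitInterval := fun k => Set.projIcc (0 : ℝ) 1 zero_le_one (k / (N + 1))
  have hc : ∀ k, dist (c k) (c (k + 1)) < ε := fun k => by
    refine lt_of_le_of_lt ?_ hN
    have := (LipschitzWith.projIcc (zero_le_one : (0 : ℝ) ≤ 1)).dist_le_mul
      ((k : ℝ) / (N + 1)) (((k + 1 : ℕ) : ℝ) / (N + 1))
    refine this.trans (le_of_eq ?_)
    rw [Real.dist_eq, abs_sub_comm, ← sub_div, abs_of_nonneg (by push_cast; simp; positivity)]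
    simp
  have hc0 : c 0 = 0 := by
    apply Subtype.ext; simp [c, Set.projIcc]
  have hcN : c (N + 1) = 1 := by
    have : ((N + 1 : ℕ) : ℝ) / (N + 1) = 1 := by
      push_cast; exact div_self (by positivity)
    apply Subtype.ext; simp only [c, this]; simp
  -- The path is stretched in stages: t ↦ Q(t c_k) is constant for c_0 = 0 and is Q itself for
  -- c_(N+1) = 1. Stage k multiplies the lift by the intertwiner of Q(t c_k) and Q(t c_(k+1)), whose
  -- parameters are within ε for every t.
  have key : ∀ k : ℕ, ∃ g h : unitInterval → Matrix ι ι F, Continuous g ∧ Continuous h ∧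
      (∀ t, g t * h t = 1) ∧ (∀ t, h t * g t = 1) ∧ g 0 = 1 ∧
      ∀ t, Q 0 * g t = (g t).map δ.ring * Q (t * c k) := by
    intro k
    induction k with
    | zero =>
      refine ⟨fun _ => 1, fun _ => 1, continuous_const, continuous_const, fun _ => one_mul 1,
        fun _ => one_mul 1, rfl, fun t => ?_⟩
      rw [hc0, mul_zero, Matrix.map_one _ (map_zero _) (map_one _), mul_one, one_mul]
    | succ k ih =>
      obtain ⟨g, h, hg, hh, hgh, hhg, h0, hQg⟩ := ih
      have hcont : Continuous fun t : unitInterval => G (t * c k, t * c (k + 1)) := by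
        refine hG.comp ?_
        fun_prop
      obtain ⟨y, hy, hy1, hy2⟩ := exists_continuous_inverse hcont fun t => by
        refine hne _ _ (lt_of_le_of_lt ?_ (hc k))
        rw [Subtype.dist_eq, Subtype.dist_eq, Real.dist_eq, Real.dist_eq]
        change |(t : ℝ) * c k - t * c (k + 1)| ≤ _
        rw [← mul_sub, abs_mul]
        refine mul_le_of_le_one_left (abs_nonneg _) ?_
        rw [abs_of_nonneg t.2.1]; exact t.2.2
      refine ⟨fun t => g t * G (t * c k, t * c (k + 1)), fun t => y t * h t, hg.mul hcont,
        hy.mul hh, fun t => ?_, fun t => ?_, ?_, fun t => ?_⟩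
      · rw [mul_assoc, ← mul_assoc _ (y t), hy1, one_mul, hgh]
      · rw [mul_assoc, ← mul_assoc (h t), hhg, one_mul, hy2]
      · simp only [zero_mul, h0, one_mul, G, intertwiner_self (hs 0)]
      · rw [← mul_assoc, hQg, mul_assoc, mul_intertwiner (hs _) (hs _), ← mul_assoc,
          ← Matrix.map_mul]
  obtain ⟨g, h, hg, hh, hgh, hhg, h0, hQg⟩ := key (N + 1)
  refine ⟨g, h, hg, hh, hgh, hhg, h0, fun t => ?_⟩
  rw [hQg, hcN, mul_one]

end PathLifting

end GradedK

end

noncomputable section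

namespace GradedK

/-! ### Base change of matrix operators. -/

section Kernel

variable {R : Type u} [Ring R] [Algebra ℝ R] [TopologicalSpace R] {γ : Grading R}
  {S : Type w} [Ring S] [Algebra ℝ S] [TopologicalSpace S] {δ : Grading S} {σ : ℤˣ}
  {ι : Type} [Fintype ι] [DecidableEq ι]

theorem map_ring_comm (f : GradedHom γ δ) {κ : Type} (P : Matrix ι κ R) :
    (P.map γ.ring).map f.ring = (P.map f.ring).map δ.ring := by
  ext i j; exact f.comm _

theorem map_mem_skewMat (f : GradedHom γ δ) {P : Matrix ι ι R} (hP : P ∈ skewMat γ σ ι) :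
    P.map f.ring ∈ skewMat δ σ ι := by
  change (P.map f.ring).map δ.ring * _ = _
  rw [← map_ring_comm, ← Matrix.map_mul, show P.map γ.ring * P = _ from hP, map_zsmul_one]

/-- Makes the map of K-groups computable: on free modules, base change is `f` applied to matrix
entries. -/
theorem exists_baseChange_free (f : GradedHom γ δ) (ι : Type) [Fintype ι] [DecidableEq ι] :
    ∃ e : BaseChange f.ring (ι → R) ≃ₗ[S] (ι → S), ∀ (P : Matrix ι ι R) (hP : P ∈ skewMat γ σ ι)
      (x : BaseChange f.ring (ι → R)),
      e (((matSq P hP).baseChange f).op x) = (matSq _ (map_mem_skewMat f hP)).op (e x) := by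
  let i : BaseChange f.ring (ι → R) →ₗ[S] (ι → S) :=
    BaseChange.lift (RingHom.id S) (AddMonoidHom.mk' (fun m k => f.ring (m k)) fun x y => by
      ext; simp) fun a m => by ext; simp
  have hi : ∀ m, i (BaseChange.ι f.ring m) = f.ring ∘ m := fun m => BaseChange.lift_ι _ _ _ m
  let r : (ι → S) →ₗ[S] BaseChange f.ring (ι → R) :=
    Fintype.linearCombination S fun k => BaseChange.ι f.ring (Pi.single k 1)
  have hsingle : ∀ k, f.ring ∘ (Pi.single k 1 : ι → R) = Pi.single k 1 := fun k => by
    ext l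
    by_cases h : l = k
    · subst h; simp
    · simp [h]
  have hir : i ∘ₗ r = LinearMap.id := by
    refine LinearMap.ext fun x => ?_
    simp only [r, LinearMap.comp_apply, Fintype.linearCombination_apply, map_sum, map_smul, hi,
      hsingle]
    exact (eq_sum_smul_single x).symm
  have hri : r ∘ₗ i = LinearMap.id := by
    refine BaseChange.hom_ext fun m => ?_
    rw [LinearMap.comp_apply, hi, LinearMap.id_apply]
    conv_rhs => rw [eq_sum_smul_single m, map_sum]
    simp only [r, Fintype.linearCombination_apply, LinearMap.map_smulₛₗ, Function.comp_apply]
  refine ⟨LinearEquiv.ofLinearMap i r hir hri, fun P hP x => ?_⟩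
  change i (((matSq P hP).baseChange f).op x) = (matSq _ (map_mem_skewMat f hP)).op (i x)
  induction x using BaseChange.induction with
  | h0 => simp only [map_zero]
  | ht s m =>
    rw [SkewSq.baseChange_smul_ι, map_smul, map_smul, LinearMap.map_smulₛₗ, hi, hi, matSq_apply,
      matSq_apply]
    congr 1
    ext k
    rw [Function.comp_apply, RingHom.map_vecMul]
    congr 1
    ext l; exact f.comm _
  | ha x y hx hy => simp only [map_add, hx, hy]

variable [IsTopologicalRing R] [ContinuousSMul ℝ R] [IsTopologicalRing S] [ContinuousSMul ℝ S]

/-- After base change the two operators coincide, and a constant path shows that such a triple is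
elementary. -/
theorem matCls_mem_ker (f : GradedHom γ δ) {P Q : Matrix ι ι R} (hP : P ∈ skewMat γ σ ι)
    (hQ : Q ∈ skewMat γ σ ι) (h : P.map f.ring = Q.map f.ring) :
    matCls hP hQ ∈ (KUnital.map f σ).ker := by
  obtain ⟨e, he⟩ := exists_baseChange_free (σ := σ) f ι
  refine Quotient.sound (KTriple.Elementary.equiv_zero ?_)
  change SkewHomotopic ((matSq P hP).baseChange f) ((matSq Q hQ).baseChange f)
  have : (matSq P hP).baseChange f = (matSq Q hQ).baseChange f := by
    ext1 x
    apply e.injective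
    rw [he, he, matSq_apply, matSq_apply, h]
  rw [this]
  exact SkewHomotopic.refl _

end Kernel

/-! ### The kernel of a split extension: normalising representatives and homotopies. -/

section SplitExtension

variable {R : Type u} [Ring R] [Algebra ℝ R] [TopologicalSpace R] [IsTopologicalRing R]
  [ContinuousSMul ℝ R] {γ : Grading R}
  {F : Type} [Ring F] [Algebra ℝ F] [TopologicalSpace F] [IsTopologicalRing F]
  [ContinuousSMul ℝ F] [T2Space F] [FiniteDimensional ℝ F] {δ : Grading F} {σ : ℤˣ}
  {p : Type} [Fintype p] [DecidableEq p] {P₀ : Matrix p p F} (h₀ : P₀ ∈ skewMat δ σ p)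
  (ε : GradedHom γ δ) (η : GradedHom δ γ) (hεη : ∀ x, ε.hom (η.hom x) = x)
  {ι : Type} [Fintype ι] [DecidableEq ι]

include hεη in
theorem map_map_of_split {κ : Type} (P : Matrix ι κ F) : (P.map η.ring).map ε.ring = P := by
  ext; exact hεη _

/-- Every class in the kernel of a split extension is represented by some operator which reduces
to a multiple of `P₀`. -/
theorem exists_matCls_eq_of_mem_ker (hcR : Cofinal.{u, u} γ σ (map_mem_skewMat η h₀))
    (hcF : Cofinal.{0, u} δ σ h₀) (hεη : ∀ x, ε.hom (η.hom x) = x) {x : KUnital.{u, u} γ σ}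
    (hx : x ∈ (KUnital.map.{u, u, 0} ε σ).ker) :
    ∃ (n m : ℕ) (P : Matrix ((Fin n ⊕ Fin m) × p) ((Fin n ⊕ Fin m) × p) R)
      (hP : P ∈ skewMat γ σ ((Fin n ⊕ Fin m) × p)),
      P.map ε.ring = blockMat (Fin n ⊕ Fin m) P₀ ∧
      matCls hP (blockMat_mem_skewMat _ (map_mem_skewMat η h₀)) = x := by
  obtain ⟨n, P, hP, rfl⟩ := exists_matCls_eq hcR x
  have hb : ∀ k, (blockMat (Fin k) (P₀.map η.ring)).map ε.ring = blockMat (Fin k) P₀ := fun k => by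
    rw [blockMat_map, map_map_of_split ε η hεη]
  have hbs := fun k => blockMat_mem_skewMat (Fin k) (map_mem_skewMat η h₀)
  obtain ⟨e, he⟩ := exists_baseChange_free (σ := σ) ε (Fin n × p)
  have h0 := Quotient.exact (show KUnital.map.{u, u, 0} ε σ _ = _ from hx)
  -- The class vanishes over `F`, so after stabilisation the reduction of `P` is joined to a
  -- multiple of P₀ by a path `q`, which is then lifted to invertible matrices `g`.
  obtain ⟨m, q, hq⟩ := exists_joinedIn_of_equiv_zero hcF h0 e (map_mem_skewMat ε hP)
    (map_mem_skewMat ε (hbs n)) (he P hP) (he _ (hbs n))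
  obtain ⟨g, h, hg, hh, hgh, hhg, hg0, hQ⟩ := exists_path_lift q.continuous hq
  rw [q.source] at hQ
  have mη : ∀ {A B : Matrix ((Fin n × p) ⊕ (Fin m × p)) ((Fin n × p) ⊕ (Fin m × p)) F},
      A * B = 1 → A.map η.ring * B.map η.ring = 1 := fun h => by
    rw [← Matrix.map_mul, h, Matrix.map_one _ (map_zero _) (map_one _)]
  have mγ : ∀ {A B : Matrix ((Fin n × p) ⊕ (Fin m × p)) ((Fin n × p) ⊕ (Fin m × p)) R},
      A * B = 1 → A.map γ.ring * B.map γ.ring = 1 := fun h => by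
    rw [← Matrix.map_mul, h, Matrix.map_one _ (map_zero _) (map_one _)]
  have mδ : ∀ {A B : Matrix ((Fin n × p) ⊕ (Fin m × p)) ((Fin n × p) ⊕ (Fin m × p)) F},
      A * B = 1 → A.map δ.ring * B.map δ.ring = 1 := fun h => by
    rw [← Matrix.map_mul, h, Matrix.map_one _ (map_zero _) (map_one _)]
  -- The lift is pushed to `R` by the splitting and acts by twisted conjugation. At t = 1 it turns
  -- the reduction of `P1` into that of the reference operator `D`.
  let act : Matrix ((Fin n × p) ⊕ (Fin m × p)) ((Fin n × p) ⊕ (Fin m × p)) R → unitInterval →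
    Matrix ((Fin n × p) ⊕ (Fin m × p)) ((Fin n × p) ⊕ (Fin m × p)) R :=
    fun A t => ((h t).map η.ring).map γ.ring * (A * (g t).map η.ring)
  have hact : ∀ A t, A * (g t).map η.ring = ((g t).map η.ring).map γ.ring * act A t :=
    fun A t => by rw [← mul_assoc, mγ (mη (hgh t)), one_mul]
  have hact' : ∀ {A} t, A ∈ skewMat γ σ _ → act A t ∈ skewMat γ σ _ := fun t hA =>
    mem_skewMat_of_conj (mη (hhg t)) hA (hact _ t)
  have hP1 := fromBlocks_mem_skewMat hP (hbs m)
  have hD := fromBlocks_mem_skewMat (hbs n) (hbs m)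
  set P1 := Matrix.fromBlocks P 0 0 (blockMat (Fin m) (P₀.map η.ring))
  set D := Matrix.fromBlocks (blockMat (Fin n) (P₀.map η.ring)) 0 0
    (blockMat (Fin m) (P₀.map η.ring))
  have hP1ε : P1.map ε.ring = Matrix.fromBlocks (P.map ε.ring) 0 0 (blockMat (Fin m) P₀) := by
    simp only [P1, Matrix.fromBlocks_map, hb]; simp
  have hDε : D.map ε.ring = Matrix.fromBlocks (blockMat (Fin n) P₀) 0 0 (blockMat (Fin m) P₀) := by
    simp only [D, Matrix.fromBlocks_map, hb]; simp
  have hε : (act P1 1).map ε.ring = D.map ε.ring := by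
    simp only [act]
    rw [Matrix.map_mul, Matrix.map_mul, map_ring_comm, map_map_of_split ε η hεη,
      map_map_of_split ε η hεη, hP1ε, hQ 1, q.target, ← mul_assoc, mδ (hhg 1), one_mul, hb, hDε]
  have hsum : matCls hP1 hD = matCls hP (hbs n) := by
    rw [matCls_fromBlocks hP (hbs n) (hbs m) (hbs m),
      matCls_eq_zero (hP := hbs m) (JoinedIn.refl (hbs m)), add_zero]
  -- The conjugation also moves `D`, but along a path starting at `D`, so the class does not notice.
  have hpath : JoinedIn (skewMat γ σ _) (act D 1) D := by
    refine JoinedIn.symm ⟨⟨⟨act D, ?_⟩, ?_, rfl⟩, fun t => hact' t hD⟩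
    · have h1 : Continuous fun t => ((h t).map η.ring).map γ.ring :=
        (hh.matrix_map η.cont).matrix_map γ.cont
      have h2 : Continuous fun t => (g t).map η.ring := hg.matrix_map η.cont
      exact h1.mul (continuous_const.mul h2)
    · have h0 : h 0 = 1 := by simpa only [hg0, one_mul] using hgh 0
      change ((h 0).map η.ring).map γ.ring * (D * (g 0).map η.ring) = D
      simp only [h0, hg0, Matrix.map_one _ (map_zero _) (map_one _), mul_one, one_mul]
  have hcls : matCls (hact' 1 hP1) hD = matCls hP (hbs n) := by
    rw [← hsum, matCls_conj (mη (hgh 1)) (mη (hhg 1)) hP1 hD (hact' 1 hP1) (hact' 1 hD)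
      (hact _ _) (hact _ _), ← matCls_add_matCls (hact' 1 hP1) (hact' 1 hD) hD,
      matCls_eq_zero hpath, add_zero]
  let f := Equiv.sumProdDistrib (Fin n) (Fin m) p
  refine ⟨n, m, (act P1 1).submatrix f f, submatrix_mem_skewMat (hact' 1 hP1) f, ?_, ?_⟩
  · rw [← Matrix.submatrix_map, hε, hDε, fromBlocks_blockMat]
  · rw [← hcls, ← matCls_submatrix (hact' 1 hP1) hD f]
    congr 1
    exact fromBlocks_blockMat _ _ _

/-- If the class of an operator reducing to a multiple of `P₀` vanishes, then it is stably
homotopic to a multiple of `P₀` through such operators. -/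
theorem exists_joinedIn_of_matCls_eq_zero (hcR : Cofinal.{u, u} γ σ (map_mem_skewMat η h₀))
    (hεη : ∀ x, ε.hom (η.hom x) = x) {κ : Type} [Fintype κ] [DecidableEq κ]
    {P : Matrix (κ × p) (κ × p) R} (hP : P ∈ skewMat γ σ (κ × p))
    (hPε : P.map ε.ring = blockMat κ P₀)
    (h0 : matCls hP (blockMat_mem_skewMat κ (map_mem_skewMat η h₀)) = 0) :
    ∃ n : ℕ, JoinedIn {Q | Q ∈ skewMat γ σ ((κ ⊕ Fin n) × p) ∧
        Q.map ε.ring = blockMat (κ ⊕ Fin n) P₀}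
      ((Matrix.fromBlocks P 0 0 (blockMat (Fin n) (P₀.map η.ring))).submatrix
        (Equiv.sumProdDistrib κ (Fin n) p) (Equiv.sumProdDistrib κ (Fin n) p))
      (blockMat (κ ⊕ Fin n) (P₀.map η.ring)) := by
  have hb : ∀ (k : Type) [DecidableEq k], (blockMat k (P₀.map η.ring)).map ε.ring =
      blockMat k P₀ := fun k _ => by
    rw [blockMat_map, map_map_of_split ε η hεη]
  obtain ⟨n, hJ⟩ := exists_joinedIn_of_equiv_zero hcR (Quotient.exact h0)
    (LinearEquiv.refl R _) hP (blockMat_mem_skewMat κ (map_mem_skewMat η h₀)) (fun _ => rfl)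
    (fun _ => rfl)
  refine ⟨n, ?_⟩
  set D := Matrix.fromBlocks (blockMat κ (P₀.map η.ring)) 0 0
    (blockMat (Fin n) (P₀.map η.ring)) with hDdef
  set DF := Matrix.fromBlocks (blockMat κ P₀) 0 0 (blockMat (Fin n) P₀) with hDFdef
  obtain ⟨q, hq⟩ := hJ
  have hDε : D.map ε.ring = DF := by
    simp only [D, DF, Matrix.fromBlocks_map, hb]; simp
  have hDη : D = DF.map η.ring := by
    simp only [D, DF, Matrix.fromBlocks_map, blockMat_map]; simp
  -- The reduction of the homotopy `q` is a loop at `DF`. Conjugating `q` by the inverse of its lift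
  -- makes the reduction constant.
  obtain ⟨g, h, hg, hh, hgh, hhg, hg0, hQ⟩ := exists_path_lift
    (σ := σ) (Q := fun t => (q t).map ε.ring) (q.continuous.matrix_map ε.cont)
    fun t => map_mem_skewMat ε (hq t)
  have hQ0 : (q 0).map ε.ring = DF := by
    rw [q.source, Matrix.fromBlocks_map, hb, hPε]; simp [DF]
  have hQ1 : (q 1).map ε.ring = DF := by rw [q.target, hDε]
  simp only [hQ0] at hQ
  have mη : ∀ {A B : Matrix ((κ × p) ⊕ (Fin n × p)) ((κ × p) ⊕ (Fin n × p)) F},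
      A * B = 1 → A.map η.ring * B.map η.ring = 1 := fun h => by
    rw [← Matrix.map_mul, h, Matrix.map_one _ (map_zero _) (map_one _)]
  have mγ : ∀ {A B : Matrix ((κ × p) ⊕ (Fin n × p)) ((κ × p) ⊕ (Fin n × p)) R},
      A * B = 1 → A.map γ.ring * B.map γ.ring = 1 := fun h => by
    rw [← Matrix.map_mul, h, Matrix.map_one _ (map_zero _) (map_one _)]
  let q' : unitInterval → Matrix ((κ × p) ⊕ (Fin n × p)) ((κ × p) ⊕ (Fin n × p)) R :=
    fun t => ((g t).map η.ring).map γ.ring * (q t * (h t).map η.ring)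
  have hq' : ∀ t, q' t ∈ skewMat γ σ _ := fun t =>
    mem_skewMat_of_conj (g := (h t).map η.ring) (h := (g t).map η.ring) (mη (hgh t)) (hq t) (by
      rw [← mul_assoc, mγ (mη (hhg t)), one_mul])
  have hq'ε : ∀ t, (q' t).map ε.ring = DF := fun t => by
    simp only [q']
    rw [Matrix.map_mul, Matrix.map_mul, map_ring_comm, map_map_of_split ε η hεη,
      map_map_of_split ε η hεη, ← mul_assoc, ← hQ t, mul_assoc, hgh, mul_one]
  have hcont : Continuous q' := by
    have h1 : Continuous fun t => ((g t).map η.ring).map γ.ring :=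
      (hg.matrix_map η.cont).matrix_map γ.cont
    have h2 : Continuous fun t => (h t).map η.ring := hh.matrix_map η.cont
    exact h1.mul (q.continuous.mul h2)
  let f := Equiv.sumProdDistrib κ (Fin n) p
  refine ⟨⟨⟨fun t => (q' t).submatrix f f, hcont.matrix_submatrix f f⟩, ?_, ?_⟩, fun t =>
    ⟨submatrix_mem_skewMat (hq' t) f, ?_⟩⟩
  · have h0 : h 0 = 1 := by simpa only [hg0, one_mul] using hgh 0
    have : q' 0 = q 0 := by
      simp only [q', h0, hg0, Matrix.map_one _ (map_zero _) (map_one _), mul_one, one_mul]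
    change (q' 0).submatrix f f = _
    rw [this, q.source]
  -- The lift of the loop need not end at 1. But DF g(1) = δ(g(1)) DF, so the twisted conjugation
  -- still fixes the image `D` of `DF` at the end point.
  · have : q' 1 = D := by
      simp only [q']
      rw [q.target, hDη, ← map_ring_comm, ← Matrix.map_mul, ← Matrix.map_mul, ← mul_assoc, ← hQ1,
        ← hQ 1, hQ1, mul_assoc, hgh, mul_one]
    change (q' 1).submatrix f f = _
    rw [this, hDdef, fromBlocks_blockMat]
  · change ((q' t).submatrix f f).map ε.ring = _
    rw [← Matrix.submatrix_map, hq'ε, fromBlocks_blockMat]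

end SplitExtension

end GradedK

end

noncomputable section

namespace GradedK

/-! ### Groups presented by stable homotopy classes of unitary matrices. -/

section Presentation

open scoped Matrix

variable {𝒜 : Type u} [NonUnitalRing 𝒜] [TopologicalSpace 𝒜] {α : 𝒜 →+ 𝒜}
  {ℬ : Type v} [NonUnitalRing ℬ] [TopologicalSpace ℬ] {β : ℬ →+ ℬ}

/-- The matrices `a` over a non-unital ring with `(1 + a) α(1 + a) = 1`. -/
def unitaries (α : 𝒜 →+ 𝒜) (κ : Type) [Fintype κ] : Set (Matrix κ κ 𝒜) :=
  {a | a + a.map α + a * a.map α = 0}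

theorem zero_mem_unitaries (κ : Type) [Fintype κ] : 0 ∈ unitaries α κ := by
  simp [unitaries]

theorem fromBlocks_mem_unitaries {κ l : Type} [Fintype κ] [Fintype l] {a : Matrix κ κ 𝒜}
    {b : Matrix l l 𝒜} (ha : a ∈ unitaries α κ) (hb : b ∈ unitaries α l) :
    Matrix.fromBlocks a 0 0 b ∈ unitaries α (κ ⊕ l) := by
  change Matrix.fromBlocks a 0 0 b + (Matrix.fromBlocks a 0 0 b).map α +
    Matrix.fromBlocks a 0 0 b * (Matrix.fromBlocks a 0 0 b).map α = 0
  have ha' : a + a.map α + a * a.map α = 0 := ha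
  have hb' : b + b.map α + b * b.map α = 0 := hb
  simp only [Matrix.fromBlocks_map, Matrix.fromBlocks_multiply, Matrix.fromBlocks_add,
    Matrix.map_zero _ (map_zero α), Matrix.mul_zero, Matrix.zero_mul, add_zero, zero_add, ha', hb',
    Matrix.fromBlocks_zero]

/-- A presentation of an abelian group by stable homotopy classes of unitary matrices. -/
structure Presentation (α : 𝒜 →+ 𝒜) (K : Type w) [AddCommGroup K] where
  /-- the class of a matrix -/
  cl : ∀ {κ : Type} [Fintype κ] [DecidableEq κ] (a : Matrix κ κ 𝒜), a ∈ unitaries α κ → K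
  surj : ∀ x : K, ∃ (κ : Type) (_ : Fintype κ) (_ : DecidableEq κ) (a : Matrix κ κ 𝒜)
    (ha : a ∈ unitaries α κ), cl a ha = x
  add : ∀ {κ l : Type} [Fintype κ] [DecidableEq κ] [Fintype l] [DecidableEq l]
    (a : Matrix κ κ 𝒜) (ha : a ∈ unitaries α κ) (b : Matrix l l 𝒜) (hb : b ∈ unitaries α l),
    cl _ (fromBlocks_mem_unitaries ha hb) = cl a ha + cl b hb
  zero_iff : ∀ {κ : Type} [Fintype κ] [DecidableEq κ] (a : Matrix κ κ 𝒜) (ha : a ∈ unitaries α κ),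
    cl a ha = 0 ↔ ∃ n : ℕ, JoinedIn (unitaries α (κ ⊕ Fin n)) (Matrix.fromBlocks a 0 0 0) 0

/-- Groups with the same presentation are isomorphic. -/
theorem Presentation.nonempty_addEquiv {K : Type*} [AddCommGroup K] {L : Type*} [AddCommGroup L]
    (p : Presentation α K) (q : Presentation α L) : Nonempty (K ≃+ L) := by
  -- Elements are related if one matrix represents both. Vanishing is the same condition on the
  -- matrix in either group, which forces this relation to be the graph of an isomorphism.
  let r : K → L → Prop := fun x y => ∃ (κ : Type) (_ : Fintype κ) (_ : DecidableEq κ)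
    (a : Matrix κ κ 𝒜) (ha : a ∈ unitaries α κ), p.cl a ha = x ∧ q.cl a ha = y
  have hr : ∀ x, ∃ y, r x y := fun x => by
    obtain ⟨κ, i, j, a, ha, h⟩ := p.surj x
    exact ⟨_, κ, i, j, a, ha, h, rfl⟩
  have hl : ∀ y, ∃ x, r x y := fun y => by
    obtain ⟨κ, i, j, a, ha, h⟩ := q.surj y
    exact ⟨_, κ, i, j, a, ha, rfl, h⟩
  have hadd : ∀ {x y x' y'}, r x y → r x' y' → r (x + x') (y + y') := by
    rintro _ _ _ _ ⟨κ, _, _, a, ha, rfl, rfl⟩ ⟨l, _, _, b, hb, rfl, rfl⟩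
    exact ⟨_, inferInstance, inferInstance, _, fromBlocks_mem_unitaries ha hb, p.add _ _ _ _,
      q.add _ _ _ _⟩
  have h0 : ∀ {x y}, r x y → (x = 0 ↔ y = 0) := by
    rintro _ _ ⟨κ, _, _, a, ha, rfl, rfl⟩
    rw [p.zero_iff, q.zero_iff]
  -- If `z` corresponds to -x, then y + z and y' + z both correspond to 0, hence vanish.
  have huniq : ∀ {x y y'}, r x y → r x y' → y = y' := fun {x y y'} h h' => by
    obtain ⟨z, hz⟩ := hr (-x)
    have e1 := (h0 (hadd h hz)).1 (add_neg_cancel x)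
    have e2 := (h0 (hadd h' hz)).1 (add_neg_cancel x)
    exact add_right_cancel (e1.trans e2.symm)
  choose f hf using hr
  let F : K →+ L := AddMonoidHom.mk' f fun x y => huniq (hf _) (hadd (hf x) (hf y))
  refine ⟨AddEquiv.ofBijective F ⟨(injective_iff_map_eq_zero F).2 fun x hx => (h0 (hf x)).2 hx,
    fun y => ?_⟩⟩
  obtain ⟨x, hx⟩ := hl y
  exact ⟨x, huniq (hf x) hx⟩

/-- Transposition makes `f` an anti-homomorphism on matrices, so the factors 1 + a and α(1 + a) are
exchanged. Applying α to their product shows that it is 1 in either order. -/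
theorem transpose_map_mem_unitaries (f : 𝒜 →+ ℬ) (hmul : ∀ x y, f (x * y) = f y * f x)
    (hα : ∀ x, f (α x) = β (f x)) (hαα : ∀ x, α (α x) = x)
    (hαm : ∀ x y, α (x * y) = α x * α y) {κ : Type} [Fintype κ] {a : Matrix κ κ 𝒜}
    (ha : a ∈ unitaries α κ) : aᵀ.map f ∈ unitaries β κ := by
  have h1 : ∀ i j, a i j + α (a i j) + ∑ k, a i k * α (a k j) = 0 := fun i j => congrFun₂ ha i j
  ext i j
  change f (a j i) + β (f (a j i)) + ∑ k, f (a k i) * β (f (a j k)) = 0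
  simp only [← hα, ← hmul]
  rw [← map_sum, ← map_add, ← map_add, ← map_zero f]
  congr 1
  have h2 := congrArg α (h1 j i)
  simp only [map_add, map_sum, hαm, hαα, map_zero] at h2
  rw [← h2]
  abel

/-- Presentations can be transported along anti-isomorphisms. -/
def Presentation.ofAntiEquiv {K : Type*} [AddCommGroup K] (p : Presentation α K) (f : ℬ ≃+ 𝒜)
    (hf : Continuous f) (hf' : Continuous f.symm) (hmul : ∀ x y, f (x * y) = f y * f x)
    (hα : ∀ x, f (β x) = α (f x)) (hαα : ∀ x, α (α x) = x)
    (hαm : ∀ x y, α (x * y) = α x * α y) : Presentation β K :=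
  have hmul' : ∀ x y, f.symm (x * y) = f.symm y * f.symm x := fun x y =>
    f.injective (by rw [hmul]; simp)
  have hβ : ∀ x, f.symm (α x) = β (f.symm x) := fun x => f.injective (by rw [hα]; simp)
  have hββ : ∀ x, β (β x) = x := fun x => f.injective (by rw [hα, hα, hαα])
  have hβm : ∀ x y, β (x * y) = β x * β y := fun x y => f.injective (by
    rw [hα, hmul, hαm, hmul, hα, hα])
  have hs : ∀ {κ : Type} [Fintype κ] {a : Matrix κ κ ℬ}, a ∈ unitaries β κ →
      aᵀ.map f ∈ unitaries α κ := fun {_ _ _} ha =>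
    transpose_map_mem_unitaries f.toAddMonoidHom hmul hα hββ hβm ha
  have hs' : ∀ {κ : Type} [Fintype κ] {a : Matrix κ κ 𝒜}, a ∈ unitaries α κ →
      aᵀ.map f.symm ∈ unitaries β κ := fun {_ _ _} ha =>
    transpose_map_mem_unitaries f.symm.toAddMonoidHom hmul' hβ hαα hαm ha
  have inv : ∀ {κ : Type} (a : Matrix κ κ 𝒜), (aᵀ.map f.symm)ᵀ.map f = a := fun a => by
    ext; simp
  have inv' : ∀ {κ : Type} (a : Matrix κ κ ℬ), (aᵀ.map f)ᵀ.map f.symm = a := fun a => by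
    ext; simp
  have blk : ∀ {κ l : Type} (a : Matrix κ κ ℬ) (b : Matrix l l ℬ),
      (Matrix.fromBlocks a 0 0 b)ᵀ.map f = Matrix.fromBlocks (aᵀ.map f) 0 0 (bᵀ.map f) :=
    fun a b => by ext (i | i) (j | j) <;> simp
  { cl := fun a ha => p.cl (aᵀ.map f) (hs ha)
    surj := fun x => by
      obtain ⟨κ, i, j, a, ha, h⟩ := p.surj x
      refine ⟨κ, i, j, aᵀ.map f.symm, hs' ha, ?_⟩
      rw [← h]
      congr 1
      exact inv a
    add := fun a ha b hb => by
      rw [← p.add]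
      congr 1
      exact blk a b
    zero_iff := fun a ha => by
      rw [p.zero_iff]
      refine exists_congr fun n => ?_
      have e : (Matrix.fromBlocks a 0 0 (0 : Matrix (Fin n) (Fin n) ℬ))ᵀ.map f =
          Matrix.fromBlocks (aᵀ.map f) 0 0 0 := by
        rw [blk]; simp
      have e' : (Matrix.fromBlocks (aᵀ.map f) 0 0 (0 : Matrix (Fin n) (Fin n) 𝒜))ᵀ.map f.symm =
          Matrix.fromBlocks a 0 0 0 := by
        rw [← e, inv']
      constructor
      · rintro ⟨s, hs''⟩
        refine ⟨⟨⟨fun t => (s t)ᵀ.map f.symm, ?_⟩, ?_, ?_⟩, fun t => hs' (hs'' t)⟩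
        · exact s.continuous.matrix_transpose.matrix_map hf'
        · change (s 0)ᵀ.map f.symm = _
          rw [s.source, e']
        · change (s 1)ᵀ.map f.symm = _
          rw [s.target]; simp
      · rintro ⟨s, hs''⟩
        refine ⟨⟨⟨fun t => (s t)ᵀ.map f, ?_⟩, ?_, ?_⟩, fun t => hs (hs'' t)⟩
        · exact s.continuous.matrix_transpose.matrix_map hf
        · change (s 0)ᵀ.map f = _
          rw [s.source, e]
        · change (s 1)ᵀ.map f = _
          rw [s.target]; simp }

end Presentation

/-! ### From a chart of the kernel to a presentation of its K-group. -/

section Chart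

variable {R : Type u} [Ring R] [Algebra ℝ R] [TopologicalSpace R] [IsTopologicalRing R]
  [ContinuousSMul ℝ R] {γ : Grading R}
  {F : Type} [Ring F] [Algebra ℝ F] [TopologicalSpace F] [IsTopologicalRing F]
  [ContinuousSMul ℝ F] [T2Space F] [FiniteDimensional ℝ F] {δ : Grading F} {σ : ℤˣ}
  {p : Type} [Fintype p] [DecidableEq p]
  {𝒜 : Type v} [NonUnitalRing 𝒜] [TopologicalSpace 𝒜] {α : 𝒜 →+ 𝒜}

/-- An identification of `(𝒜, α)` with the matrices over the kernel of `R → F`, with the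
automorphism `x ↦ γ(P₀⁻¹ x P₀)`. -/
structure Chart (ε : GradedHom γ δ) (η : GradedHom δ γ) (P₀ : Matrix p p F) (α : 𝒜 →+ 𝒜) where
  /-- the inclusion -/
  j : 𝒜 →ₙ+* Matrix p p R
  continuous_j : Continuous j
  /-- a left inverse -/
  q : Matrix p p R → 𝒜
  continuous_q : Continuous q
  q_j : ∀ a, q (j a) = a
  j_q : ∀ x : Matrix p p R, x.map ε.ring = 0 → j (q x) = x
  map_j : ∀ a, (j a).map ε.ring = 0
  j_α : ∀ a, P₀.map η.ring * (j (α a)).map γ.ring = j a * P₀.map η.ring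

namespace Chart

variable {ε : GradedHom γ δ} {η : GradedHom δ γ} {P₀ : Matrix p p F} (C : Chart ε η P₀ α)
  {κ l : Type} [Fintype κ] [DecidableEq κ] [Fintype l] [DecidableEq l]

/-- The inclusion on matrices. -/
def jMat (a : Matrix κ κ 𝒜) : Matrix (κ × p) (κ × p) R := Matrix.comp κ κ p p R (a.map C.j)

theorem jMat_add (a b : Matrix κ κ 𝒜) : C.jMat (a + b) = C.jMat a + C.jMat b := by
  ext ⟨k, i⟩ ⟨l, j⟩
  simp [jMat]

theorem jMat_mul (a b : Matrix κ κ 𝒜) : C.jMat (a * b) = C.jMat a * C.jMat b := by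
  have h : (a * b).map C.j = a.map C.j * b.map C.j := by
    ext1 i j
    simp only [Matrix.map_apply, Matrix.mul_apply, map_sum, map_mul]
  unfold jMat
  rw [h]
  exact map_mul (Matrix.compRingEquiv κ p R) _ _

theorem jMat_zero : C.jMat (0 : Matrix κ κ 𝒜) = 0 := by
  ext ⟨k, i⟩ ⟨l, j⟩
  simp [jMat]

/-- The inverse on matrices. -/
def qMat (x : Matrix (κ × p) (κ × p) R) : Matrix κ κ 𝒜 := ((Matrix.comp κ κ p p R).symm x).map C.q

theorem qMat_jMat (a : Matrix κ κ 𝒜) : C.qMat (C.jMat a) = a := by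
  ext i j
  simp [qMat, jMat, C.q_j]

theorem jMat_qMat (x : Matrix (κ × p) (κ × p) R) (hx : x.map ε.ring = 0) :
    C.jMat (C.qMat x) = x := by
  have h : ((Matrix.comp κ κ p p R).symm x).map (fun y => C.j (C.q y)) =
      (Matrix.comp κ κ p p R).symm x := by
    ext1 i j
    refine C.j_q _ ?_
    ext k l
    exact congrFun₂ hx (i, k) (j, l)
  change Matrix.comp κ κ p p R (((Matrix.comp κ κ p p R).symm x).map (fun y => C.j (C.q y))) = x
  rw [h, Equiv.apply_symm_apply]

theorem map_jMat (a : Matrix κ κ 𝒜) : (C.jMat a).map ε.ring = 0 := by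
  ext ⟨k, i⟩ ⟨l, j⟩
  exact congrFun₂ (C.map_j (a k l)) i j

theorem jMat_injective : Function.Injective (C.jMat (κ := κ)) :=
  Function.LeftInverse.injective C.qMat_jMat

theorem continuous_jMat : Continuous (C.jMat (κ := κ)) := by
  refine continuous_matrix fun i j => ?_
  exact (C.continuous_j.comp (continuous_id.matrix_elem i.1 j.1)).matrix_elem i.2 j.2

theorem continuous_qMat : Continuous (C.qMat (κ := κ)) := by
  refine continuous_matrix fun i j => C.continuous_q.comp ?_
  exact continuous_matrix fun k l => continuous_id.matrix_elem (i, k) (j, l)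

theorem blockMat_mul_jMat (a : Matrix κ κ 𝒜) :
    blockMat κ (P₀.map η.ring) * (C.jMat (a.map α)).map γ.ring =
      C.jMat a * blockMat κ (P₀.map η.ring) := by
  have h : (Matrix.diagonal fun _ : κ => P₀.map η.ring) *
      (a.map fun x => (C.j (α x)).map γ.ring) =
      a.map C.j * Matrix.diagonal fun _ => P₀.map η.ring := by
    ext1 k l
    rw [Matrix.diagonal_mul, Matrix.mul_diagonal]
    exact C.j_α _
  have h1 := map_mul (Matrix.compRingEquiv κ p R) (Matrix.diagonal fun _ : κ => P₀.map η.ring)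
    (a.map fun x => (C.j (α x)).map γ.ring)
  rw [h, map_mul] at h1
  exact h1.symm

/-- The operator `(1 + a) P₀`. -/
def mat (a : Matrix κ κ 𝒜) : Matrix (κ × p) (κ × p) R :=
  (1 + C.jMat a) * blockMat κ (P₀.map η.ring)

theorem mat_zero : C.mat (0 : Matrix κ κ 𝒜) = blockMat κ (P₀.map η.ring) := by
  rw [mat, jMat_zero, add_zero, one_mul]

theorem continuous_mat : Continuous (C.mat (κ := κ)) :=
  (continuous_const.add C.continuous_jMat).mul continuous_const

theorem mat_fromBlocks (a : Matrix κ κ 𝒜) (b : Matrix l l 𝒜) :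
    C.mat (Matrix.fromBlocks a 0 0 b) = (Matrix.fromBlocks (C.mat a) 0 0 (C.mat b)).submatrix
      (Equiv.sumProdDistrib κ l p) (Equiv.sumProdDistrib κ l p) := by
  have h : C.jMat (Matrix.fromBlocks a 0 0 b) =
      (Matrix.fromBlocks (C.jMat a) 0 0 (C.jMat b)).submatrix
        (Equiv.sumProdDistrib κ l p) (Equiv.sumProdDistrib κ l p) := by
    ext ⟨k | k, i⟩ ⟨k' | k', j⟩ <;> simp [jMat]
  have h1 : (1 : Matrix ((κ ⊕ l) × p) ((κ ⊕ l) × p) R) = (1 : Matrix _ _ R).submatrix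
      (Equiv.sumProdDistrib κ l p) (Equiv.sumProdDistrib κ l p) :=
    (Matrix.submatrix_one_equiv _).symm
  rw [mat, h, fromBlocks_blockMat, h1, show ∀ X Y : Matrix ((κ × p) ⊕ (l × p)) ((κ × p) ⊕ (l × p)) R,
      X.submatrix (Equiv.sumProdDistrib κ l p) (Equiv.sumProdDistrib κ l p) +
      Y.submatrix (Equiv.sumProdDistrib κ l p) (Equiv.sumProdDistrib κ l p) =
      (X + Y).submatrix (Equiv.sumProdDistrib κ l p) (Equiv.sumProdDistrib κ l p)
      from fun _ _ => rfl, Matrix.submatrix_mul_equiv, ← Matrix.fromBlocks_one, Matrix.fromBlocks_add,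
    Matrix.fromBlocks_multiply]
  simp [mat]

theorem map_mat (hεη : ∀ x, ε.hom (η.hom x) = x) (a : Matrix κ κ 𝒜) :
    (C.mat a).map ε.ring = blockMat κ P₀ := by
  have h : (1 + C.jMat a).map ε.ring = 1 := by
    have := Matrix.map_add ε.ring (map_add _) (1 : Matrix (κ × p) (κ × p) R) (C.jMat a)
    rw [this, C.map_jMat, add_zero, Matrix.map_one _ (map_zero _) (map_one _)]
  rw [mat, Matrix.map_mul, h, one_mul, blockMat_map, map_map_of_split ε η hεη]

/-- By `j_α`, P = (1 + a)P₀ is also P₀ γ(1 + α(a)). Hence γ(P)P = γ(1 + a) γ(P₀)P₀ γ(1 + α(a)) =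
σγ((1 + a)(1 + α(a))), and γ and σ can be cancelled. -/
theorem mat_mem_skewMat_iff (h₀ : P₀ ∈ skewMat δ σ p) (a : Matrix κ κ 𝒜) :
    C.mat a ∈ skewMat γ σ (κ × p) ↔ a ∈ unitaries α κ := by
  have hD := blockMat_mem_skewMat κ (map_mem_skewMat η h₀)
  have madd : ∀ x : Matrix (κ × p) (κ × p) R, (1 + x).map γ.ring = 1 + x.map γ.ring := fun x => by
    have := Matrix.map_add γ.ring (map_add _) (1 : Matrix (κ × p) (κ × p) R) x
    rw [this, Matrix.map_one _ (map_zero _) (map_one _)]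
  have h1 : C.mat a = blockMat κ (P₀.map η.ring) * (1 + C.jMat (a.map α)).map γ.ring := by
    rw [mat, madd, mul_add, add_mul, blockMat_mul_jMat, one_mul, mul_one]
  have h2 : (C.mat a).map γ.ring * C.mat a =
      (σ : ℤ) • ((1 + C.jMat a) * (1 + C.jMat (a.map α))).map γ.ring := by
    have h3 : (C.mat a).map γ.ring =
        (1 + C.jMat a).map γ.ring * (blockMat κ (P₀.map η.ring)).map γ.ring := by
      rw [mat, Matrix.map_mul]
    rw [h3, h1, mul_assoc, ← mul_assoc ((blockMat κ (P₀.map η.ring)).map γ.ring),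
      show (blockMat κ (P₀.map η.ring)).map γ.ring * _ = _ from hD, smul_mul_assoc, one_mul,
      mul_smul_comm, ← Matrix.map_mul]
  have h3 : (1 + C.jMat a) * (1 + C.jMat (a.map α)) =
      1 + C.jMat (a + a.map α + a * a.map α) := by
    rw [jMat_add, jMat_add, jMat_mul]
    noncomm_ring
  have hσ : ∀ T : Matrix (κ × p) (κ × p) R, (σ : ℤ) • (σ : ℤ) • T = T := fun T => by
    rw [smul_smul, ← Units.val_mul, Int.units_mul_self, Units.val_one, one_smul]
  change (C.mat a).map γ.ring * C.mat a = (σ : ℤ) • 1 ↔ a + a.map α + a * a.map α = 0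
  rw [h2, h3]
  constructor
  · intro h
    have h4 := congrArg (fun T => (σ : ℤ) • T) h
    simp only [hσ] at h4
    have h5 := congrArg (fun T : Matrix (κ × p) (κ × p) R => T.map γ.ring) h4
    simp only [map_map_grading, Matrix.map_one _ (map_zero γ.ring) (map_one _)] at h5
    apply C.jMat_injective
    rw [C.jMat_zero]
    exact left_eq_add.1 h5.symm
  · intro h
    rw [h, C.jMat_zero, add_zero, Matrix.map_one _ (map_zero _) (map_one _)]

/-- The inverse of `mat`. -/
def invMat (σ : ℤˣ) (x : Matrix (κ × p) (κ × p) R) : Matrix κ κ 𝒜 :=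
  C.qMat (x * ((σ : ℤ) • (blockMat κ (P₀.map η.ring)).map γ.ring) - 1)

theorem continuous_invMat : Continuous (C.invMat (κ := κ) σ) :=
  C.continuous_qMat.comp ((continuous_id.mul continuous_const).sub continuous_const)

theorem invMat_mat (h₀ : P₀ ∈ skewMat δ σ p) (a : Matrix κ κ 𝒜) : C.invMat σ (C.mat a) = a := by
  have hD := mul_map_of_mem_skewMat (blockMat_mem_skewMat κ (map_mem_skewMat η h₀))
  rw [invMat, mat, mul_assoc, mul_smul_comm, hD, smul_smul, ← Units.val_mul, Int.units_mul_self,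
    Units.val_one, one_smul, mul_one, add_sub_cancel_left, qMat_jMat]

/-- The inverse of P₀ is σγ(P₀). If x reduces to a multiple of P₀, then x P₀⁻¹ - 1 reduces to 0 and
so comes from a matrix over `𝒜`. -/
theorem mat_invMat (h₀ : P₀ ∈ skewMat δ σ p) (hεη : ∀ x, ε.hom (η.hom x) = x)
    {x : Matrix (κ × p) (κ × p) R} (hx : x.map ε.ring = blockMat κ P₀) :
    C.mat (C.invMat σ x) = x := by
  have hD : (blockMat κ (P₀.map η.ring)).map γ.ring * blockMat κ (P₀.map η.ring) = _ :=
    blockMat_mem_skewMat κ (map_mem_skewMat η h₀)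
  have hD' := mul_map_of_mem_skewMat (blockMat_mem_skewMat κ h₀)
  have hσ : ∀ T : Matrix (κ × p) (κ × p) R, (σ : ℤ) • (σ : ℤ) • T = T := fun T => by
    rw [smul_smul, ← Units.val_mul, Int.units_mul_self, Units.val_one, one_smul]
  rw [mat, invMat, jMat_qMat, add_sub_cancel, mul_assoc, smul_mul_assoc, hD, hσ, mul_one]
  have h1 := Matrix.map_sub ε.ring (map_sub _)
    (x * ((σ : ℤ) • (blockMat κ (P₀.map η.ring)).map γ.ring)) 1
  have h2 : ((σ : ℤ) • (blockMat κ (P₀.map η.ring)).map γ.ring).map ε.ring =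
      (σ : ℤ) • ((blockMat κ (P₀.map η.ring)).map γ.ring).map ε.ring := by
    ext i j; exact map_zsmul ε.ring _ _
  rw [h1, Matrix.map_mul, h2, map_ring_comm, blockMat_map, map_map_of_split ε η hεη, hx,
    mul_smul_comm, hD', smul_smul, ← Units.val_mul, Int.units_mul_self, Units.val_one, one_smul,
    Matrix.map_one _ (map_zero _) (map_one _), sub_self]

/-- The kernel of `K(R) → K(F)` is presented by the unitary matrices over `𝒜`. -/
def presentation (h₀ : P₀ ∈ skewMat δ σ p) (hcR : Cofinal.{u, u} γ σ (map_mem_skewMat η h₀))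
    (hcF : Cofinal.{0, u} δ σ h₀) (hεη : ∀ x, ε.hom (η.hom x) = x) :
    Presentation α (KUnital.map.{u, u, 0} ε σ).ker :=
  have hD : ∀ (κ : Type) [Fintype κ] [DecidableEq κ],
      blockMat κ (P₀.map η.ring) ∈ skewMat γ σ (κ × p) := fun κ _ _ =>
    blockMat_mem_skewMat κ (map_mem_skewMat η h₀)
  have hm : ∀ {κ : Type} [Fintype κ] [DecidableEq κ] {a : Matrix κ κ 𝒜}, a ∈ unitaries α κ →
      C.mat a ∈ skewMat γ σ (κ × p) := fun {_ _ _ _} ha => (C.mat_mem_skewMat_iff h₀ _).2 ha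
  have hblk : ∀ {κ l : Type} [Fintype κ] [DecidableEq κ] [Fintype l] [DecidableEq l]
      (a : Matrix κ κ 𝒜) (ha : a ∈ unitaries α κ) (b : Matrix l l 𝒜) (hb : b ∈ unitaries α l),
      matCls (hm (fromBlocks_mem_unitaries ha hb)) (hD (κ ⊕ l)) =
        matCls (hm ha) (hD κ) + matCls (hm hb) (hD l) := by
    intro κ l _ _ _ _ a ha b hb
    rw [← matCls_fromBlocks, ← matCls_submatrix _ _ (Equiv.sumProdDistrib κ l p)]
    congr 1
    · exact C.mat_fromBlocks a b
    · exact fromBlocks_blockMat _ _ _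
  { cl := fun {κ} _ _ a ha => ⟨matCls (hm ha) (hD κ), matCls_mem_ker ε _ _ (by
      rw [C.map_mat hεη, blockMat_map, map_map_of_split ε η hεη])⟩
    surj := fun ⟨x, hx⟩ => by
      obtain ⟨n, m, P, hP, hPε, h⟩ := exists_matCls_eq_of_mem_ker h₀ ε η hcR hcF hεη hx
      have e := C.mat_invMat h₀ hεη hPε
      refine ⟨Fin n ⊕ Fin m, inferInstance, inferInstance, C.invMat σ P,
        (C.mat_mem_skewMat_iff h₀ _).1 (by rwa [e]), Subtype.ext ?_⟩
      exact (matCls_congr _ hP _ _ e rfl).trans h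
    add := fun a ha b hb => Subtype.ext (hblk a ha b hb)
    zero_iff := fun {κ} _ _ a ha => by
      rw [Subtype.ext_iff]
      constructor
      · intro h
        obtain ⟨n, s, hs⟩ := exists_joinedIn_of_matCls_eq_zero h₀ ε η hcR hεη (hm ha)
          (C.map_mat hεη a) h
        refine ⟨n, ⟨⟨fun t => C.invMat σ (s t), C.continuous_invMat.comp s.continuous⟩, ?_, ?_⟩,
          fun t => ?_⟩
        · change C.invMat σ (s 0) = _
          rw [s.source, ← C.mat_zero, ← C.mat_fromBlocks, C.invMat_mat h₀]
        · change C.invMat σ (s 1) = _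
          rw [s.target, ← C.mat_zero, C.invMat_mat h₀]
        · refine (C.mat_mem_skewMat_iff h₀ _).1 ?_
          change C.mat (C.invMat σ (s t)) ∈ _
          rw [C.mat_invMat h₀ hεη (hs t).2]
          exact (hs t).1
      · rintro ⟨n, s, hs⟩
        have h0 : matCls (hm (fromBlocks_mem_unitaries ha (zero_mem_unitaries (Fin n))))
            (hD (κ ⊕ Fin n)) = 0 := by
          refine matCls_eq_zero ⟨⟨⟨fun t => C.mat (s t), C.continuous_mat.comp s.continuous⟩,
            congrArg C.mat s.source, (congrArg C.mat s.target).trans C.mat_zero⟩,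
            fun t => hm (hs t)⟩
        -- The zero block stands for P₀ against itself, so stabilising by it does not change the
        -- class.
        have h1 : matCls (hm (zero_mem_unitaries (α := α) (Fin n))) (hD (Fin n)) = 0 :=
          matCls_eq_zero (by rw [C.mat_zero]; exact JoinedIn.refl (hD _))
        rwa [hblk a ha 0 (zero_mem_unitaries _), h1, add_zero] at h0 }

end Chart

end Chart

end GradedK

end

noncomputable section

namespace GradedK

@[simp] theorem Cl.fst_neg {R : Type u} [Ring R] [Algebra ℝ R] [TopologicalSpace R]
    {γ : Grading R} (x : Cl γ) : (-x).fst = -x.fst := rfl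

@[simp] theorem Cl.snd_neg {R : Type u} [Ring R] [Algebra ℝ R] [TopologicalSpace R]
    {γ : Grading R} (x : Cl γ) : (-x).snd = -x.snd := rfl

/-! ### Two cofinal operators: the hyperbolic matrix, and 1 in the presence of an odd unit. -/

section CofinalExamples

variable {R : Type u} [Ring R] [Algebra ℝ R] [TopologicalSpace R] {γ : Grading R} {σ : ℤˣ}
  {p : Type} [Fintype p] [DecidableEq p]

theorem matSq_blockMat_apply {κ : Type} [Fintype κ] [DecidableEq κ] {P₀ : Matrix p p R}
    (h : blockMat κ P₀ ∈ skewMat γ σ (κ × p)) (x : κ × p → R) (k : κ) (j : p) :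
    (matSq _ h).op x (k, j) = ∑ i, γ.hom (x (k, i)) * P₀ i j := by
  rw [matSq_apply]
  change ∑ y : κ × p, γ.hom (x y) * blockMat κ P₀ y (k, j) = _
  rw [Fintype.sum_prod_type, Finset.sum_eq_single k]
  · simp [blockMat]
  · intro l _ hl
    simp [blockMat, hl]
  · simp

/-- The matrix of the hyperbolic operator. -/
def hypMat (R : Type u) [Ring R] (σ : ℤˣ) : Matrix (Fin 2) (Fin 2) R := !![0, 1; ((σ : ℤ) : R), 0]

theorem map_hypMat {S : Type*} [Ring S] (f : R →+* S) : (hypMat R σ).map f = hypMat S σ := by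
  ext i j
  fin_cases i <;> fin_cases j <;> simp [hypMat]

theorem hypMat_mem_skewMat : hypMat R σ ∈ skewMat γ σ (Fin 2) := by
  change (hypMat R σ).map γ.ring * _ = _
  rw [map_hypMat]
  ext i j
  fin_cases i <;> fin_cases j <;> simp [hypMat, Matrix.mul_apply, Fin.sum_univ_two]

/-- A multiple of this matrix is the hyperbolic operator with its coordinates regrouped, and every
operator is a summand of a hyperbolic one. -/
theorem cofinal_hypMat {P₀ : Matrix (Fin 2) (Fin 2) R} (h₀ : P₀ ∈ skewMat γ σ (Fin 2))
    (h : P₀ = hypMat R σ) : Cofinal.{u, v} γ σ h₀ := by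
  subst h
  intro M _ _ _ _ J
  obtain ⟨n, hn⟩ := J.isRetract_hyperbolic
  refine ⟨n, hn.trans (SkewSq.IsRetract.of_equiv
    { toFun := fun x ki => ![x.1 ki.1, x.2 ki.1] ki.2
      invFun := fun y => (fun k => y (k, 0), fun k => y (k, 1))
      map_add' := fun x y => by ext ⟨k, i⟩; fin_cases i <;> simp
      map_smul' := fun a x => by ext ⟨k, i⟩; fin_cases i <;> simp
      left_inv := fun x => by simp
      right_inv := fun y => by ext ⟨k, i⟩; fin_cases i <;> simp } fun x => ?_)⟩
  ext ⟨k, i⟩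
  rw [matSq_blockMat_apply]
  fin_cases i <;> simp [hypMat, hyperbolic, Fin.sum_univ_two, Int.cast_comm]

/-- In the presence of an odd unit the grading of the algebra itself is cofinal. -/
theorem cofinal_one {e : R} (he : e * e = 1) (hγe : γ.hom e = -e) {P₀ : Matrix Unit Unit R}
    (h₀ : P₀ ∈ skewMat γ 1 Unit) (h : P₀ = 1) : Cofinal.{u, v} γ 1 h₀ := by
  subst h
  intro M _ _ _ _ J
  obtain ⟨n, hn⟩ := J.isRetract_hyperbolic
  let half : R := algebraMap ℝ R 2⁻¹
  have hh : half + half = 1 := by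
    rw [← map_add, ← map_one (algebraMap ℝ R)]; norm_num
  have hcomm : ∀ x, x * half = half * x := fun x => (Algebra.commutes _ _).symm
  have hγ : γ.hom half = half := γ.ring_algebraMap _
  have he' : ∀ x : R, x * e * e = x := fun x => by rw [mul_assoc, he, mul_one]
  -- The hyperbolic operator is γ followed by the exchange of coordinates. It becomes γ alone on x₁
  -- + x₂ and -γ on x₁ - x₂; right multiplication by the odd unit `e` absorbs the latter sign.
  let i : ((Fin n → R) × (Fin n → R)) →ₗ[R] (Fin (n + n) × Unit → R) :=
    { toFun := fun x k => Sum.elim (x.1 + x.2) (fun l => (x.1 l - x.2 l) * e)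
        (finSumFinEquiv.symm k.1)
      map_add' := fun x y => by
        ext ⟨k, u⟩
        obtain ⟨k, rfl⟩ := finSumFinEquiv.surjective k
        rcases k with k | k <;> simp only [Equiv.symm_apply_apply, Sum.elim_inl, Sum.elim_inr,
          Pi.add_apply, Prod.fst_add, Prod.snd_add, sub_mul, add_mul] <;> abel
      map_smul' := fun a x => by
        ext ⟨k, u⟩
        obtain ⟨k, rfl⟩ := finSumFinEquiv.surjective k
        rcases k with k | k <;> simp only [Equiv.symm_apply_apply, Sum.elim_inl, Sum.elim_inr,
          Pi.add_apply, Pi.smul_apply, Prod.smul_fst, Prod.smul_snd, smul_eq_mul,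
          RingHom.id_apply] <;> noncomm_ring }
  let r : (Fin (n + n) × Unit → R) →ₗ[R] ((Fin n → R) × (Fin n → R)) :=
    { toFun := fun y =>
        (fun k => (y (finSumFinEquiv (.inl k), ()) + y (finSumFinEquiv (.inr k), ()) * e) * half,
         fun k => (y (finSumFinEquiv (.inl k), ()) - y (finSumFinEquiv (.inr k), ()) * e) * half)
      map_add' := fun x y => by ext <;> simp only [Pi.add_apply, Prod.mk_add_mk] <;> noncomm_ring
      map_smul' := fun a x => by
        ext <;> simp only [Pi.smul_apply, smul_eq_mul, RingHom.id_apply, Prod.smul_mk] <;>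
          noncomm_ring }
  have hi : ∀ x k, i x (finSumFinEquiv (.inl k), ()) = x.1 k + x.2 k := fun x k => by
    simp [i]
  have hi' : ∀ x k, i x (finSumFinEquiv (.inr k), ()) = (x.1 k - x.2 k) * e := fun x k => by
    simp only [i, LinearMap.coe_mk, AddHom.coe_mk, Equiv.symm_apply_apply, Sum.elim_inr]
  have hr : ∀ y k, (r y).1 k = (y (finSumFinEquiv (.inl k), ()) +
    y (finSumFinEquiv (.inr k), ()) * e) * half := fun _ _ => rfl
  have hr' : ∀ y k, (r y).2 k = (y (finSumFinEquiv (.inl k), ()) -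
    y (finSumFinEquiv (.inr k), ()) * e) * half := fun _ _ => rfl
  have hH : ∀ x k, ((hyperbolic γ 1 n).op x).1 k = γ.hom (x.2 k) := fun x k => by
    simp [hyperbolic]
  have hH' : ∀ x k, ((hyperbolic γ 1 n).op x).2 k = γ.hom (x.1 k) := fun x k => rfl
  have hone : ∀ x (k : Fin (n + n)) (u : Unit),
      (matSq _ (blockMat_mem_skewMat (Fin (n + n)) h₀)).op x (k, u) = γ.hom (x (k, u)) :=
    fun x k u => by
      rw [matSq_blockMat_apply]
      simp
  refine ⟨n + n, hn.trans ⟨i, r, fun x => ?_, fun x => ?_, fun y => ?_⟩⟩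
  · ext k
    · rw [hr, hi, hi', he', hcomm]
      calc half * (x.1 k + x.2 k + (x.1 k - x.2 k)) = (half + half) * x.1 k := by noncomm_ring
        _ = x.1 k := by rw [hh, one_mul]
    · rw [hr', hi, hi', he', hcomm]
      calc half * (x.1 k + x.2 k - (x.1 k - x.2 k)) = (half + half) * x.2 k := by noncomm_ring
        _ = x.2 k := by rw [hh, one_mul]
  · ext ⟨k, u⟩
    obtain ⟨k, rfl⟩ := finSumFinEquiv.surjective k
    rw [hone]
    rcases k with k | k
    · rw [hi, hi, hH, hH', map_add, add_comm]
    · rw [hi', hi', hH, hH', map_mul, map_sub, hγe]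
      noncomm_ring
  · ext k
    · rw [hr, hone, hone, hH, hr', map_mul, map_sub, map_mul, hγ, hγe]
      noncomm_ring
    · rw [hr', hone, hone, hH', hr, map_mul, map_add, map_mul, hγ, hγe]
      noncomm_ring

/-- The Clifford generator serves as the odd unit. -/
theorem cofinal_cl [IsTopologicalRing R] {P₀ : Matrix Unit Unit (Cl γ)}
    (h₀ : P₀ ∈ skewMat γ.cl 1 Unit) (h : P₀ = 1) : Cofinal.{u, v} γ.cl 1 h₀ :=
  cofinal_one (e := ⟨0, 1⟩) (by ext <;> simp)
    (Cl.ext (by rw [Cl.fst_neg]; simp [Grading.cl]) (by rw [Cl.snd_neg]; simp [Grading.cl])) h₀ h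

theorem one_mem_skewMat : (1 : Matrix Unit Unit R) ∈ skewMat γ 1 Unit := by
  change (1 : Matrix Unit Unit R).map γ.ring * 1 = _
  rw [Matrix.map_one _ (map_zero _) (map_one _)]
  simp

end CofinalExamples

end GradedK

end

noncomputable section

namespace GradedK

/-! ### Presentation of K₀ and SPT by matrices over the algebra. -/

section PlusChart

variable {A : Type u} [NonUnitalRing A] [Module ℝ A] [IsScalarTower ℝ A A] [SMulCommClass ℝ A A]
  [TopologicalSpace A] [IsTopologicalRing A] [ContinuousSMul ℝ A]

/-- The inclusion `A → A₊`. -/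
def Plus.inr (A : Type u) [NonUnitalRing A] [Module ℝ A] [IsScalarTower ℝ A A]
    [SMulCommClass ℝ A A] [TopologicalSpace A] [IsTopologicalRing A] [ContinuousSMul ℝ A] :
    A →ₙ+* Plus A where
  toFun a := Plus.mk 0 a
  map_zero' := rfl
  map_add' x y := Plus.ext (add_zero (0 : ℝ)).symm rfl
  map_mul' x y := Plus.ext (mul_zero (0 : ℝ)).symm (by
    change x * y = (0 : ℝ) • y + (0 : ℝ) • x + x * y
    simp)

theorem Plus.continuous_inr : Continuous (Plus.inr A) :=
  Plus.continuous_rng continuous_const continuous_id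

/-- The inclusion of the scalars into the unitization. -/
def NGrading.unitHom (γ : NGrading A) : GradedHom Grading.real γ.plus where
  hom := Algebra.ofId ℝ (Plus A)
  cont := Plus.continuous_rng continuous_id continuous_const
  comm r := (γ.plus.hom.commutes r).symm

theorem NGrading.augmentation_unitHom (γ : NGrading A) (r : ℝ) :
    γ.augmentation.hom (γ.unitHom.hom r) = r := rfl

/-- The automorphism `x ↦ γ(P₀⁻¹ x P₀)` of `M₂(A)` for the hyperbolic matrix `P₀`. -/
def flip (γ : NGrading A) (σ : ℤˣ) : Matrix (Fin 2) (Fin 2) A →+ Matrix (Fin 2) (Fin 2) A where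
  toFun m := !![γ.hom (m 1 1), (σ : ℤ) • γ.hom (m 1 0); (σ : ℤ) • γ.hom (m 0 1), γ.hom (m 0 0)]
  map_zero' := by ext i j; fin_cases i <;> fin_cases j <;> simp
  map_add' m n := by ext i j; fin_cases i <;> fin_cases j <;> simp [-zsmul_eq_mul]

theorem flip_apply (γ : NGrading A) (σ : ℤˣ) (m : Matrix (Fin 2) (Fin 2) A) : flip γ σ m =
    !![γ.hom (m 1 1), (σ : ℤ) • γ.hom (m 1 0); (σ : ℤ) • γ.hom (m 0 1), γ.hom (m 0 0)] := rfl

theorem units_smul_smul {B : Type*} [AddCommGroup B] (σ : ℤˣ) (b : B) :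
    (σ : ℤ) • (σ : ℤ) • b = b := by
  rw [smul_smul, ← Units.val_mul, Int.units_mul_self, Units.val_one, one_smul]

theorem flip_flip (γ : NGrading A) (σ : ℤˣ) (m : Matrix (Fin 2) (Fin 2) A) :
    flip γ σ (flip γ σ m) = m := by
  ext i j
  fin_cases i <;> fin_cases j <;> simp [flip_apply, γ.invol, units_smul_smul]

/-- The signs σ sit on the off-diagonal entries only, and these enter the diagonal of a product in
pairs. -/
theorem flip_mul (γ : NGrading A) (σ : ℤˣ) (m n : Matrix (Fin 2) (Fin 2) A) :
    flip γ σ (m * n) = flip γ σ m * flip γ σ n := by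
  ext i j
  fin_cases i <;> fin_cases j <;>
    simp [flip_apply, Matrix.mul_apply, Fin.sum_univ_two, smul_mul_assoc, mul_smul_comm,
      units_smul_smul, add_comm]

/-- The inclusion of the matrices over `A` into the matrices over `A₊`. -/
def plusMat (A : Type u) [NonUnitalRing A] [Module ℝ A] [IsScalarTower ℝ A A]
    [SMulCommClass ℝ A A] [TopologicalSpace A] [IsTopologicalRing A] [ContinuousSMul ℝ A] :
    Matrix (Fin 2) (Fin 2) A →ₙ+* Matrix (Fin 2) (Fin 2) (Plus A) where
  toFun m := m.map (Plus.inr A)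
  map_zero' := by ext1 i j; exact map_zero (Plus.inr A)
  map_add' m n := by ext1 i j; exact map_add (Plus.inr A) _ _
  map_mul' m n := by
    ext1 i j; simp only [Matrix.map_apply, Matrix.mul_apply, map_sum, map_mul]

theorem plusMat_apply (m : Matrix (Fin 2) (Fin 2) A) (i j : Fin 2) :
    plusMat A m i j = Plus.inr A (m i j) := rfl

theorem NGrading.plus_inr (γ : NGrading A) (a : A) :
    γ.plus.hom (Plus.inr A a) = Plus.inr A (γ.hom a) := rfl

/-- The matrices over `A` inside the matrices over `A₊`. -/
def plusChart (γ : NGrading A) (σ : ℤˣ) :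
    Chart γ.augmentation γ.unitHom (hypMat ℝ σ) (flip γ σ) where
  j := plusMat A
  continuous_j := continuous_id.matrix_map Plus.continuous_inr
  q m := m.map Plus.snd
  continuous_q := continuous_id.matrix_map Plus.continuous_snd
  q_j _ := rfl
  j_q x hx := by
    ext1 i j
    exact Plus.ext (congrFun₂ hx i j).symm rfl
  map_j _ := rfl
  j_α m := by
    rw [map_hypMat]
    ext1 i j
    fin_cases i <;> fin_cases j <;>
      simp [hypMat, flip_apply, Matrix.mul_apply, Fin.sum_univ_two, γ.plus_inr, plusMat_apply,
        γ.invol, -zsmul_eq_mul, map_zsmul (Plus.inr A)]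
    · rw [zsmul_eq_mul, Int.cast_comm]
    · rw [Int.cast_comm]
    · rw [← zsmul_eq_mul, units_smul_smul]

/-- `K₀` and `SPT` are presented by matrices over `A`. -/
def plusPresentation (γ : NGrading A) (σ : ℤˣ) : Presentation (flip γ σ) (γ.KGroup σ) :=
  (plusChart γ σ).presentation hypMat_mem_skewMat (cofinal_hypMat _ (map_hypMat _))
    (cofinal_hypMat _ rfl) γ.augmentation_unitHom

/-- The anti-isomorphism between matrices over `A` and over the opposite algebra. -/
def transposeOp (A : Type u) [NonUnitalRing A] :
    Matrix (Fin 2) (Fin 2) A ≃+ Matrix (Fin 2) (Fin 2) Aᵐᵒᵖ where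
  toFun m := m.transpose.map MulOpposite.op
  invFun m := m.transpose.map MulOpposite.unop
  left_inv _ := rfl
  right_inv _ := rfl
  map_add' _ _ := rfl

theorem transposeOp_apply (m : Matrix (Fin 2) (Fin 2) A) (i j : Fin 2) :
    transposeOp A m i j = MulOpposite.op (m j i) := rfl

theorem transposeOp_mul (m n : Matrix (Fin 2) (Fin 2) A) :
    transposeOp A (m * n) = transposeOp A n * transposeOp A m := by
  ext1 i j
  simp [transposeOp_apply, Matrix.mul_apply, Fin.sum_univ_two]

/-- The pattern of `flip` is symmetric under transposition. This is why the groups do not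
distinguish an algebra from its ungraded opposite. -/
theorem transposeOp_flip (γ : NGrading A) (σ : ℤˣ) (m : Matrix (Fin 2) (Fin 2) A) :
    transposeOp A (flip γ σ m) = flip γ.mop σ (transposeOp A m) := by
  ext1 i j
  fin_cases i <;> fin_cases j <;> simp [transposeOp_apply, flip_apply, NGrading.mop]

theorem continuous_transposeOp : Continuous (transposeOp A) :=
  continuous_matrix fun i j => MulOpposite.continuous_op.comp (continuous_id.matrix_elem j i)

theorem continuous_transposeOp_symm : Continuous (transposeOp A).symm :=
  continuous_matrix fun i j => MulOpposite.continuous_unop.comp (continuous_id.matrix_elem j i)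

/-- Presentations over the opposite algebra are presentations over the algebra. -/
def Presentation.ofMop {γ : NGrading A} {σ : ℤˣ} {K : Type*} [AddCommGroup K]
    (p : Presentation (flip γ.mop σ) K) : Presentation (flip γ σ) K :=
  p.ofAntiEquiv (transposeOp A) continuous_transposeOp continuous_transposeOp_symm transposeOp_mul
    (transposeOp_flip γ σ) (flip_flip _ _) (flip_mul _ _)

/-- Presentations over the algebra are presentations over the opposite algebra. -/
def Presentation.toMop {γ : NGrading A} {σ : ℤˣ} {K : Type*} [AddCommGroup K]
    (p : Presentation (flip γ σ) K) : Presentation (flip γ.mop σ) K :=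
  p.ofAntiEquiv (transposeOp A).symm continuous_transposeOp_symm continuous_transposeOp
    (fun x y => (transposeOp A).injective (by simp [transposeOp_mul]))
    (fun x => (transposeOp A).injective (by simp [transposeOp_flip])) (flip_flip _ _) (flip_mul _ _)

end PlusChart

/-! ### Unit charge: comparing gradings by c with polarizations for θ. -/

section UnitCharge

variable {A : Type u} [NonUnitalRing A] [Module ℝ A] [IsScalarTower ℝ A A] [SMulCommClass ℝ A A]
  [TopologicalSpace A] [IsTopologicalRing A] [ContinuousSMul ℝ A]

/-- A multiplier `i` of `A` with `i² = -1` such that conjugation by `i` is the product of the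
gradings `c` and `θ`, both of which fix `i`. -/
structure UnitCharge (c θ : NGrading A) where
  /-- left multiplication by `i` -/
  left : A →ₗ[ℝ] A
  /-- right multiplication by `i` -/
  right : A →ₗ[ℝ] A
  continuous_left : Continuous left
  continuous_right : Continuous right
  left_mul : ∀ a b, left (a * b) = left a * b
  right_mul : ∀ a b, right (a * b) = a * right b
  mul_left : ∀ a b, a * left b = right a * b
  left_left : ∀ a, left (left a) = -a
  right_right : ∀ a, right (right a) = -a
  left_eq : ∀ a, left a = right (c.hom (θ.hom a))
  c_left : ∀ a, c.hom (left a) = left (c.hom a)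
  c_right : ∀ a, c.hom (right a) = right (c.hom a)
  θ_left : ∀ a, θ.hom (left a) = left (θ.hom a)
  θ_right : ∀ a, θ.hom (right a) = right (θ.hom a)
  comm : ∀ a, c.hom (θ.hom a) = θ.hom (c.hom a)

variable {c θ : NGrading A}

namespace UnitCharge

variable (I : UnitCharge c θ)

/-- The anti-isomorphism of `M₂(A)` with `M₂(Aᵒᵖ)` which intertwines the automorphisms for
`(θ, -1)` and `(c, 1)`. -/
def antiEquiv : Matrix (Fin 2) (Fin 2) A ≃+ Matrix (Fin 2) (Fin 2) Aᵐᵒᵖ where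
  -- This is transposition after conjugation by diag(1, i): the entry -x i is x i⁻¹, and cθ is
  -- conjugation by i.
  toFun m := !![.op (m 0 0), .op (I.left (m 1 0)); .op (-I.right (m 0 1)),
    .op (c.hom (θ.hom (m 1 1)))]
  invFun m := !![(m 0 0).unop, I.right (m 1 0).unop; -I.left (m 0 1).unop,
    c.hom (θ.hom (m 1 1).unop)]
  left_inv m := by
    ext i j
    fin_cases i <;> fin_cases j <;> simp [I.left_left, I.right_right, I.comm]
    simp only [c.invol, θ.invol]
  right_inv m := by
    ext i j
    fin_cases i <;> fin_cases j <;> simp [I.left_left, I.right_right, I.comm]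
    simp only [c.invol, θ.invol, MulOpposite.op_unop]
  map_add' m n := by
    ext i j
    fin_cases i <;> fin_cases j <;> simp [add_comm]

theorem antiEquiv_apply (m : Matrix (Fin 2) (Fin 2) A) : I.antiEquiv m =
    !![.op (m 0 0), .op (I.left (m 1 0)); .op (-I.right (m 0 1)),
      .op (c.hom (θ.hom (m 1 1)))] := rfl

theorem right_mul_left (a b : A) : I.right a * I.left b = -(a * b) := by
  rw [I.mul_left, I.right_right, neg_mul]

theorem left_mul_right (a b : A) : I.left a * I.right b = -c.hom (θ.hom (a * b)) := by
  rw [← I.left_mul, ← I.right_mul, I.left_eq, ← neg_eq_iff_eq_neg]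
  simp only [I.c_right, I.θ_right, I.right_right, neg_neg]

/-- In the diagonal entries the factors i and i⁻¹ of the off-diagonal products cancel, up to cθ. In
the others, `h1` and `h2` move i past a factor at the price of cθ. -/
theorem antiEquiv_mul (m n : Matrix (Fin 2) (Fin 2) A) :
    I.antiEquiv (m * n) = I.antiEquiv n * I.antiEquiv m := by
  have h1 : ∀ a b, I.left (a * b) = c.hom (θ.hom a) * I.left b := fun a b => by
    rw [I.left_mul, I.left_eq, I.mul_left]
  have h2 : ∀ a b, I.right (a * b) = I.right a * c.hom (θ.hom b) := fun a b => by
    rw [← I.mul_left, I.left_eq, I.comm, c.invol, θ.invol, I.right_mul]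
  ext i j
  apply MulOpposite.unop_injective
  fin_cases i <;> fin_cases j <;>
    simp [antiEquiv_apply, Matrix.mul_apply, Fin.sum_univ_two]
  · simp [right_mul_left]
  · simp only [← h1, ← I.left_mul]
  · simp only [← h2, ← I.right_mul, add_comm]
  · simp [left_mul_right]

/-- Conjugation by diag(1, i) turns the hyperbolic matrix for -1 into -i times the one for 1.
Conjugation by the factor i is cθ, and composing it with θ leaves c. This is where square -1 is
traded for square 1. -/
theorem antiEquiv_flip (m : Matrix (Fin 2) (Fin 2) A) :
    I.antiEquiv (flip θ (-1) m) = flip c.mop 1 (I.antiEquiv m) := by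
  ext i j
  apply MulOpposite.unop_injective
  fin_cases i <;> fin_cases j <;> simp [antiEquiv_apply, flip_apply, NGrading.mop]
  · rw [c.invol]
  · rw [I.left_eq, θ.invol, I.c_right]
  · rw [I.c_left, I.left_eq, I.comm, c.invol]
  · rw [θ.invol]

theorem continuous_antiEquiv : Continuous I.antiEquiv := by
  have h := c.cont.comp θ.cont
  have hl := I.continuous_left
  have hr := I.continuous_right
  refine continuous_matrix fun i j => ?_
  fin_cases i <;> fin_cases j
  · exact MulOpposite.continuous_op.comp (continuous_id.matrix_elem 0 0)
  · exact MulOpposite.continuous_op.comp (hl.comp (continuous_id.matrix_elem 1 0))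
  · exact MulOpposite.continuous_op.comp (hr.comp (continuous_id.matrix_elem 0 1)).neg
  · exact MulOpposite.continuous_op.comp (h.comp (continuous_id.matrix_elem 1 1))

theorem continuous_antiEquiv_symm : Continuous I.antiEquiv.symm := by
  have h := c.cont.comp θ.cont
  have hl := I.continuous_left
  have hr := I.continuous_right
  have hu : ∀ i j, Continuous fun m : Matrix (Fin 2) (Fin 2) Aᵐᵒᵖ => (m i j).unop := fun i j =>
    MulOpposite.continuous_unop.comp (continuous_id.matrix_elem i j)
  refine continuous_matrix fun i j => ?_
  fin_cases i <;> fin_cases j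
  · exact hu 0 0
  · exact hr.comp (hu 1 0)
  · exact (hl.comp (hu 0 1)).neg
  · exact h.comp (hu 1 1)

/-- A presentation for `(c, 1)` over the opposite algebra gives one for `(θ, -1)`. -/
def presentation {K : Type*} [AddCommGroup K] (p : Presentation (flip c.mop 1) K) :
    Presentation (flip θ (-1)) K :=
  p.ofAntiEquiv I.antiEquiv I.continuous_antiEquiv I.continuous_antiEquiv_symm I.antiEquiv_mul
    I.antiEquiv_flip (flip_flip _ _) (flip_mul _ _)

/-- `K₀ᶜ(Aᵒᵖ) ≅ SPT^(A, θ)`. -/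
theorem nonempty_mop_K₀_equiv_SPT {c θ : NGrading A} (I : UnitCharge c θ) : Nonempty (c.mop.K₀ ≃+ θ.SPT) :=
  (I.presentation (plusPresentation c.mop 1)).nonempty_addEquiv (plusPresentation θ (-1))

/-- `K₀ᶜ(A) ≅ SPT^(A, θ)`. -/
theorem nonempty_K₀_equiv_SPT {c θ : NGrading A} (I : UnitCharge c θ) : Nonempty (c.K₀ ≃+ θ.SPT) :=
  (I.presentation (plusPresentation c 1).toMop).nonempty_addEquiv (plusPresentation θ (-1))

end UnitCharge

end UnitCharge

end GradedK

end

noncomputable section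

namespace GradedK

/-! ### Two Clifford generators over a graded algebra, in coordinates. -/

section ClInstances

variable {R : Type u} [Ring R] [Algebra ℝ R] [TopologicalSpace R] {γ : Grading R}

instance [T2Space R] : T2Space (Cl γ) :=
  T2Space.of_injective_continuous (f := Cl.equiv γ) (Cl.equiv γ).injective continuous_induced_dom

instance [Module.Finite ℝ R] : Module.Finite ℝ (Cl γ) :=
  Module.Finite.equiv (Equiv.linearEquiv ℝ (Cl.equiv γ)).symm

/-- With generators e (inner) and f (outer), the four coordinates stand for a + b e + c f + d ef.
The negative signs come from fe = -ef. -/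
theorem Cl.mk_mul_mk [IsTopologicalRing R] (a b c d a' b' c' d' : R) :
    (⟨⟨a, b⟩, ⟨c, d⟩⟩ * ⟨⟨a', b'⟩, ⟨c', d'⟩⟩ : Cl γ.cl) =
      ⟨⟨a * a' + b * γ.hom b' + (c * γ.hom c' - d * d'),
        a * b' + b * γ.hom a' + (d * c' - c * γ.hom d')⟩,
        ⟨a * c' + b * γ.hom d' + (c * γ.hom a' - d * b'),
        a * d' + b * γ.hom c' + (d * a' - c * γ.hom b')⟩⟩ := by
  apply Cl.ext <;> apply Cl.ext
  · change a * a' + b * γ.hom b' + (c * γ.hom c' + d * γ.hom (-γ.hom d')) = _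
    rw [map_neg, γ.invol, mul_neg, ← sub_eq_add_neg]
  · change a * b' + b * γ.hom a' + (c * -γ.hom d' + d * γ.hom (γ.hom c')) = _
    rw [γ.invol, mul_neg, neg_add_eq_sub]
  · change a * c' + b * γ.hom d' + (c * γ.hom a' + d * γ.hom (-γ.hom b')) = _
    rw [map_neg, γ.invol, mul_neg, ← sub_eq_add_neg]
  · change a * d' + b * γ.hom c' + (c * -γ.hom b' + d * γ.hom (γ.hom a')) = _
    rw [γ.invol, mul_neg, neg_add_eq_sub]

theorem Grading.cl_cl_hom [IsTopologicalRing R] (a b c d : R) :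
    γ.cl.cl.hom ⟨⟨a, b⟩, ⟨c, d⟩⟩ =
      ⟨⟨γ.hom a, -γ.hom b⟩, ⟨-γ.hom c, γ.hom d⟩⟩ := by
  apply Cl.ext
  · rfl
  · apply Cl.ext
    · rfl
    · change - -γ.hom d = _
      rw [neg_neg]

end ClInstances

/-! ### K₂ of the graded opposite by matrices over the ungraded opposite. -/

section CliffordChart

variable {A : Type u} [NonUnitalRing A] [Module ℝ A] [IsScalarTower ℝ A A] [SMulCommClass ℝ A A]
  [TopologicalSpace A] [IsTopologicalRing A] [ContinuousSMul ℝ A]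

namespace GrOp

variable (γ : NGrading A) (a b : A)

theorem even_add : even γ (a + b) = even γ a + even γ b := by
  simp only [even, map_add]; module

theorem odd_add : odd γ (a + b) = odd γ a + odd γ b := by
  simp only [odd, map_add]; module

theorem even_sub : even γ (a - b) = even γ a - even γ b := by
  simp only [even, map_sub]; module

theorem odd_sub : odd γ (a - b) = odd γ a - odd γ b := by
  simp only [odd, map_sub]; module

theorem even_even : even γ (even γ a) = even γ a := by
  simp only [even, map_add, map_smul, γ.invol]; module

theorem even_odd : even γ (odd γ a) = 0 := by
  simp only [even, odd, map_sub, map_smul, γ.invol]; module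

theorem odd_even : odd γ (even γ a) = 0 := by
  simp only [even, odd, map_add, map_smul, γ.invol]; module

theorem odd_odd : odd γ (odd γ a) = odd γ a := by
  simp only [odd, map_sub, map_smul, γ.invol]; module

theorem hom_even : γ.hom (even γ a) = even γ a := by
  simp only [even, map_add, map_smul, γ.invol]; module

theorem hom_odd : γ.hom (odd γ a) = -odd γ a := by
  simp only [odd, map_sub, map_smul, γ.invol]; module

theorem even_hom : even γ (γ.hom a) = even γ a := by
  simp only [even, γ.invol]; module

theorem odd_hom : odd γ (γ.hom a) = -odd γ a := by
  simp only [odd, γ.invol]; module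

theorem even_neg : even γ (-a) = -even γ a := by
  simp only [even, map_neg]; module

theorem odd_neg : odd γ (-a) = -odd γ a := by
  simp only [odd, map_neg]; module

theorem even_mul : even γ (a * b) = even γ a * even γ b + odd γ a * odd γ b := by
  simp only [even, odd, map_mul, mul_add, add_mul, mul_sub, sub_mul, smul_mul_assoc, mul_smul_comm]
  module

theorem odd_mul : odd γ (a * b) = even γ a * odd γ b + odd γ a * even γ b := by
  simp only [even, odd, map_mul, mul_add, add_mul, mul_sub, sub_mul, smul_mul_assoc, mul_smul_comm]
  module

theorem even_add_odd : even γ a + odd γ a = a := by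
  simp only [even, odd]; module

theorem even_even_add_odd : even γ (even γ a + odd γ b) = even γ a := by
  rw [even_add, even_even, even_odd, add_zero]

theorem even_even_sub_odd : even γ (even γ a - odd γ b) = even γ a := by
  rw [even_sub, even_even, even_odd, sub_zero]

theorem odd_even_add_odd : odd γ (even γ a + odd γ b) = odd γ b := by
  rw [odd_add, odd_odd, odd_even, zero_add]

theorem odd_even_sub_odd : odd γ (even γ a - odd γ b) = -odd γ b := by
  rw [odd_sub, odd_odd, odd_even, zero_sub]

variable {γ}

theorem unop_neg (x : GrOp γ) : (-x).unop = -x.unop := rfl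

theorem unop_sub (x y : GrOp γ) : (x - y).unop = x.unop - y.unop := rfl

theorem continuous_op : Continuous (GrOp.op : A → GrOp γ) := continuous_induced_rng.2 continuous_id

variable (γ)

theorem continuous_even : Continuous (even γ) := by
  have := γ.cont
  unfold even
  fun_prop

theorem continuous_odd : Continuous (odd γ) := by
  have := γ.cont
  unfold odd
  fun_prop

end GrOp

open GrOp

variable (γ : NGrading A)

theorem NGrading.selfOp_hom (a : A) : γ.selfOp.hom ⟨a⟩ = ⟨γ.hom a⟩ := rfl

/-- The element of `Cl₊₂ ⊗ A^op` which corresponds to the matrix with coordinates `p`, `q`, `r`,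
`s` with respect to `1`, `diag(1, -1)`, the flip and the rotation by a quarter. -/
def cliffordElt (p q r s : A) : Cl γ.selfOp.plus.cl :=
  ⟨⟨Plus.inr _ ⟨even γ p - odd γ s⟩, Plus.inr _ ⟨even γ q + odd γ r⟩⟩,
    ⟨Plus.inr _ ⟨even γ r - odd γ q⟩, Plus.inr _ ⟨even γ s + odd γ p⟩⟩⟩

/-- An even coefficient is kept and an odd one is multiplied by ω = ef. As ω anticommutes with e and
f, the modified odd elements commute with the generators; as ω² = -1, the sign in the product of two
odd elements of the graded opposite disappears. What remains is the product of 2 × 2 matrices over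
the ungraded opposite, in the basis 1, e, f, ef. -/
theorem cliffordElt_mul (p q r s p' q' r' s' : A) :
    cliffordElt γ p q r s * cliffordElt γ p' q' r' s' =
      cliffordElt γ (p' * p + q' * q + r' * r - s' * s) (q' * p + p' * q - s' * r + r' * s)
        (r' * p + p' * r + s' * q - q' * s) (s' * p + p' * s + r' * q - q' * r) := by
  rw [cliffordElt, cliffordElt, Cl.mk_mul_mk]
  simp only [cliffordElt, γ.selfOp.plus_inr, NGrading.selfOp_hom, ← map_mul, ← map_add, ← map_sub]
  congr 3 <;> apply GrOp.ext <;>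
    simp only [unop_add, unop_mul, unop_sub, even_add, odd_add, even_sub, odd_sub, even_even,
      even_odd, odd_even, odd_odd, map_add, map_sub, hom_even, hom_odd, GrOp.even_neg,
      GrOp.odd_neg, even_mul, odd_mul] <;>
    noncomm_ring

theorem cliffordElt_add (p q r s p' q' r' s' : A) :
    cliffordElt γ p q r s + cliffordElt γ p' q' r' s' =
      cliffordElt γ (p + p') (q + q') (r + r') (s + s') := by
  apply Cl.ext <;> apply Cl.ext
  · refine (map_add (Plus.inr (GrOp γ)) _ _).symm.trans (congrArg _ (GrOp.ext ?_))
    change even γ p - odd γ s + (even γ p' - odd γ s') = even γ (p + p') - odd γ (s + s')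
    rw [even_add, odd_add]
    abel
  · refine (map_add (Plus.inr (GrOp γ)) _ _).symm.trans (congrArg _ (GrOp.ext ?_))
    change even γ q + odd γ r + (even γ q' + odd γ r') = even γ (q + q') + odd γ (r + r')
    rw [even_add, odd_add]
    abel
  · refine (map_add (Plus.inr (GrOp γ)) _ _).symm.trans (congrArg _ (GrOp.ext ?_))
    change even γ r - odd γ q + (even γ r' - odd γ q') = even γ (r + r') - odd γ (q + q')
    rw [even_add, odd_add]
    abel
  · refine (map_add (Plus.inr (GrOp γ)) _ _).symm.trans (congrArg _ (GrOp.ext ?_))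
    change even γ s + odd γ p + (even γ s' + odd γ p') = even γ (s + s') + odd γ (p + p')
    rw [even_add, odd_add]
    abel

theorem cliffordElt_hom (p q r s : A) :
    γ.selfOp.plus.cl.cl.hom (cliffordElt γ p q r s) =
      cliffordElt γ (γ.hom p) (-γ.hom q) (-γ.hom r) (γ.hom s) := by
  rw [cliffordElt, cliffordElt, Grading.cl_cl_hom]
  simp only [γ.selfOp.plus_inr, NGrading.selfOp_hom, ← map_neg]
  congr 3 <;> apply GrOp.ext <;>
    simp only [unop_neg, map_add, map_sub, map_neg, hom_even, hom_odd, even_hom, odd_hom,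
      GrOp.even_neg, GrOp.odd_neg] <;>
    abel

/-- The element of `Cl₊₂ ⊗ A^op` which corresponds to a matrix over `Aᵒᵖ`. -/
def cliffordMat (m : Matrix (Fin 2) (Fin 2) Aᵐᵒᵖ) : Cl γ.selfOp.plus.cl :=
  cliffordElt γ ((2⁻¹ : ℝ) • ((m 0 0).unop + (m 1 1).unop))
    ((2⁻¹ : ℝ) • ((m 0 0).unop - (m 1 1).unop)) ((2⁻¹ : ℝ) • ((m 0 1).unop + (m 1 0).unop))
    ((2⁻¹ : ℝ) • ((m 0 1).unop - (m 1 0).unop))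

theorem cliffordMat_add (m n : Matrix (Fin 2) (Fin 2) Aᵐᵒᵖ) :
    cliffordMat γ (m + n) = cliffordMat γ m + cliffordMat γ n := by
  rw [cliffordMat, cliffordMat, cliffordMat, cliffordElt_add]
  congr 1 <;> simp only [Matrix.add_apply, MulOpposite.unop_add] <;> module

theorem cliffordMat_zero : cliffordMat γ (0 : Matrix (Fin 2) (Fin 2) Aᵐᵒᵖ) = 0 := by
  have h := cliffordMat_add γ 0 0
  rwa [add_zero, left_eq_add] at h

theorem cliffordMat_mul (m n : Matrix (Fin 2) (Fin 2) Aᵐᵒᵖ) :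
    cliffordMat γ (m * n) = cliffordMat γ m * cliffordMat γ n := by
  rw [cliffordMat, cliffordMat, cliffordMat, cliffordElt_mul]
  congr 1 <;>
    simp only [Matrix.mul_apply, Fin.sum_univ_two, MulOpposite.unop_add, MulOpposite.unop_mul,
      smul_mul_assoc, mul_smul_comm, mul_add, add_mul, mul_sub, sub_mul] <;>
    module

/-- The hyperbolic matrix for -1 is the quarter rotation ef. Conjugation by it fixes 1 and ef and
negates e and f, just as the grading of Cl₊₂ does. So the Clifford side needs no P₀ other than 1. -/
theorem cliffordMat_flip (m : Matrix (Fin 2) (Fin 2) Aᵐᵒᵖ) :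
    γ.selfOp.plus.cl.cl.hom (cliffordMat γ (flip γ.mop (-1) m)) = cliffordMat γ m := by
  rw [cliffordMat, cliffordMat, cliffordElt_hom]
  congr 1 <;> simp [flip_apply, NGrading.mop, γ.invol]
  · rw [add_comm]
  · rw [← smul_neg, neg_sub]
  · module

/-- The matrix over `Aᵒᵖ` which corresponds to an element of `Cl₊₂ ⊗ A^op`. -/
def matClifford (x : Cl γ.selfOp.plus.cl) : Matrix (Fin 2) (Fin 2) Aᵐᵒᵖ :=
  let a := x.fst.fst.snd.unop
  let b := x.fst.snd.snd.unop
  let c := x.snd.fst.snd.unop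
  let d := x.snd.snd.snd.unop
  !![.op (even γ a + odd γ d + (even γ b - odd γ c)),
    .op (even γ c + odd γ b + (even γ d - odd γ a));
    .op (even γ c + odd γ b - (even γ d - odd γ a)),
    .op (even γ a + odd γ d - (even γ b - odd γ c))]

theorem matClifford_cliffordMat (m : Matrix (Fin 2) (Fin 2) Aᵐᵒᵖ) :
    matClifford γ (cliffordMat γ m) = m := by
  have h : ∀ p q r s : A, matClifford γ (cliffordElt γ p q r s) =
      !![.op (p + q), .op (r + s); .op (r - s), .op (p - q)] := fun p q r s => by
    change !![_, _; _, _] = _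
    change !![MulOpposite.op (even γ (even γ p - odd γ s) + odd γ (even γ s + odd γ p) +
        (even γ (even γ q + odd γ r) - odd γ (even γ r - odd γ q))),
      MulOpposite.op (even γ (even γ r - odd γ q) + odd γ (even γ q + odd γ r) +
        (even γ (even γ s + odd γ p) - odd γ (even γ p - odd γ s)));
      MulOpposite.op (even γ (even γ r - odd γ q) + odd γ (even γ q + odd γ r) -
        (even γ (even γ s + odd γ p) - odd γ (even γ p - odd γ s))),
      MulOpposite.op (even γ (even γ p - odd γ s) + odd γ (even γ s + odd γ p) -
        (even γ (even γ q + odd γ r) - odd γ (even γ r - odd γ q)))] = _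
    simp only [even_even_add_odd, odd_even_add_odd, even_even_sub_odd, odd_even_sub_odd,
      sub_neg_eq_add, even_add_odd]
  rw [cliffordMat, h]
  ext i j
  apply MulOpposite.unop_injective
  fin_cases i <;> fin_cases j <;> simp <;> module

/-- The hypothesis kills the scalar parts of all four coordinates; on the parts in `A` the even and
odd components recombine. -/
theorem cliffordMat_matClifford (x : Cl γ.selfOp.plus.cl)
    (hx : γ.selfOp.augmentation.cl.cl.hom x = 0) : cliffordMat γ (matClifford γ x) = x := by
  obtain ⟨⟨a, b⟩, ⟨c, d⟩⟩ := x
  have ha : a.fst = 0 := congrArg (fun x => x.fst.fst) hx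
  have hb : b.fst = 0 := congrArg (fun x => x.fst.snd) hx
  have hc : c.fst = 0 := congrArg (fun x => x.snd.fst) hx
  have hd : d.fst = 0 := congrArg (fun x => x.snd.snd) hx
  have h : ∀ p q r s : A, cliffordMat γ !![.op (p + q), .op (r + s); .op (r - s), .op (p - q)] =
      cliffordElt γ p q r s := fun p q r s => by
    rw [cliffordMat]
    congr 1 <;> simp <;> module
  rw [matClifford, h]
  apply Cl.ext <;> apply Cl.ext <;> apply Plus.ext
  · exact ha.symm
  · apply GrOp.ext
    change even γ (even γ a.snd.unop + odd γ d.snd.unop) -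
      odd γ (even γ d.snd.unop - odd γ a.snd.unop) = a.snd.unop
    rw [even_even_add_odd, odd_even_sub_odd, sub_neg_eq_add, even_add_odd]
  · exact hb.symm
  · apply GrOp.ext
    change even γ (even γ b.snd.unop - odd γ c.snd.unop) +
      odd γ (even γ c.snd.unop + odd γ b.snd.unop) = b.snd.unop
    rw [even_even_sub_odd, odd_even_add_odd, even_add_odd]
  · exact hc.symm
  · apply GrOp.ext
    change even γ (even γ c.snd.unop + odd γ b.snd.unop) -
      odd γ (even γ b.snd.unop - odd γ c.snd.unop) = c.snd.unop
    rw [even_even_add_odd, odd_even_sub_odd, sub_neg_eq_add, even_add_odd]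
  · exact hd.symm
  · apply GrOp.ext
    change even γ (even γ d.snd.unop - odd γ a.snd.unop) +
      odd γ (even γ a.snd.unop + odd γ d.snd.unop) = d.snd.unop
    rw [even_even_sub_odd, odd_even_add_odd, even_add_odd]

theorem continuous_cliffordMat : Continuous (cliffordMat γ) := by
  have hu : ∀ i j, Continuous fun m : Matrix (Fin 2) (Fin 2) Aᵐᵒᵖ => (m i j).unop := fun i j =>
    MulOpposite.continuous_unop.comp (continuous_id.matrix_elem i j)
  have h₀ := hu 0 0
  have h₁ := hu 0 1
  have h₂ := hu 1 0
  have h₃ := hu 1 1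
  have he := continuous_even γ
  have ho := continuous_odd γ
  have hi := (Plus.continuous_inr (A := GrOp γ)).comp continuous_op
  refine Cl.continuous_mk (Cl.continuous_mk (hi.comp ?_) (hi.comp ?_))
    (Cl.continuous_mk (hi.comp ?_) (hi.comp ?_)) <;> fun_prop

theorem continuous_matClifford : Continuous (matClifford γ) := by
  have hs := continuous_unop.comp (Plus.continuous_snd (A := GrOp γ))
  have ha := hs.comp (Cl.continuous_fst.comp (Cl.continuous_fst (γ := γ.selfOp.plus.cl)))
  have hb := hs.comp (Cl.continuous_snd.comp (Cl.continuous_fst (γ := γ.selfOp.plus.cl)))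
  have hc := hs.comp (Cl.continuous_fst.comp (Cl.continuous_snd (γ := γ.selfOp.plus.cl)))
  have hd := hs.comp (Cl.continuous_snd.comp (Cl.continuous_snd (γ := γ.selfOp.plus.cl)))
  have he := continuous_even γ
  have ho := continuous_odd γ
  refine continuous_matrix fun i j => ?_
  fin_cases i <;> fin_cases j
  · exact MulOpposite.continuous_op.comp
      (((he.comp ha).add (ho.comp hd)).add ((he.comp hb).sub (ho.comp hc)))
  · exact MulOpposite.continuous_op.comp
      (((he.comp hc).add (ho.comp hb)).add ((he.comp hd).sub (ho.comp ha)))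
  · exact MulOpposite.continuous_op.comp
      (((he.comp hc).add (ho.comp hb)).sub ((he.comp hd).sub (ho.comp ha)))
  · exact MulOpposite.continuous_op.comp
      (((he.comp ha).add (ho.comp hd)).sub ((he.comp hb).sub (ho.comp hc)))

/-- The matrices over `Aᵒᵖ` inside `Cl₊₂ ⊗ (A^op)₊`. -/
def cliffordChart : Chart γ.selfOp.augmentation.cl.cl γ.selfOp.unitHom.cl.cl
    (1 : Matrix Unit Unit (Cl Grading.real.cl)) (flip γ.mop (-1)) where
  j :=
    { toFun := fun m => .of fun _ _ => cliffordMat γ m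
      map_zero' := by ext1 i j; exact cliffordMat_zero γ
      map_add' := fun m n => by ext1 i j; exact cliffordMat_add γ m n
      map_mul' := fun m n => by
        ext1 i j
        rw [Matrix.mul_apply, Fintype.sum_unique]
        exact cliffordMat_mul γ m n }
  continuous_j := continuous_matrix fun _ _ => continuous_cliffordMat γ
  q x := matClifford γ (x () ())
  continuous_q := (continuous_matClifford γ).comp (continuous_id.matrix_elem () ())
  q_j := matClifford_cliffordMat γ
  j_q x hx := by
    ext1 i j
    exact cliffordMat_matClifford γ _ (congrFun₂ hx () ())
  map_j m := by
    ext1 i j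
    rfl
  j_α m := by
    rw [Matrix.map_one _ (map_zero _) (map_one _), one_mul, mul_one]
    ext1 i j
    exact cliffordMat_flip γ m

/-- The group `K₂` of the graded opposite is presented by matrices over `A`. -/
def cliffordPresentation : Presentation (flip γ (-1)) γ.selfOp.K₂ :=
  ((cliffordChart γ).presentation one_mem_skewMat
    (cofinal_cl _ (Matrix.map_one _ (map_zero _) (map_one _))) (cofinal_cl _ rfl)
    fun _ => rfl).ofMop

/-- `SPT^A ≅ K₂(A^op)`. -/
theorem NGrading.nonempty_SPT_equiv_K₂ : Nonempty (γ.SPT ≃+ γ.selfOp.K₂) :=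
  (plusPresentation γ (-1)).nonempty_addEquiv (cliffordPresentation γ)

end CliffordChart

end GradedK

end

noncomputable section

namespace GradedK

/-! ### Unit charge of the graded opposite. -/

section GrOpCharge

variable {A : Type u} [NonUnitalRing A] [Module ℝ A] [IsScalarTower ℝ A A] [SMulCommClass ℝ A A]
  [TopologicalSpace A] [IsTopologicalRing A] [ContinuousSMul ℝ A]

open GrOp

/-- The graded opposite with respect to `c` of an algebra of unit charge. -/
def UnitCharge.grOp {c θ : NGrading A} (I : UnitCharge c θ)
    (h : ∀ a, c.hom (θ.hom a) = θ.hom (c.hom a)) : UnitCharge c.selfOp (c.grOp θ h) where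
  -- Left and right multiplication by i trade places in the opposite. No sign appears, since `c`
  -- fixes i.
  left :=
    { toFun := fun x => ⟨I.right x.unop⟩
      map_add' := fun x y => GrOp.ext (map_add I.right _ _)
      map_smul' := fun r x => GrOp.ext (map_smul I.right _ _) }
  right :=
    { toFun := fun x => ⟨I.left x.unop⟩
      map_add' := fun x y => GrOp.ext (map_add I.left _ _)
      map_smul' := fun r x => GrOp.ext (map_smul I.left _ _) }
  continuous_left := continuous_op.comp (I.continuous_right.comp continuous_unop)
  continuous_right := continuous_op.comp (I.continuous_left.comp continuous_unop)
  left_mul x y := GrOp.ext <| by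
    change I.right (even c y.unop * x.unop + odd c y.unop * c.hom x.unop) =
      even c y.unop * I.right x.unop + odd c y.unop * c.hom (I.right x.unop)
    rw [map_add, I.right_mul, I.right_mul, I.c_right]
  right_mul x y := GrOp.ext <| by
    change I.left (even c y.unop * x.unop + odd c y.unop * c.hom x.unop) =
      even c (I.left y.unop) * x.unop + odd c (I.left y.unop) * c.hom x.unop
    simp only [map_add, I.left_mul, even, odd, map_smul, map_sub, I.c_left]
  mul_left x y := GrOp.ext <| by
    change even c (I.right y.unop) * x.unop + odd c (I.right y.unop) * c.hom x.unop =
      even c y.unop * I.left x.unop + odd c y.unop * c.hom (I.left x.unop)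
    simp only [I.mul_left, I.c_left, even, odd, map_add, map_smul, map_sub, I.c_right]
  left_left x := GrOp.ext (I.right_right x.unop)
  right_right x := GrOp.ext (I.left_left x.unop)
  left_eq x := GrOp.ext <| by
    change I.right x.unop = I.left (c.hom (θ.hom x.unop))
    rw [I.left_eq, I.comm, c.invol, θ.invol]
  c_left x := GrOp.ext (I.c_right x.unop)
  c_right x := GrOp.ext (I.c_left x.unop)
  θ_left x := GrOp.ext (I.θ_right x.unop)
  θ_right x := GrOp.ext (I.θ_left x.unop)
  comm x := GrOp.ext (h x.unop)

end GrOpCharge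

open MeasureTheory

/-! ### The imaginary unit as a multiplier of the twisted group algebra. -/

namespace FreedMooreGroup

variable {G : Type u} [Group G] [TopologicalSpace G] {X : FreedMooreGroup G} {s : X.Section}

theorem CovRep.I_mem_unitary (ρ : CovRep s) : ρ.I ∈ unitary (E →L[ℝ] E) := by
  rw [Unitary.mem_iff, ρ.star_I, neg_mul, mul_neg, ρ.I_mul_I, neg_neg]
  exact ⟨rfl, rfl⟩

theorem CovRep.π_I_mul (ρ : CovRep s) (z : ℂ) : ρ.π (Complex.I * z) = ρ.I * ρ.π z := by
  simp only [CovRep.π, Complex.I_mul_re, Complex.I_mul_im, mul_add, mul_smul_comm, mul_one,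
    ρ.I_mul_I]
  module

theorem CovRep.π_mul_I (ρ : CovRep s) (z : ℂ) : ρ.π z * ρ.I = ρ.I * ρ.π z := by
  simp only [CovRep.π, mul_add, add_mul, mul_smul_comm, smul_mul_assoc, mul_one, one_mul]

namespace Families

/-- The family of the operators `π(i)`. -/
def imag (s : X.Section) : Families s :=
  ⟨fun ρ => ρ.I, memℓp_infty ⟨‖(1 : E →L[ℝ] E)‖, by
    rintro _ ⟨ρ, rfl⟩
    have := CStarRing.norm_mem_unitary_mul (1 : E →L[ℝ] E) ρ.I_mem_unitary
    rw [mul_one] at this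
    exact this.le⟩⟩

theorem imag_apply (ρ : CovRep s) : (imag s).apply ρ = ρ.I := rfl

theorem mul_apply (a b : Families s) (ρ : CovRep s) :
    (a * b).apply ρ = a.apply ρ * b.apply ρ := rfl

theorem neg_apply (a : Families s) (ρ : CovRep s) : (-a).apply ρ = -a.apply ρ := rfl

theorem imag_mul_imag_mul (a : Families s) : imag s * (imag s * a) = -a := by
  ext1 ρ
  rw [mul_apply, mul_apply, imag_apply, ← mul_assoc, ρ.I_mul_I, neg_one_mul, neg_apply]

theorem mul_imag_mul_imag (a : Families s) : a * imag s * imag s = -a := by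
  ext1 ρ
  rw [mul_apply, mul_apply, imag_apply, mul_assoc, ρ.I_mul_I, mul_neg_one, neg_apply]

theorem star_imag : star (imag s) = -imag s := by
  ext1 ρ
  exact ρ.star_I

/-- The automorphism of the families of operators induced by `φ = c + θ`. -/
def twistφ (s : X.Section) : Families s →⋆ₙₐ[ℝ] Families s :=
  (twist X.c X.continuous_c).comp (twist X.θ X.continuous_θ)

theorem twistφ_apply (a : Families s) :
    twistφ s a = twist X.c X.continuous_c (twist X.θ X.continuous_θ a) := rfl

theorem twistφ_twistφ (a : Families s) : twistφ s (twistφ s a) = a := by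
  rw [twistφ_apply, twistφ_apply, twist_comm X.θ X.c, twist_twist, twist_twist]

theorem twistφ_imag : twistφ s (imag s) = imag s := rfl

theorem continuous_twistφ : Continuous (twistφ s) :=
  (continuous_twist _ _).comp (continuous_twist _ _)

end Families

open Families

variable [IsTopologicalGroup G] [LocallyCompactSpace G]

/-- The operator π(i) is moved to the other argument of the inner product, where the weak integral
for `f` applies. -/
theorem IsIntegratedForm.imag_mul {f : X.H → ℂ} {a : Families s} (h : IsIntegratedForm f a) :
    IsIntegratedForm (fun g => Complex.I * f g) (imag s * a) := fun ρ x y => by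
  have hI : ∀ z w : E, inner ℝ z (ρ.I w) = inner ℝ (star ρ.I z) w := fun z w =>
    (ContinuousLinearMap.adjoint_inner_left _ _ _).symm
  have := h ρ (star ρ.I x) y
  simp only [← hI] at this
  simp only [CovRep.π_I_mul]
  exact this

theorem imag_mul_mem_integratedForms {a : Families s} (h : a ∈ integratedForms s) :
    imag s * a ∈ integratedForms s := by
  obtain ⟨f, hf, h⟩ := h
  exact ⟨_, hf.const_mul Complex.I, h.imag_mul⟩

/-- Covariance v_h π(i) = φ(h) π(i) v_h under the integral: moving i from the right of v_h to the
left costs the sign φ(h), which the twist by φ supplies once more. -/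
theorem imag_mul_of_mem_integratedForms {a : Families s} (h : a ∈ integratedForms s) :
    imag s * a = twistφ s a * imag s := by
  obtain ⟨f, hf, h⟩ := h
  ext1 ρ
  refine ContinuousLinearMap.ext fun y => ext_inner_left ℝ fun x => ?_
  refine (h.imag_mul ρ x y).trans (Eq.symm ?_)
  refine (h ((ρ.twist X.c X.continuous_c).twist X.θ X.continuous_θ) x (ρ.I y)).trans ?_
  congr 1
  ext g
  rw [ρ.π_I_mul, ← ρ.π_mul_I]
  change inner ℝ x (ρ.π (f g) (((X.descend X.θ g : ℤ) • (X.descend X.c g : ℤ) • ρ.v g) (ρ.I y))) =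
    inner ℝ x (ρ.π (f g) ((ρ.I * ρ.v g) y))
  -- As signs c = θφ, so θcφ is a product of squares.
  have hφ : X.descend X.θ g * X.descend X.c g * X.descend X.φ g = 1 := by
    obtain ⟨g, rfl⟩ := QuotientGroup.mk'_surjective X.Q.range g
    change X.θ g * (X.θ g * X.φ g) * X.φ g = 1
    rw [← mul_assoc, Int.units_mul_self, one_mul, Int.units_mul_self]
  congr 2
  change (((X.descend X.θ g : ℤ) • (X.descend X.c g : ℤ) • ρ.v g) * ρ.I) y = _
  rw [smul_smul, smul_mul_assoc, ρ.v_mul_I, smul_smul, ← Units.val_mul, ← Units.val_mul, hφ,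
    Units.val_one, one_smul]

/-- The relation cuts out a closed *-subalgebra containing the generators. It is stable under `star`
because i* = -i and the twist is an involutive *-automorphism fixing i. -/
theorem imag_mul_of_mem {a : Families s} (h : a ∈ twistedGroupAlgebra s) :
    imag s * a = twistφ s a * imag s := by
  let S : NonUnitalStarSubalgebra ℝ (Families s) :=
    { carrier := {a | imag s * a = twistφ s a * imag s}
      add_mem' := fun {a b} ha hb => by
        change _ = _ at ha hb
        change imag s * (a + b) = _
        rw [mul_add, ha, hb, map_add, add_mul]
      zero_mem' := by
        change imag s * 0 = _
        rw [map_zero, mul_zero, zero_mul]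
      mul_mem' := fun {a b} ha hb => by
        change _ = _ at ha hb
        change imag s * (a * b) = _
        rw [← mul_assoc, ha, mul_assoc, hb, map_mul, mul_assoc]
      smul_mem' := fun r a ha => by
        change _ = _ at ha
        change imag s * (r • a) = _
        rw [mul_smul_comm, ha, map_smul, smul_mul_assoc]
      star_mem' := fun {a} ha => by
        change _ = _ at ha
        change imag s * star a = _
        have := congrArg (fun x => twistφ s (star x)) ha
        simp only [star_mul, star_imag, map_mul, map_neg, map_star, twistφ_twistφ,
          twistφ_imag, mul_neg, neg_mul, neg_inj] at this
        exact this.symm }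
  have hS : twistedGroupAlgebra s ≤ S :=
    NonUnitalStarSubalgebra.topologicalClosure_minimal _
      (NonUnitalStarAlgebra.adjoin_le fun b hb => imag_mul_of_mem_integratedForms hb)
      (isClosed_eq (continuous_const.mul continuous_id)
        (continuous_twistφ.mul continuous_const))
  exact hS h

theorem mul_imag_of_mem {a : Families s} (h : a ∈ twistedGroupAlgebra s) :
    a * imag s = twistφ s (imag s * a) := by
  rw [imag_mul_of_mem h, map_mul, twistφ_twistφ, twistφ_imag]

theorem twistφ_mem {a : Families s} (h : a ∈ twistedGroupAlgebra s) :
    twistφ s a ∈ twistedGroupAlgebra s := twist_mem _ _ (twist_mem _ _ h)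

/-- On generators, f becomes i f. For adjoints, i a* = -(a i)*, and the commutation relation turns a
i into the twist of i a, so that multiplication by i on the left suffices. -/
theorem imag_mul_mem {a : Families s} (h : a ∈ twistedGroupAlgebra s) :
    imag s * a ∈ twistedGroupAlgebra s := by
  let S : NonUnitalStarSubalgebra ℝ (Families s) :=
    { carrier := {a | a ∈ twistedGroupAlgebra s ∧ imag s * a ∈ twistedGroupAlgebra s}
      add_mem' := fun {a b} ha hb => ⟨add_mem ha.1 hb.1, by
        rw [mul_add]
        exact add_mem ha.2 hb.2⟩
      zero_mem' := ⟨zero_mem _, by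
        rw [mul_zero]
        exact zero_mem _⟩
      mul_mem' := fun {a b} ha hb => ⟨mul_mem ha.1 hb.1, by
        rw [← mul_assoc]
        exact mul_mem ha.2 hb.1⟩
      smul_mem' := fun r a ha => ⟨SMulMemClass.smul_mem r ha.1, by
        rw [mul_smul_comm]
        exact SMulMemClass.smul_mem r ha.2⟩
      star_mem' := fun {a} ha => ⟨star_mem ha.1, by
        have := neg_mem (star_mem (twistφ_mem ha.2))
        rwa [← mul_imag_of_mem ha.1, star_mul, star_imag, neg_mul, neg_neg] at this⟩ }
  have hS : twistedGroupAlgebra s ≤ S := by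
    have hc : IsClosed (twistedGroupAlgebra s : Set (Families s)) :=
      NonUnitalStarSubalgebra.isClosed_topologicalClosure _
    refine NonUnitalStarSubalgebra.topologicalClosure_minimal _
      (NonUnitalStarAlgebra.adjoin_le fun b hb => ⟨?_, ?_⟩)
      (hc.inter (hc.preimage (continuous_const.mul continuous_id)))
    · exact NonUnitalStarSubalgebra.le_topologicalClosure _
        (NonUnitalStarAlgebra.subset_adjoin ℝ _ hb)
    · exact NonUnitalStarSubalgebra.le_topologicalClosure _
        (NonUnitalStarAlgebra.subset_adjoin ℝ _ (imag_mul_mem_integratedForms hb))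
  exact (hS h).2

theorem mul_imag_mem {a : Families s} (h : a ∈ twistedGroupAlgebra s) :
    a * imag s ∈ twistedGroupAlgebra s := by
  rw [mul_imag_of_mem h]
  exact twistφ_mem (imag_mul_mem h)

/-- Multiplication by `i` on the unit charge twisted group algebra. -/
def Section.unitCharge (s : X.Section) : UnitCharge s.gradingC s.gradingθ where
  left :=
    { toFun := fun a => ⟨imag s * a, imag_mul_mem a.2⟩
      map_add' := fun _ _ => Subtype.ext (mul_add _ _ _)
      map_smul' := fun _ _ => Subtype.ext (mul_smul_comm _ _ _) }
  right :=
    { toFun := fun a => ⟨a * imag s, mul_imag_mem a.2⟩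
      map_add' := fun _ _ => Subtype.ext (add_mul _ _ _)
      map_smul' := fun _ _ => Subtype.ext (smul_mul_assoc _ _ _) }
  continuous_left := (continuous_const.mul continuous_subtype_val).subtype_mk _
  continuous_right := (continuous_subtype_val.mul continuous_const).subtype_mk _
  left_mul _ _ := Subtype.ext (mul_assoc _ _ _).symm
  right_mul _ _ := Subtype.ext (mul_assoc _ _ _)
  mul_left _ _ := Subtype.ext (mul_assoc _ _ _).symm
  left_left _ := Subtype.ext (imag_mul_imag_mul _)
  right_right _ := Subtype.ext (mul_imag_mul_imag _)
  left_eq a := Subtype.ext (imag_mul_of_mem a.2)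
  c_left _ := Subtype.ext (map_mul (twist X.c X.continuous_c) _ _)
  c_right _ := Subtype.ext (map_mul (twist X.c X.continuous_c) _ _)
  θ_left _ := Subtype.ext (map_mul (twist X.θ X.continuous_θ) _ _)
  θ_right _ := Subtype.ext (map_mul (twist X.θ X.continuous_θ) _ _)
  comm := s.gradingC_gradingθ

end FreedMooreGroup

end GradedK

end

/-- K₀ is taken over A° in the first half but over `B` itself in the second; the extra transposition
needed there is built into `nonempty_K₀_equiv_SPT`. The comparison of SPT with K₂ holds for any
graded algebra, without unit charge. -/
theorem mainTheorem2 {G : Type u} [Group G] [TopologicalSpace G] [IsTopologicalGroup G]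
    [T2Space G] [SecondCountableTopology G] [LocallyCompactSpace G]
    (X : GradedK.FreedMooreGroup G) (s : X.Section) :
    (Nonempty (s.gradingC.mop.K₀ ≃+ s.gradingθ.SPT) ∧
      Nonempty (s.gradingθ.SPT ≃+ s.gradingθ.selfOp.K₂)) ∧
    (Nonempty (s.gradingOpC.K₀ ≃+ s.gradingOpθ.SPT) ∧
      Nonempty (s.gradingOpθ.SPT ≃+ s.gradingOpθ.selfOp.K₂)) :=
  ⟨⟨s.unitCharge.nonempty_mop_K₀_equiv_SPT, s.gradingθ.nonempty_SPT_equiv_K₂⟩,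
    ⟨(s.unitCharge.grOp s.gradingC_gradingθ).nonempty_K₀_equiv_SPT,
      s.gradingOpθ.nonempty_SPT_equiv_K₂⟩⟩
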